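/- **Theorem.** Let $\mathfrak g$ be a finite-dimensional simple complex Lie algebra and let $\overline{\mathfrak g}=\mathfrak g\otimes\mathbb C[z,z^{-1}]$ be the classical current algebra, with bracket $[x\otimes z^n,y\otimes z^m]=[x,y]\otimes z^{n+m}$. *Definitions.* Let $L$ be a complex Lie algebra and $A$ a commutative $\mathbb C$-algebra with an augmentation $\varepsilon:A\to\mathbb C$. A deformation of $L$ over $(A,\varepsilon)$ is an $A$-bilinear Lie bracket on $A\otimes L$ for which $\varepsilon\otimes\mathrm{id}:A\otimes L\to L$ is a homomorphism of Lie algebras. If $A$ is a complete local algebra with maximal ideal $m=\ker\varepsilon$ and $\dim m^k/m^{k+1}<\infty$ for all $k$, a formal deformation is defined in the same way on the completed tensor product $A\hat\otimes L=\varprojlim_n (A/m^n)\otimes L$. Two deformations over the same base are equivalent if there is an $A$-linear Lie algebra isomorphism between them compatible with the map to $L$; the trivial deformation has $[a\otimes x,b\otimes y]=ab\otimes[x,y]$. An analytic family of Lie brackets on $L$ over a finite-dimensional complex analytic manifold $M$ with base point $x_0$ consists of Lie brackets $\mu_t$ on the vector space $L$ $(t\in M)$ such that $\mu_{x_0}$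 is the bracket of $L$ and, for all $x,y\in L$, the map $t\mapsto\mu_t(x,y)$ is locally a finite sum $\sum_i f_i(t)\,l_i$ with $f_i$ analytic and $l_i\in L$; it is trivial on an open set $U\ni x_0$ if there are linear automorphisms $\varphi_t$ of $L$ $(t\in U)$, such that $\varphi_t$ and $\varphi_t^{-1}$ depend analytically on $t$ in the same sense, with $\varphi_{x_0}=\mathrm{id}$ and $\varphi_t([x,y])=\mu_t(\varphi_t x,\varphi_t y)$. $L$ is *formally rigid* if every formal deformation of $L$ is equivalent to the trivial one. It is *geometrically rigid* if for every deformation of $L$ over a finitely generated reduced $\mathbb C$-algebra $A$ with augmentation $\varepsilon$ there is an affine Zariski open neighbourhood $\mathrm{Spec}\,B\subseteq\mathrm{Spec}\,A$ of the point $\ker\varepsilon$ such that the push-out of the deformation to $B$ is equivalent to the trivial deformation. It is *analytically rigid* if every analytic family of Lie brackets on $L$ over a pointed finite-dimensional complex analytic manifold is trivial on some open neighbourhood of the base point. *Claims.* 1. $\overline{\mathfrak g}$ is formally rigid, but it is neither geometrically nor analytically rigid. 2. Write $A_n=z^n$ for $n\in\mathbb Z$. For every $s\in\mathbb C\cup\{\infty\}$,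 the $\mathbb C[e]$-bilinear bracket $\overline{\mathcal G}^s_{(e)}$ on $\mathbb C[e]\otimes\overline{\mathfrak g}$ given by $$[x\otimes A_n,y\otimes A_m]=\begin{cases}[x,y]\otimes A_{n+m}, & n\text{ or }m\text{ even},\\ [x,y]\otimes\bigl(A_{n+m}+p_s A_{n+m-2}+q_s A_{n+m-4}\bigr), & n\text{ and }m\text{ odd},\end{cases}$$ where $p_s=3e$ and $q_s=e^2(1-s)(2+s)$ for $s\in\mathbb C$, and $p_\infty=0$ and $q_\infty=-e$, is a deformation of $\overline{\mathfrak g}$ over $\mathbb C[e]$ with special fibre $\overline{\mathfrak g}$ at $e=0$. It is non-trivial on every neighbourhood of $e=0$: its push-out to any affine Zariski open neighbourhood $\mathrm{Spec}\,B$ of $0$ in the affine line is not equivalent to the trivial deformation; and its fibres form an analytic family of Lie brackets on $\overline{\mathfrak g}$ over $(\mathbb C,0)$ that is not trivial on any open neighbourhood of $0$ in $\mathbb C$ in the usual topology. (These families arise by restricting the family of Krichever–Novikov current algebras of the cubics $Y^2=4(X-e_1)(X-e_2)(X-e_3)$, $e_1+e_2+e_3=0$, with possible poles at $\infty$ and $(e_1,0)$,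 to the line $e_2=se_1$ with $e=e_1$, respectively to the line $e_1=0$ with $e=e_2^2$.) -/

import Mathlib

open scoped TensorProduct LaurentPolynomial Polynomial Manifold ContDiff Topology

noncomputable section

namespace CurrentRigidity

universe u v

/-! ## Lie structures over a base algebra -/

section Base

variable {K : Type u} [Field K] {A : Type u} [CommRing A] [Algebra K A]
variable {L : Type v} [LieRing L] [LieAlgebra K L]

/-- `μ` is an `A`-bilinear Lie bracket on the `A`-module `M` for which the map `p : M → L` is a
homomorphism of Lie algebras. Here `M` is a (completed) tensor product `A ⊗ L` and `p` the map
`ε ⊗ id` induced by an augmentation `ε` of `A`. -/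
structure IsDeformation {M : Type*} [AddCommGroup M] [Module K M] [Module A M]
    (p : M →ₗ[K] L) (μ : M →ₗ[A] M →ₗ[A] M) : Prop where
  alternating : ∀ X, μ X X = 0
  jacobi : ∀ X Y Z, μ X (μ Y Z) + μ Y (μ Z X) + μ Z (μ X Y) = 0
  map_bracket : ∀ X Y, p (μ X Y) = ⁅p X, p Y⁆

/-- Equivalence of two brackets on `M`: an `A`-linear isomorphism that takes one bracket to the
other and is compatible with the map `p` to the special fibre. -/
def IsEquivalent {M : Type*} [AddCommGroup M] [Module K M] [Module A M]
    (p : M →ₗ[K] L) (μ μ' : M →ₗ[A] M →ₗ[A] M) : Prop :=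
  ∃ φ : M ≃ₗ[A] M, (∀ X Y, φ (μ X Y) = μ' (φ X) (φ Y)) ∧ ∀ X, p (φ X) = p X

/-- The map `ε ⊗ id : A ⊗ L → K ⊗ L = L` of an augmentation `ε : A → K`. -/
def augmentation (L : Type v) [LieRing L] [LieAlgebra K L] (ε : A →ₐ[K] K) : A ⊗[K] L →ₗ[K] L :=
  (TensorProduct.lid K L).toLinearMap ∘ₗ TensorProduct.map ε.toLinearMap LinearMap.id

@[simp]
theorem augmentation_tmul (ε : A →ₐ[K] K) (a : A) (x : L) :
    augmentation L ε (a ⊗ₜ[K] x) = ε a • x := by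
  simp [augmentation]

/-- The `A`-bilinear extension to `A ⊗ L` of a `K`-bilinear map `L × L → A ⊗ L`. -/
def extendBilin (β : L →ₗ[K] L →ₗ[K] A ⊗[K] L) :
    A ⊗[K] L →ₗ[A] A ⊗[K] L →ₗ[A] A ⊗[K] L :=
  LinearMap.liftBaseChange A
    (((LinearMap.liftBaseChangeEquiv A (R := K) (M := L) (N := A ⊗[K] L)).restrictScalars
      K).toLinearMap ∘ₗ β)

@[simp]
theorem extendBilin_tmul (β : L →ₗ[K] L →ₗ[K] A ⊗[K] L) (a b : A) (x y : L) :
    extendBilin β (a ⊗ₜ[K] x) (b ⊗ₜ[K] y) = (a * b) • β x y := by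
  simp [extendBilin, mul_smul]

variable (K A L) in
/-- The trivially extended bracket `[a ⊗ x, b ⊗ y] = ab ⊗ [x, y]` on `A ⊗ L`. -/
def trivialBracket :
    A ⊗[K] L →ₗ[A] A ⊗[K] L →ₗ[A] A ⊗[K] L :=
  extendBilin ((LieModule.toEnd K L L : L →ₗ[K] L →ₗ[K] L).compr₂ (TensorProduct.mk K A L 1))

@[simp]
theorem trivialBracket_tmul (a b : A) (x y : L) :
    trivialBracket K A L (a ⊗ₜ[K] x) (b ⊗ₜ[K] y) = (a * b) ⊗ₜ[K] ⁅x, y⁆ := by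
  simp [trivialBracket, TensorProduct.smul_tmul']

/-- The push-out of a bracket on `A ⊗ L` along `f : A → B`: the `B`-bilinear bracket on
`B ⊗ L = B ⊗_A (A ⊗ L)` with `[1 ⊗ x, 1 ⊗ y] = (f ⊗ id) [1 ⊗ x, 1 ⊗ y]`. -/
def pushout {B : Type u} [CommRing B] [Algebra K B] (f : A →ₐ[K] B)
    (μ : A ⊗[K] L →ₗ[A] A ⊗[K] L →ₗ[A] A ⊗[K] L) :
    B ⊗[K] L →ₗ[B] B ⊗[K] L →ₗ[B] B ⊗[K] L :=
  extendBilin <| LinearMap.mk₂ K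
    (fun x y => TensorProduct.map f.toLinearMap LinearMap.id (μ (1 ⊗ₜ[K] x) (1 ⊗ₜ[K] y)))
    (fun x x' y => by simp [TensorProduct.tmul_add])
    (fun c x y => by
      rw [TensorProduct.tmul_smul, ← algebraMap_smul A c, map_smul, LinearMap.smul_apply,
        algebraMap_smul, map_smul])
    (fun x y y' => by simp [TensorProduct.tmul_add])
    (fun c x y => by
      rw [TensorProduct.tmul_smul, ← algebraMap_smul A c, map_smul, algebraMap_smul, map_smul])

theorem pushout_tmul {B : Type u} [CommRing B] [Algebra K B] (f : A →ₐ[K] B)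
    (μ : A ⊗[K] L →ₗ[A] A ⊗[K] L →ₗ[A] A ⊗[K] L) (b c : B) (x y : L) :
    pushout f μ (b ⊗ₜ[K] x) (c ⊗ₜ[K] y) =
      (b * c) • TensorProduct.map f.toLinearMap LinearMap.id (μ (1 ⊗ₜ[K] x) (1 ⊗ₜ[K] y)) := by
  simp [pushout]

/-- The bracket on `L` in the fibre of a family over the point given by an augmentation `ε`:
`(x, y) ↦ (ε ⊗ id) [1 ⊗ x, 1 ⊗ y]`. -/
def fiberBracket (ε : A →ₐ[K] K) (μ : A ⊗[K] L →ₗ[A] A ⊗[K] L →ₗ[A] A ⊗[K] L) :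
    L →ₗ[K] L →ₗ[K] L :=
  LinearMap.mk₂ K
    (fun x y => augmentation L ε (μ (1 ⊗ₜ[K] x) (1 ⊗ₜ[K] y)))
    (fun x x' y => by simp [TensorProduct.tmul_add])
    (fun c x y => by
      rw [TensorProduct.tmul_smul, ← algebraMap_smul A c, map_smul, LinearMap.smul_apply,
        algebraMap_smul, map_smul])
    (fun x y y' => by simp [TensorProduct.tmul_add])
    (fun c x y => by
      rw [TensorProduct.tmul_smul, ← algebraMap_smul A c, map_smul, algebraMap_smul, map_smul])

end Base

/-! ## Formal deformations -/

section Formal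

/-- The bilinear map induced by `μ` on the quotient `M ⧸ J M`. -/
def quotientBilin {A M : Type*} [CommRing A] [AddCommGroup M] [Module A M] (J : Ideal A)
    (μ : M →ₗ[A] M →ₗ[A] M) :
    (M ⧸ (J • ⊤ : Submodule A M)) →ₗ[A] (M ⧸ (J • ⊤ : Submodule A M)) →ₗ[A]
      (M ⧸ (J • ⊤ : Submodule A M)) :=
  Submodule.liftQ _
    { toFun := fun X => Submodule.mapQ _ _ (μ X) (Submodule.smul_top_le_comap_smul_top J (μ X))
      map_add' := fun X X' => by ext Y; simp
      map_smul' := fun a X => by ext Y; simp }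
    (by
      intro X hX
      rw [LinearMap.mem_ker]
      ext Y
      have h := Submodule.smul_top_le_comap_smul_top J (μ.flip Y) hX
      simpa using h)

theorem quotientBilin_mk {A M : Type*} [CommRing A] [AddCommGroup M] [Module A M] (J : Ideal A)
    (μ : M →ₗ[A] M →ₗ[A] M) (X Y : M) :
    quotientBilin J μ (Submodule.Quotient.mk X) (Submodule.Quotient.mk Y) =
      Submodule.Quotient.mk (μ X Y) := rfl

theorem transition_quotientBilin {A M : Type*} [CommRing A] [AddCommGroup M] [Module A M]
    (I : Ideal A) (μ : M →ₗ[A] M →ₗ[A] M) {m n : ℕ} (hmn : m ≤ n)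
    (X Y : M ⧸ (I ^ n • ⊤ : Submodule A M)) :
    AdicCompletion.transitionMap I M hmn (quotientBilin (I ^ n) μ X Y) =
      quotientBilin (I ^ m) μ (AdicCompletion.transitionMap I M hmn X)
        (AdicCompletion.transitionMap I M hmn Y) := by
  obtain ⟨X, rfl⟩ := Submodule.Quotient.mk_surjective _ X
  obtain ⟨Y, rfl⟩ := Submodule.Quotient.mk_surjective _ Y
  rw [quotientBilin_mk]
  simp only [AdicCompletion.transitionMap, Submodule.factorPow, Submodule.factor_mk, ← Submodule.mkQ_apply]
  rfl

/-- The pair of compatible sequences `ξ`, `η` is taken to the sequence of the brackets. -/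
def completedBilinFun {A M : Type*} [CommRing A] [AddCommGroup M] [Module A M] (I : Ideal A)
    (μ : M →ₗ[A] M →ₗ[A] M) (ξ η : AdicCompletion I M) : AdicCompletion I M :=
  ⟨fun n => quotientBilin (I ^ n) μ (ξ.val n) (η.val n), fun hmn =>
    (transition_quotientBilin I μ hmn _ _).trans
      (congrArg₂ (fun X Y => quotientBilin _ μ X Y) (ξ.property hmn) (η.property hmn))⟩

theorem completedBilinFun_val {A M : Type*} [CommRing A] [AddCommGroup M] [Module A M]
    (I : Ideal A) (μ : M →ₗ[A] M →ₗ[A] M) (ξ η : AdicCompletion I M) (n : ℕ) :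
    (completedBilinFun I μ ξ η).val n = quotientBilin (I ^ n) μ (ξ.val n) (η.val n) := rfl

/-- The bilinear map induced by `μ` on the completion `lim M ⧸ I ^ n M`. -/
def completedBilin {A M : Type*} [CommRing A] [AddCommGroup M] [Module A M] (I : Ideal A)
    (μ : M →ₗ[A] M →ₗ[A] M) :
    AdicCompletion I M →ₗ[A] AdicCompletion I M →ₗ[A] AdicCompletion I M :=
  LinearMap.mk₂ A (completedBilinFun I μ)
    (fun ξ ξ' η => AdicCompletion.ext fun n => by
      simp only [completedBilinFun_val, AdicCompletion.val_add_apply, map_add,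
        LinearMap.add_apply])
    (fun c ξ η => AdicCompletion.ext fun n => by
      simp only [completedBilinFun_val, AdicCompletion.val_smul_apply, map_smul,
        LinearMap.smul_apply])
    (fun ξ η η' => AdicCompletion.ext fun n => by
      simp only [completedBilinFun_val, AdicCompletion.val_add_apply, map_add])
    (fun c ξ η => AdicCompletion.ext fun n => by
      simp only [completedBilinFun_val, AdicCompletion.val_smul_apply, map_smul])

variable {K : Type u} [Field K] {A : Type u} [CommRing A] [Algebra K A]

/-- The completed tensor product `lim (A ⧸ m ^ n) ⊗ L`, as the completion of `A ⊗ L` with respect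
to the kernel `m` of the augmentation `ε`. -/
abbrev CompletedTensor (L : Type v) [LieRing L] [LieAlgebra K L] (ε : A →ₐ[K] K) : Type _ :=
  AdicCompletion (RingHom.ker ε) (A ⊗[K] L)

theorem augmentation_eq_zero (L : Type v) [LieRing L] [LieAlgebra K L] (ε : A →ₐ[K] K) :
    (((RingHom.ker ε) ^ 1 • ⊤ : Submodule A (A ⊗[K] L)).restrictScalars K) ≤
      LinearMap.ker (augmentation L ε) := by
  have key : ∀ (a : A) (X : A ⊗[K] L), augmentation L ε (a • X) = ε a • augmentation L ε X := by
    intro a X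
    induction X using TensorProduct.induction_on with
    | zero => simp
    | tmul b x => simp [TensorProduct.smul_tmul', mul_smul]
    | add X Y hX hY => simp [hX, hY]
  intro X hX
  rw [Submodule.restrictScalars_mem, pow_one] at hX
  rw [LinearMap.mem_ker]
  refine Submodule.smul_induction_on hX ?_ ?_
  · intro a ha Y _
    rw [key, (RingHom.mem_ker).1 ha, zero_smul]
  · intro X Y hX hY
    rw [map_add, hX, hY, add_zero]

/-- The completed augmentation from the completed tensor product to `L`. -/
def completedAugmentation (L : Type v) [LieRing L] [LieAlgebra K L] (ε : A →ₐ[K] K) :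
    CompletedTensor L ε →ₗ[K] L :=
  (Submodule.liftQ _ (augmentation L ε) (augmentation_eq_zero L ε)) ∘ₗ
    (Submodule.Quotient.restrictScalarsEquiv K
      ((RingHom.ker ε) ^ 1 • ⊤ : Submodule A (A ⊗[K] L))).symm.toLinearMap ∘ₗ
    (AdicCompletion.eval (RingHom.ker ε) (A ⊗[K] L) 1).restrictScalars K

theorem completedAugmentation_of (L : Type v) [LieRing L] [LieAlgebra K L] (ε : A →ₐ[K] K)
    (X : A ⊗[K] L) :
    completedAugmentation L ε (AdicCompletion.of (RingHom.ker ε) (A ⊗[K] L) X) =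
      augmentation L ε X := rfl

theorem completedBilin_of {A M : Type*} [CommRing A] [AddCommGroup M] [Module A M] (I : Ideal A)
    (μ : M →ₗ[A] M →ₗ[A] M) (X Y : M) :
    completedBilin I μ (AdicCompletion.of I M X) (AdicCompletion.of I M Y) =
      AdicCompletion.of I M (μ X Y) := by
  refine AdicCompletion.ext fun n => ?_
  rw [completedBilin, LinearMap.mk₂_apply, completedBilinFun_val]
  exact quotientBilin_mk _ μ X Y

/-- Formal rigidity: every formal deformation over a complete local algebra `A` with maximal ideal
`m`, residue field `K` and finite-dimensional `m ^ k ⧸ m ^ (k + 1)` is equivalent to the trivial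
one. Every such `A` is a quotient of a power series ring in finitely many variables over `K`, so
algebras in the universe of `K` suffice. -/
def IsFormallyRigid (K : Type u) [Field K] (L : Type v) [LieRing L] [LieAlgebra K L] : Prop :=
  ∀ (A : Type u) [CommRing A] [IsLocalRing A] [Algebra K A] (ε : A →ₐ[K] K),
    IsAdicComplete (IsLocalRing.maximalIdeal A) A →
    (∀ k : ℕ, Module.Finite K
      (↥(IsLocalRing.maximalIdeal A ^ k) ⧸
        (IsLocalRing.maximalIdeal A ^ (k + 1)).submoduleOf (IsLocalRing.maximalIdeal A ^ k))) →
    ∀ μ : CompletedTensor L ε →ₗ[A] CompletedTensor L ε →ₗ[A] CompletedTensor L ε,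
      IsDeformation (completedAugmentation L ε) μ →
      IsEquivalent (completedAugmentation L ε) μ
        (completedBilin (RingHom.ker ε) (trivialBracket K A L))

end Formal

/-! ## Geometric rigidity -/

section Geometric

variable {K : Type u} [Field K] {A B : Type u} [CommRing A] [Algebra K A] [CommRing B] [Algebra K B]

/-- `f : A → B` exhibits `Spec B`, with the point `ε'`, as an affine open neighbourhood of the
point `ε` in `Spec A`. -/
def IsAffineNeighbourhood (ε : A →ₐ[K] K) (f : A →ₐ[K] B) (ε' : B →ₐ[K] K) : Prop :=
  AlgebraicGeometry.IsOpenImmersion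
    (AlgebraicGeometry.Spec.map (CommRingCat.ofHom (f : A →+* B))) ∧
  ε'.comp f = ε

/-- Geometric rigidity: every deformation over a pointed affine variety becomes equivalent to the
trivial one on an affine open neighbourhood of the base point. The base point, a maximal ideal with
residue field `K`, is given by its augmentation. -/
def IsGeometricallyRigid (K : Type u) [Field K] (L : Type v) [LieRing L] [LieAlgebra K L] : Prop :=
  ∀ (A : Type u) [CommRing A] [IsReduced A] [Algebra K A] [Algebra.FiniteType K A]
    (ε : A →ₐ[K] K) (μ : A ⊗[K] L →ₗ[A] A ⊗[K] L →ₗ[A] A ⊗[K] L),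
    IsDeformation (augmentation L ε) μ →
    ∃ (B : Type u) (_ : CommRing B) (_ : Algebra K B) (f : A →ₐ[K] B) (ε' : B →ₐ[K] K),
      IsAffineNeighbourhood ε f ε' ∧
      IsEquivalent (augmentation L ε') (pushout f μ) (trivialBracket K B L)

end Geometric

/-! ## Analytic rigidity -/

section Analytic

variable {𝕜 : Type u} [RCLike 𝕜] {L : Type v} [LieRing L] [LieAlgebra 𝕜 L]
variable {E : Type u} [NormedAddCommGroup E] [NormedSpace 𝕜 E]
variable {X : Type u} [TopologicalSpace X] [ChartedSpace E X]

variable (𝕜 E) in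
/-- `s : X → L` is an analytic section over `U` of the trivial bundle with fibre `L`, i.e. a
section over `U` of the sheaf `𝒪 ⊗ L`: locally `s = ∑ fᵢ lᵢ`, a finite sum with analytic functions
`fᵢ` and vectors `lᵢ` of `L`. -/
def IsAnalyticSection
    (U : Set X) (s : X → L) : Prop :=
  ∀ x ∈ U, ∃ (n : ℕ) (f : Fin n → X → 𝕜) (l : Fin n → L),
    (∀ i, ContMDiffAt 𝓘(𝕜, E) 𝓘(𝕜, 𝕜) ω (f i) x) ∧
    ∀ᶠ y in 𝓝 x, s y = ∑ i, f i y • l i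

variable (E) in
/-- `μ` is an analytic family over `X` of Lie brackets on the vector space `L`, with the given
bracket of `L` over the base point `x₀`. -/
structure IsAnalyticDeformation (x₀ : X) (μ : X → L →ₗ[𝕜] L →ₗ[𝕜] L) : Prop where
  alternating : ∀ t x, μ t x x = 0
  jacobi : ∀ t x y z, μ t x (μ t y z) + μ t y (μ t z x) + μ t z (μ t x y) = 0
  special : ∀ x y, μ x₀ x y = ⁅x, y⁆
  analytic : ∀ x y, IsAnalyticSection 𝕜 E Set.univ (fun t => μ t x y)

variable (E) in
/-- The restriction of the family `μ` to `U` is equivalent to the trivial family: there is an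
analytic family over `U` of linear automorphisms of `L` (with analytic inverse), the identity over
the base point, that takes the bracket of `L` to that of `μ`. -/
def IsAnalyticallyTrivialOn (x₀ : X) (U : Set X) (μ : X → L →ₗ[𝕜] L →ₗ[𝕜] L) : Prop :=
  ∃ φ : X → (L ≃ₗ[𝕜] L),
    (∀ x, IsAnalyticSection 𝕜 E U (fun t => φ t x)) ∧
    (∀ x, IsAnalyticSection 𝕜 E U (fun t => (φ t).symm x)) ∧
    (∀ t ∈ U, ∀ x y, φ t ⁅x, y⁆ = μ t (φ t x) (φ t y)) ∧
    ∀ x, φ x₀ x = x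

/-- Analytic rigidity: every analytic family over a pointed finite-dimensional analytic manifold
is equivalent to the trivial one on an open neighbourhood of the base point. -/
def IsAnalyticallyRigid (𝕜 : Type u) [RCLike 𝕜] (L : Type v) [LieRing L] [LieAlgebra 𝕜 L] :
    Prop :=
  ∀ (E : Type u) [NormedAddCommGroup E] [NormedSpace 𝕜 E] [FiniteDimensional 𝕜 E]
    (X : Type u) [TopologicalSpace X] [T2Space X] [SecondCountableTopology X] [ChartedSpace E X]
    [IsManifold 𝓘(𝕜, E) ω X] (x₀ : X) (μ : X → L →ₗ[𝕜] L →ₗ[𝕜] L),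
    IsAnalyticDeformation E x₀ μ →
    ∃ U : Set X, IsOpen U ∧ x₀ ∈ U ∧ IsAnalyticallyTrivialOn E x₀ U μ

end Analytic

/-! ## Current algebras and the one-parameter families -/

section Current

variable (g : Type v) [LieRing g] [LieAlgebra ℂ g]

/-- The classical current algebra, Laurent polynomials tensor `g`, with the bracket
`[zⁿ ⊗ x, zᵐ ⊗ y] = zⁿ⁺ᵐ ⊗ [x, y]`. The basis element `zⁿ` is written `T n`. -/
abbrev CurrentAlgebra : Type v := ℂ[T;T⁻¹] ⊗[ℂ] g

/-- The product of the basis elements `Aₙ = zⁿ` and `Aₘ = zᵐ` deformed by `p, q ∈ A`: it is `Aₙ₊ₘ`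
if `n` or `m` is even, and `Aₙ₊ₘ + p Aₙ₊ₘ₋₂ + q Aₙ₊ₘ₋₄` if both are odd. -/
def structureConstants {A : Type} [CommRing A] [Algebra ℂ A] (p q : A) (n m : ℤ) :
    A ⊗[ℂ] ℂ[T;T⁻¹] :=
  if Even n ∨ Even m then 1 ⊗ₜ LaurentPolynomial.T (n + m)
  else 1 ⊗ₜ LaurentPolynomial.T (n + m) + p ⊗ₜ LaurentPolynomial.T (n + m - 2) +
    q ⊗ₜ LaurentPolynomial.T (n + m - 4)

/-- The bilinear extension of `structureConstants` to Laurent polynomials. -/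
def deformedProduct {A : Type} [CommRing A] [Algebra ℂ A] (p q : A) :
    ℂ[T;T⁻¹] →ₗ[ℂ] ℂ[T;T⁻¹] →ₗ[ℂ] A ⊗[ℂ] ℂ[T;T⁻¹] :=
  (AddMonoidAlgebra.basis ℤ ℂ).constr ℂ fun n =>
    (AddMonoidAlgebra.basis ℤ ℂ).constr ℂ fun m => structureConstants p q n m

/-- The `A`-bilinear bracket on `A ⊗ (ℂ[z, z⁻¹] ⊗ g)` with
`[Aₙ ⊗ x, Aₘ ⊗ y] = (Aₙ · Aₘ) ⊗ [x, y]` for the deformed product of `Aₙ` and `Aₘ`. -/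
def currentBracket {A : Type} [CommRing A] [Algebra ℂ A] (p q : A) :
    A ⊗[ℂ] CurrentAlgebra g →ₗ[A] A ⊗[ℂ] CurrentAlgebra g →ₗ[A] A ⊗[ℂ] CurrentAlgebra g :=
  extendBilin <|
    (TensorProduct.map₂ (deformedProduct p q) (LieModule.toEnd ℂ g g : g →ₗ[ℂ] g →ₗ[ℂ] g)).compr₂
      (TensorProduct.assoc ℂ A ℂ[T;T⁻¹] g).toLinearMap

theorem currentBracket_T {A : Type} [CommRing A] [Algebra ℂ A] (p q : A) (n m : ℤ) (x y : g) :
    currentBracket g p q (1 ⊗ₜ (LaurentPolynomial.T n ⊗ₜ x)) (1 ⊗ₜ (LaurentPolynomial.T m ⊗ₜ y)) =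
      if Even n ∨ Even m then 1 ⊗ₜ (LaurentPolynomial.T (n + m) ⊗ₜ ⁅x, y⁆)
      else 1 ⊗ₜ (LaurentPolynomial.T (n + m) ⊗ₜ ⁅x, y⁆) +
        p ⊗ₜ (LaurentPolynomial.T (n + m - 2) ⊗ₜ ⁅x, y⁆) +
        q ⊗ₜ (LaurentPolynomial.T (n + m - 4) ⊗ₜ ⁅x, y⁆) := by
  have hT : ∀ k : ℤ, (LaurentPolynomial.T k : ℂ[T;T⁻¹]) = AddMonoidAlgebra.basis ℤ ℂ k :=
    fun k => (AddMonoidAlgebra.basis_apply ℂ k).symm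
  have h : deformedProduct p q (LaurentPolynomial.T n) (LaurentPolynomial.T m) =
      structureConstants p q n m := by
    rw [hT, hT, deformedProduct, Module.Basis.constr_basis, Module.Basis.constr_basis]
  have h' : currentBracket g p q (1 ⊗ₜ (LaurentPolynomial.T n ⊗ₜ x))
      (1 ⊗ₜ (LaurentPolynomial.T m ⊗ₜ y)) =
      TensorProduct.assoc ℂ A ℂ[T;T⁻¹] g (structureConstants p q n m ⊗ₜ ⁅x, y⁆) := by
    rw [currentBracket, extendBilin_tmul, mul_one, one_smul, ← h]
    rfl
  rw [h', structureConstants]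
  split_ifs
  · rw [TensorProduct.assoc_tmul]
  · rw [TensorProduct.add_tmul, TensorProduct.add_tmul, map_add, map_add,
      TensorProduct.assoc_tmul, TensorProduct.assoc_tmul, TensorProduct.assoc_tmul]

open scoped OnePoint in
/-- The coefficients over `ℂ[e]` of the Krichever-Novikov family over the line `D_s`: with
`e₁ = e` and `e₂ = s e` these are `3 e₁` and `(e₁ - e₂) (2 e₁ + e₂)`; for `s = ∞` one has `e₁ = 0`
and `e = e₂ ^ 2`. -/
def lineCoefficients : OnePoint ℂ → ℂ[X] × ℂ[X]
  | ∞ => (0, -Polynomial.X)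
  | OnePoint.some s =>
    (3 * Polynomial.X, Polynomial.C ((1 - s) * (2 + s)) * Polynomial.X ^ 2)

/-- The one-parameter Krichever-Novikov family over `ℂ[e]` attached to `s ∈ ℂ ∪ {∞}`. -/
def lineFamily (s : OnePoint ℂ) :
    ℂ[X] ⊗[ℂ] CurrentAlgebra g →ₗ[ℂ[X]] ℂ[X] ⊗[ℂ] CurrentAlgebra g →ₗ[ℂ[X]]
      ℂ[X] ⊗[ℂ] CurrentAlgebra g :=
  currentBracket g (lineCoefficients s).1 (lineCoefficients s).2

/-- The point `e = c` of the affine line, as an augmentation of `ℂ[e]`. -/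
def point (c : ℂ) : ℂ[X] →ₐ[ℂ] ℂ := Polynomial.aeval c

end Current

end CurrentRigidity

end

/-!
# Rigidity of the classical current algebra

Write `ḡ` for the current algebra `ℂ[z, z⁻¹] ⊗ g` of a simple Lie algebra `g`.

*Formal rigidity.* The second cohomology of `ḡ` with adjoint coefficients vanishes
(`IsCocycle.exists_eq_coboundary`). Whitehead's two lemmas for `g`, applied to each coefficient in
`z`, change a cocycle by coboundaries until it vanishes as soon as one argument lies in `g`. Such a
cocycle consists of `g`-equivariant bilinear maps on `g` that depend on two Laurent polynomials.
Alternating equivariant maps `g × g → g` are multiples of the bracket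
(`IsEquivariant.exists_eq_smul_of_alternating`); symmetric ones need not vanish, but those with the
cyclic identity that the cocycle condition imposes do (`IsEquivariant.eq_zero_of_symm_of_cyclic`).
Hence the alternating part of the cocycle is a Hochschild cocycle of `ℂ[z, z⁻¹]` and a coboundary,
whereas the symmetric part is a skew biderivation of an algebra in one variable and zero.

A formal deformation over `A` with maximal ideal `m` is trivialised by a bracket-preserving lift
`L → A ⊗̂ L` of the special fibre. The lift is built modulo the powers of `m`: the obstruction at each
step has coordinates in `mⁿ / mⁿ⁺¹ ⊗ L` that are adjoint `2`-cocycles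
(`exists_lift_modulo_pow_succ`). The completion behaves well because `m` is finitely generated,
which follows from the finiteness of `m / m²` (`fg_of_finite_cotangent`).

*The families.* An equivalence with the trivial family, on any Zariski or analytic neighbourhood of
`e = 0`, makes the fibre over some point `e ≠ 0` isomorphic to `ḡ`. No such fibre is
(`eq_zero_of_equiv_deformedLie`): its centroid is the commutative algebra with `X = A₂` invertible
and generated over `ℂ[X, X⁻¹]` by `Y = A₁`, with `Y² = X + p + q X⁻¹`, and it would have to be
isomorphic to `ℂ[z, z⁻¹]`. The Euler derivation of the latter, on which the units are monomials,
multiplies `X` by a nonzero integer, so that `X - q X⁻¹` would be a multiple of `Y`, and a comparison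
of leading terms gives `p = q = 0`. Both negative rigidity statements follow from these families.
-/

noncomputable section

namespace CurrentRigidity

/-! ### Simple Lie algebras: Schur's lemma and the Casimir element -/

theorem skew_of_alternating {R M N : Type*} [CommRing R] [AddCommGroup M] [Module R M]
    [AddCommGroup N] [Module R N] {B : M →ₗ[R] M →ₗ[R] N} (h : ∀ x, B x x = 0) (x y : M) :
    B x y = -B y x := by
  have := h (x + y)
  simp only [map_add, LinearMap.add_apply, h, zero_add, add_zero] at this
  exact eq_neg_of_add_eq_zero_right this

section Simple

variable {g : Type*} [LieRing g] [LieAlgebra ℂ g]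

theorem eq_top_of_mem_of_ne_zero [LieAlgebra.IsSimple ℂ g] (I : LieIdeal ℂ g) {x : g}
    (hx : x ∈ I) (hx0 : x ≠ 0) : I = ⊤ := by
  rcases LieAlgebra.IsSimple.eq_bot_or_eq_top (R := ℂ) I with h | h
  · rw [h, LieSubmodule.mem_bot] at hx
    exact absurd hx hx0
  · exact h

/-- A linear subspace closed under the adjoint action is everything as soon as it is nonzero. -/
theorem mem_of_lie_mem [LieAlgebra.IsSimple ℂ g] (p : Submodule ℂ g)
    (hp : ∀ x : g, ∀ y ∈ p, ⁅x, y⁆ ∈ p) {x : g} (hx : x ∈ p) (hx0 : x ≠ 0) (y : g) : y ∈ p := by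
  let I : LieIdeal ℂ g := { p with lie_mem := fun {x y} h => hp x y h }
  have : y ∈ (⊤ : LieIdeal ℂ g) := LieSubmodule.mem_top y
  rw [← eq_top_of_mem_of_ne_zero I (x := x) hx hx0] at this
  exact this

variable (g) in
theorem lie_top_top_eq_top [LieAlgebra.IsSimple ℂ g] :
    ⁅(⊤ : LieIdeal ℂ g), (⊤ : LieIdeal ℂ g)⁆ = ⊤ := by
  rcases LieAlgebra.IsSimple.eq_bot_or_eq_top (R := ℂ) ⁅(⊤ : LieIdeal ℂ g), (⊤ : LieIdeal ℂ g)⁆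
    with h | h
  · refine absurd ⟨fun x y => ?_⟩ (LieAlgebra.IsSimple.non_abelian (R := ℂ) (L := g))
    have : ⁅x, y⁆ ∈ ⁅(⊤ : LieIdeal ℂ g), (⊤ : LieIdeal ℂ g)⁆ :=
      LieSubmodule.lie_mem_lie (LieSubmodule.mem_top x) (LieSubmodule.mem_top y)
    rwa [h, LieSubmodule.mem_bot] at this
  · exact h

/-- A simple Lie algebra is perfect, so linear maps that agree on brackets are equal. -/
theorem linearMap_ext_lie [LieAlgebra.IsSimple ℂ g] {V : Type*} [AddCommGroup V] [Module ℂ V]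
    {f f' : g →ₗ[ℂ] V} (h : ∀ x y : g, f ⁅x, y⁆ = f' ⁅x, y⁆) : f = f' := by
  ext x
  have hx : x ∈ (⁅(⊤ : LieIdeal ℂ g), (⊤ : LieIdeal ℂ g)⁆).toSubmodule := by
    rw [lie_top_top_eq_top]; exact LieSubmodule.mem_top x
  rw [LieSubmodule.lieIdeal_oper_eq_linear_span'] at hx
  induction hx using Submodule.span_induction with
  | mem x hx => obtain ⟨y, -, z, -, rfl⟩ := hx; exact h y z
  | zero => simp
  | add x y _ _ hx hy => rw [map_add, map_add, hx, hy]
  | smul c x _ hx => rw [map_smul, map_smul, hx]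

theorem eq_zero_of_forall_lie_eq_zero [LieAlgebra.IsSimple ℂ g] {x : g}
    (h : ∀ y : g, ⁅y, x⁆ = 0) : x = 0 := by
  by_contra hx
  refine LieAlgebra.IsSimple.non_abelian (R := ℂ) (L := g) ⟨fun y z => ?_⟩
  exact mem_of_lie_mem (⨅ y : g, LinearMap.ker (LieModule.toEnd ℂ g g y))
    (fun a b hb => by
      simp only [Submodule.mem_iInf, LinearMap.mem_ker, LieModule.toEnd_apply_apply] at hb ⊢
      intro y; rw [hb a, lie_zero])
    (x := x) (by simpa [Submodule.mem_iInf] using h) hx z |> fun hz => by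
      simpa using (Submodule.mem_iInf _).1 hz y

instance [LieAlgebra.IsSimple ℂ g] : Nontrivial g := by
  by_contra h
  rw [not_nontrivial_iff_subsingleton] at h
  exact LieAlgebra.IsSimple.non_abelian (R := ℂ) (L := g) ⟨fun y z => Subsingleton.elim _ _⟩

/-- A module with vanishing trace form is trivial: it is nilpotent by Cartan's criterion, and since
`g` is perfect, each step of the lower central series then vanishes with the previous one. -/
theorem lie_eq_zero_of_traceForm_eq_zero [LieAlgebra.IsSimple ℂ g] {V : Type*} [AddCommGroup V] [Module ℂ V]
    [LieRingModule g V] [LieModule ℂ g V] [FiniteDimensional ℂ V]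
    (h : LieModule.traceForm ℂ g V = 0) (x : g) (v : V) : ⁅x, v⁆ = 0 := by
  have hnil : LieModule.IsNilpotent g V := by
    have h1 := LieModule.isNilpotent_derivedSeries_of_traceForm_eq_zero h
    have h2 : LieAlgebra.derivedSeries ℂ g 1 = ⊤ := lie_top_top_eq_top g
    rw [h2] at h1
    exact (LieModule.isNilpotent_of_top_iff (R := ℂ)).1 h1
  obtain ⟨k, hk⟩ := (LieModule.isNilpotent_iff ℂ g V).1 hnil
  have key : ∀ (k : ℕ) (x : g) (v : V), ⁅x, v⁆ ∈ LieModule.lowerCentralSeries ℂ g V k := by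
    intro k
    induction k with
    | zero => intro x v; exact LieSubmodule.mem_top _
    | succ k ih =>
      intro x v
      let q : V →ₗ[ℂ] _ := (LieModule.lowerCentralSeries ℂ g V (k + 1)).toSubmodule.mkQ
      have hq : ∀ (y : g) (w : V), w ∈ LieModule.lowerCentralSeries ℂ g V k → q ⁅y, w⁆ = 0 := by
        intro y w hw
        refine (Submodule.Quotient.mk_eq_zero _).2 ?_
        rw [LieSubmodule.mem_toSubmodule, LieModule.lowerCentralSeries_succ]
        exact LieSubmodule.lie_mem_lie (LieSubmodule.mem_top y) hw
      have : q ∘ₗ (LieModule.toEnd ℂ g V : g →ₗ[ℂ] V →ₗ[ℂ] V).flip v = 0 :=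
        linearMap_ext_lie fun y z => by
        simp only [LinearMap.comp_apply, LinearMap.flip_apply, LieHom.coe_toLinearMap,
          LieModule.toEnd_apply_apply, lie_lie, map_sub, LinearMap.zero_apply]
        rw [hq y _ (ih z v), hq z _ (ih y v), sub_zero]
      exact (Submodule.Quotient.mk_eq_zero _).1 (LinearMap.congr_fun this x)
  have := key k x v
  rwa [hk, LieSubmodule.mem_bot] at this

variable [FiniteDimensional ℂ g] [LieAlgebra.IsSimple ℂ g]

/-- Schur's lemma for the adjoint representation. -/
theorem exists_eq_smul_of_equivariant (f : g →ₗ[ℂ] g) (hf : ∀ x y : g, f ⁅x, y⁆ = ⁅x, f y⁆) :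
    ∃ c : ℂ, ∀ x, f x = c • x := by
  obtain ⟨c, hc⟩ := Module.End.exists_eigenvalue f
  obtain ⟨v, hv⟩ := hc.exists_hasEigenvector
  refine ⟨c, fun x => ?_⟩
  have := mem_of_lie_mem (Module.End.eigenspace f c)
    (fun x y hy => by
      rw [Module.End.mem_eigenspace_iff] at hy ⊢
      rw [hf, hy, lie_smul]) hv.1 hv.2 x
  exact Module.End.mem_eigenspace_iff.1 this

/-- A basis of `g`, used to write down the Casimir element of the Killing form. -/
def casimirBasis (g : Type*) [LieRing g] [LieAlgebra ℂ g] [FiniteDimensional ℂ g] :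
    Module.Basis (Fin (Module.finrank ℂ g)) ℂ g :=
  Module.finBasis ℂ g

/-- The basis of `g` that is dual to `casimirBasis` for the Killing form. -/
def casimirDual (g : Type*) [LieRing g] [LieAlgebra ℂ g] [FiniteDimensional ℂ g]
    [LieAlgebra.IsSimple ℂ g] : Module.Basis (Fin (Module.finrank ℂ g)) ℂ g :=
  LinearMap.BilinForm.dualBasis (killingForm ℂ g)
    (LieAlgebra.IsKilling.killingForm_nondegenerate ℂ g) (casimirBasis g)

/-- The contraction of a bilinear map with the Casimir element `∑ bᵢ' ⊗ bᵢ` of `g ⊗ g`. -/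
def contract {V : Type*} [AddCommGroup V] [Module ℂ V] (F : g →ₗ[ℂ] g →ₗ[ℂ] V) : V :=
  ∑ i, F (casimirDual g i) (casimirBasis g i)

theorem killingForm_casimirDual_casimirBasis (i j : Fin (Module.finrank ℂ g)) :
    killingForm ℂ g (casimirDual g i) (casimirBasis g j) = if j = i then 1 else 0 :=
  LinearMap.BilinForm.apply_dualBasis_left _ _ i j

theorem sum_killingForm_smul_casimirDual (x : g) :
    ∑ i, killingForm ℂ g x (casimirBasis g i) • casimirDual g i = x := by
  conv_rhs => rw [← (casimirDual g).sum_repr x]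
  refine Finset.sum_congr rfl fun i _ => ?_
  rw [casimirDual, LinearMap.BilinForm.dualBasis_repr_apply]

theorem sum_killingForm_smul_casimirBasis (x : g) :
    ∑ i, killingForm ℂ g (casimirDual g i) x • casimirBasis g i = x := by
  have h : ∀ i, killingForm ℂ g (casimirDual g i) x = (casimirBasis g).repr x i := by
    intro i
    conv_lhs => rw [← (casimirBasis g).sum_repr x, map_sum]
    simp only [map_smul, killingForm_casimirDual_casimirBasis]
    simp
  simp_rw [h]
  exact (casimirBasis g).sum_repr x

/-- The Casimir element is symmetric. -/
theorem contract_flip {V : Type*} [AddCommGroup V] [Module ℂ V] (F : g →ₗ[ℂ] g →ₗ[ℂ] V) :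
    contract F.flip = contract F := by
  have h : ∀ i, F (casimirBasis g i) (casimirDual g i) =
      ∑ j, killingForm ℂ g (casimirBasis g i) (casimirBasis g j) •
        F (casimirDual g j) (casimirDual g i) := by
    intro i
    conv_lhs => rw [← sum_killingForm_smul_casimirDual (casimirBasis g i)]
    simp
  have h' : ∀ i, F (casimirDual g i) (casimirBasis g i) =
      ∑ j, killingForm ℂ g (casimirBasis g i) (casimirBasis g j) •
        F (casimirDual g i) (casimirDual g j) := by
    intro i
    conv_lhs => rw [← sum_killingForm_smul_casimirDual (casimirBasis g i)]
    simp
  simp only [contract, LinearMap.flip_apply, h, h']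
  rw [Finset.sum_comm]
  refine Finset.sum_congr rfl fun i _ => Finset.sum_congr rfl fun j _ => ?_
  rw [LieModule.traceForm_comm]

/-- The Casimir element is invariant. -/
theorem contract_lie {V : Type*} [AddCommGroup V] [Module ℂ V] (F : g →ₗ[ℂ] g →ₗ[ℂ] V) (x : g) :
    contract (F ∘ₗ LieModule.toEnd ℂ g g x) =
      -contract (F.compl₂ (LieModule.toEnd ℂ g g x)) := by
  have h : ∀ i, F ⁅x, casimirDual g i⁆ (casimirBasis g i) =
      ∑ j, killingForm ℂ g ⁅x, casimirDual g i⁆ (casimirBasis g j) •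
        F (casimirDual g j) (casimirBasis g i) := by
    intro i
    conv_lhs => rw [← sum_killingForm_smul_casimirDual ⁅x, casimirDual g i⁆]
    simp
  have h' : ∀ i, F (casimirDual g i) ⁅x, casimirBasis g i⁆ =
      ∑ j, killingForm ℂ g (casimirDual g j) ⁅x, casimirBasis g i⁆ •
        F (casimirDual g i) (casimirBasis g j) := by
    intro i
    conv_lhs => rw [← sum_killingForm_smul_casimirBasis ⁅x, casimirBasis g i⁆]
    simp
  simp only [contract, LinearMap.comp_apply, LinearMap.compl₂_apply, LieModule.toEnd_apply_apply,
    h, h']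
  rw [Finset.sum_comm, ← Finset.sum_neg_distrib]
  refine Finset.sum_congr rfl fun i _ => ?_
  rw [← Finset.sum_neg_distrib]
  refine Finset.sum_congr rfl fun j _ => ?_
  rw [← lie_skew, map_neg, LinearMap.neg_apply, LieModule.traceForm_apply_lie_apply, neg_smul]

theorem map_contract {V W : Type*} [AddCommGroup V] [Module ℂ V] [AddCommGroup W] [Module ℂ W]
    (f : V →ₗ[ℂ] W) (F : g →ₗ[ℂ] g →ₗ[ℂ] V) : f (contract F) = contract (F.compr₂ f) := by
  simp [contract]

section Casimir

variable {V : Type*} [AddCommGroup V] [Module ℂ V] [LieRingModule g V] [LieModule ℂ g V]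

variable (g V) in
/-- The Casimir operator `∑ bᵢ' bᵢ` of a `g`-module, for the Killing form of `g`. -/
def casimirOp : Module.End ℂ V :=
  contract ((LinearMap.mul ℂ (Module.End ℂ V)).compl₁₂ (LieModule.toEnd ℂ g V : g →ₗ[ℂ] _)
    (LieModule.toEnd ℂ g V : g →ₗ[ℂ] _))

theorem casimirOp_apply (v : V) :
    casimirOp g V v = ∑ i, ⁅casimirDual g i, ⁅casimirBasis g i, v⁆⁆ := by
  simp [casimirOp, contract]

/-- A pointwise form of the invariance of the Casimir element. -/
theorem sum_lie_casimirDual {W : Type*} [AddCommGroup W] [Module ℂ W]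
    (F : g →ₗ[ℂ] g →ₗ[ℂ] W) (x : g) :
    ∑ i, F ⁅x, casimirDual g i⁆ (casimirBasis g i) =
      -∑ i, F (casimirDual g i) ⁅x, casimirBasis g i⁆ := by
  simpa [contract] using contract_lie F x

theorem casimirOp_lie (x : g) (v : V) : casimirOp g V ⁅x, v⁆ = ⁅x, casimirOp g V v⁆ := by
  have h := sum_lie_casimirDual (LinearMap.mk₂ ℂ (fun y z : g => ⁅y, ⁅z, v⁆⁆)
    (by simp) (by simp) (by simp) (by simp)) x
  simp only [LinearMap.mk₂_apply] at h
  rw [casimirOp_apply, casimirOp_apply, lie_sum]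
  have h2 : ∀ i, ⁅x, ⁅casimirDual g i, ⁅casimirBasis g i, v⁆⁆⁆ =
      ⁅⁅x, casimirDual g i⁆, ⁅casimirBasis g i, v⁆⁆ +
      (⁅casimirDual g i, ⁅⁅x, casimirBasis g i⁆, v⁆⁆ +
      ⁅casimirDual g i, ⁅casimirBasis g i, ⁅x, v⁆⁆⁆) := by
    intro i
    rw [← lie_add, ← leibniz_lie, ← leibniz_lie]
  simp_rw [h2, Finset.sum_add_distrib]
  rw [h, neg_add_cancel_left]

end Casimir

/-- The Casimir operator of the adjoint representation is a scalar by Schur's lemma, and its trace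
is `∑ κ(bᵢ', bᵢ) = dim g`. -/
theorem casimirOp_adjoint (x : g) : casimirOp g g x = x := by
  obtain ⟨c, hc⟩ := exists_eq_smul_of_equivariant (casimirOp g g) (casimirOp_lie)
  have h : LinearMap.trace ℂ g (casimirOp g g) = Module.finrank ℂ g := by
    rw [casimirOp, map_contract, contract]
    have : ∀ i, killingForm ℂ g (casimirDual g i) (casimirBasis g i) = 1 := fun i => by
      simp [killingForm_casimirDual_casimirBasis]
    simp only [LieModule.traceForm_apply_apply] at this
    simp [Module.End.mul_eq_comp, this]
  have hc' : casimirOp g g = c • LinearMap.id := by ext x; simp [hc]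
  rw [hc', map_smul, LinearMap.trace_id, smul_eq_mul] at h
  have : (Module.finrank ℂ g : ℂ) ≠ 0 := by
    exact_mod_cast (Module.finrank_pos (R := ℂ) (M := g)).ne'
  have hc1 : c = 1 := mul_right_cancel₀ this (by rw [h, one_mul])
  rw [hc, hc1, one_smul]

/-- An invariant bilinear form on `g` is a multiple of the Killing form. -/
theorem exists_eq_smul_killingForm (B : g →ₗ[ℂ] g →ₗ[ℂ] ℂ)
    (hB : ∀ x y z : g, B ⁅x, y⁆ z = -B y ⁅x, z⁆) : ∃ c : ℂ, B = c • killingForm ℂ g := by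
  have nd := LieAlgebra.IsKilling.killingForm_nondegenerate ℂ g
  let A : g →ₗ[ℂ] g := (LinearMap.BilinForm.toDual (killingForm ℂ g) nd).symm.toLinearMap ∘ₗ B
  have hA : ∀ x y, killingForm ℂ g (A x) y = B x y := fun x y =>
    LinearMap.BilinForm.apply_toDual_symm_apply (hB := nd) _ _
  obtain ⟨c, hc⟩ := exists_eq_smul_of_equivariant A (fun x y => by
    apply (LinearMap.BilinForm.toDual (killingForm ℂ g) nd).injective
    ext z
    rw [LinearMap.BilinForm.toDual_def, LinearMap.BilinForm.toDual_def, hA, hB, ← hA,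
      ← lie_skew x (A y), map_neg, LinearMap.neg_apply, LieModule.traceForm_apply_lie_apply])
  refine ⟨c, ?_⟩
  ext x y
  rw [← hA, hc]
  simp

/-! ### Vanishing of the first and second cohomology of simple Lie algebras -/

/-- A module on which the Casimir operator of the Killing form is nilpotent is trivial: its trace
form is a multiple of the Killing form, and the factor is proportional to the trace of the Casimir
operator. -/
theorem lie_eq_zero_of_isNilpotent_casimirOp {V : Type*} [AddCommGroup V] [Module ℂ V]
    [LieRingModule g V] [LieModule ℂ g V] [FiniteDimensional ℂ V]
    (h : IsNilpotent (casimirOp g V)) (x : g) (v : V) : ⁅x, v⁆ = 0 := by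
  refine lie_eq_zero_of_traceForm_eq_zero ?_ x v
  obtain ⟨c, hc⟩ := exists_eq_smul_killingForm (LieModule.traceForm ℂ g V) (fun x y z => by
    rw [← lie_skew, map_neg, LinearMap.neg_apply, LieModule.traceForm_apply_lie_apply])
  have htr := (LinearMap.isNilpotent_trace_of_isNilpotent h).eq_zero
  have h1 : LinearMap.trace ℂ V (casimirOp g V) = contract (LieModule.traceForm ℂ g V) := by
    rw [casimirOp, map_contract]
    simp [contract, LieModule.traceForm_apply_apply, Module.End.mul_eq_comp]
  rw [h1, hc] at htr
  have hdim : (Module.finrank ℂ g : ℂ) ≠ 0 := by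
    exact_mod_cast (Module.finrank_pos (R := ℂ) (M := g)).ne'
  have hc0 : c = 0 := by
    simpa [contract, killingForm_casimirDual_casimirBasis, hdim] using htr
  rw [hc, hc0, zero_smul]

/-- Whitehead's first lemma: derivations of a simple Lie algebra into a finite-dimensional module
are inner. The Casimir operator times the derivation is inner; on the part of the module where it
is nilpotent the action is trivial and so is the derivation, and elsewhere it is invertible. -/
theorem exists_eq_lie_of_derivation {V : Type*} [AddCommGroup V] [Module ℂ V]
    [LieRingModule g V] [LieModule ℂ g V] [FiniteDimensional ℂ V] (c : g →ₗ[ℂ] V)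
    (hc : ∀ x y : g, c ⁅x, y⁆ = ⁅x, c y⁆ - ⁅y, c x⁆) : ∃ v : V, ∀ x : g, c x = ⁅x, v⁆ := by
  set Ω := casimirOp g V with hΩ
  obtain ⟨n, hn, hn1⟩ := ((LinearMap.eventually_isCompl_ker_pow_range_pow Ω).and
    (Filter.eventually_ge_atTop 1)).exists
  obtain ⟨m, rfl⟩ : ∃ m, n = m + 1 := ⟨n - 1, by omega⟩
  clear hn1
  set n := m + 1 with hnm
  have hpow : ∀ (k : ℕ) (x : g) (v : V), (Ω ^ k) ⁅x, v⁆ = ⁅x, (Ω ^ k) v⁆ := by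
    intro k
    induction k with
    | zero => intro x v; rfl
    | succ k ih => intro x v; rw [pow_succ, Module.End.mul_apply, casimirOp_lie, ih]; rfl
  let E : LieSubmodule ℂ g V := { LinearMap.ker (Ω ^ n) with
    lie_mem := fun {x m} hm => by
      change (Ω ^ n) m = 0 at hm
      change (Ω ^ n) ⁅x, m⁆ = 0
      rw [hpow, hm, lie_zero] }
  have hE : ∀ v, v ∈ E ↔ (Ω ^ n) v = 0 := fun v => Iff.rfl
  have htriv : ∀ (x : g) (v : V), (Ω ^ n) v = 0 → ⁅x, v⁆ = 0 := by
    intro x v hv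
    have hcoe : ∀ (k : ℕ) (w : E), (((casimirOp g E) ^ k) w : V) = (Ω ^ k) (w : V) := by
      intro k
      induction k with
      | zero => intro w; rfl
      | succ k ih =>
        intro w
        rw [pow_succ, pow_succ, Module.End.mul_apply, Module.End.mul_apply, ih, hΩ,
          casimirOp_apply, casimirOp_apply]
        simp
    have := lie_eq_zero_of_isNilpotent_casimirOp (g := g) (V := E) ⟨n, by
      ext w
      rw [hcoe]
      exact (hE _).1 w.2⟩ x ⟨v, hv⟩
    simpa using congrArg (Subtype.val) this
  -- the component of the derivation in the trivial part vanishes because `g` is perfect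
  let π : V →ₗ[ℂ] V := Submodule.projection _ _ hn
  have hπ0 : ∀ v, (Ω ^ n) (π v) = 0 := fun v => Submodule.projection_apply_mem hn v
  have hπ1 : ∀ v, v - π v ∈ LinearMap.range (Ω ^ n) := fun v => by
    rw [← Submodule.ker_projection hn, LinearMap.mem_ker, map_sub, sub_eq_zero]
    exact (Submodule.projection_eq_self_iff hn _).2 (hπ0 v) |>.symm
  have hπ2 : ∀ v, v ∈ LinearMap.range (Ω ^ n) → π v = 0 := fun v hv => by
    rwa [← Submodule.ker_projection hn, LinearMap.mem_ker] at hv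
  have hlieπ : ∀ (x : g) v, π ⁅x, v⁆ = 0 := by
    intro x v
    obtain ⟨w, hw⟩ := hπ1 v
    apply hπ2
    refine ⟨⁅x, w⁆, ?_⟩
    rw [hpow, hw, lie_sub, htriv x _ (hπ0 v), sub_zero]
  have hπc : π ∘ₗ c = 0 := linearMap_ext_lie fun x y => by
    rw [LinearMap.comp_apply, hc, map_sub, hlieπ, hlieπ, sub_zero, LinearMap.zero_apply]
  have hcr : ∀ x, c x ∈ LinearMap.range (Ω ^ n) := fun x => by
    have := hπ1 (c x)
    rwa [show π (c x) = 0 from LinearMap.congr_fun hπc x, sub_zero] at this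
  set v := ∑ i, ⁅casimirDual g i, c (casimirBasis g i)⁆ with hv
  have hΩc : ∀ x : g, Ω (c x) = ⁅x, v⁆ := by
    intro x
    have h := sum_lie_casimirDual (LinearMap.mk₂ ℂ (fun y z : g => ⁅y, c z⁆)
      (by simp) (by simp) (by simp) (by simp)) x
    simp only [LinearMap.mk₂_apply] at h
    rw [hΩ, casimirOp_apply, hv, lie_sum]
    have h2 : ∀ i, ⁅x, ⁅casimirDual g i, c (casimirBasis g i)⁆⁆ =
        ⁅⁅x, casimirDual g i⁆, c (casimirBasis g i)⁆ +
        (⁅casimirDual g i, c ⁅x, casimirBasis g i⁆⁆ +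
        ⁅casimirDual g i, ⁅casimirBasis g i, c x⁆⁆) := by
      intro i
      rw [leibniz_lie, ← lie_add, hc, sub_add_cancel]
    simp_rw [h2, Finset.sum_add_distrib]
    rw [h, neg_add_cancel_left]
  have hdisj : ∀ w, w ∈ LinearMap.range (Ω ^ n) → (Ω ^ n) w = 0 → w = 0 := fun w h1 h2 =>
    (Submodule.disjoint_def.1 hn.disjoint) w h2 h1
  -- on the range of a high power, the Casimir operator is injective, hence surjective
  obtain ⟨w, hw⟩ : ∃ w ∈ LinearMap.range (Ω ^ n), Ω w = v - π v := by
    obtain ⟨u, hu⟩ := hπ1 v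
    obtain ⟨u', hu'⟩ := hπ1 u
    refine ⟨(Ω ^ n) ((Ω ^ m) u'), ⟨_, rfl⟩, ?_⟩
    have h1 : (Ω ^ n) u = (Ω ^ n) (u - π u) := by rw [map_sub, hπ0, sub_zero]
    rw [← hu, h1, ← hu']
    simp only [← Module.End.mul_apply, ← pow_succ', ← pow_add]
    congr 2
  refine ⟨w, fun x => ?_⟩
  have hwr : ⁅x, w⁆ ∈ LinearMap.range (Ω ^ n) := by
    obtain ⟨u, rfl⟩ := hw.1
    exact ⟨⁅x, u⁆, hpow n x u⟩
  rw [← sub_eq_zero]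
  refine hdisj _ (sub_mem (hcr x) hwr) ?_
  have h0 : Ω (c x - ⁅x, w⁆) = 0 := by
    rw [map_sub, hΩc, casimirOp_lie, hw.2, lie_sub, htriv x _ (hπ0 v), sub_zero, sub_self]
  rw [hnm, pow_succ, Module.End.mul_apply, h0, map_zero]

/-- Whitehead's second lemma for the adjoint representation: on it the Casimir operator is the
identity, so contraction with the Casimir element is a homotopy. -/
theorem exists_coboundary_of_cocycle (f : g →ₗ[ℂ] g →ₗ[ℂ] g) (halt : ∀ x, f x x = 0)
    (hf : ∀ x y z : g, ⁅x, f y z⁆ + ⁅y, f z x⁆ + ⁅z, f x y⁆ +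
      (f x ⁅y, z⁆ + f y ⁅z, x⁆ + f z ⁅x, y⁆) = 0) :
    ∃ ψ : g →ₗ[ℂ] g, ∀ x y : g, f x y = ⁅x, ψ y⁆ - ⁅y, ψ x⁆ - ψ ⁅x, y⁆ := by
  have hskew : ∀ x y, f x y = -f y x := skew_of_alternating halt
  let ψ : g →ₗ[ℂ] g := ∑ i, LieModule.toEnd ℂ g g (casimirDual g i) ∘ₗ f (casimirBasis g i)
  have hψ : ∀ y, ψ y = ∑ i, ⁅casimirDual g i, f (casimirBasis g i) y⁆ := fun y => by simp [ψ]
  refine ⟨ψ, fun x y => ?_⟩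
  have inv : ∀ x y : g, ∑ i, ⁅⁅x, casimirDual g i⁆, f (casimirBasis g i) y⁆ =
      -∑ i, ⁅casimirDual g i, f ⁅x, casimirBasis g i⁆ y⁆ := fun x y => by
    have h := sum_lie_casimirDual (LinearMap.mk₂ ℂ (fun u z : g => ⁅u, f z y⁆)
      (by simp) (by simp) (by simp) (by simp)) x
    simpa only [LinearMap.mk₂_apply] using h
  have h1 : ∀ x y : g, ⁅x, ψ y⁆ = ∑ i, ⁅casimirDual g i,
      ⁅x, f (casimirBasis g i) y⁆ - f ⁅x, casimirBasis g i⁆ y⁆ := fun x y => by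
    simp only [hψ, lie_sum, lie_sub, Finset.sum_sub_distrib]
    simp only [leibniz_lie x (casimirDual g _), Finset.sum_add_distrib, inv]
    abel
  rw [h1, h1, hψ, ← Finset.sum_sub_distrib, ← Finset.sum_sub_distrib]
  conv_lhs => rw [← casimirOp_adjoint (f x y), casimirOp_apply]
  refine Finset.sum_congr rfl fun i _ => ?_
  rw [← lie_sub, ← lie_sub]
  congr 1
  have h := hf (casimirBasis g i) x y
  have e1 : f y ⁅casimirBasis g i, x⁆ = f ⁅x, casimirBasis g i⁆ y := by
    rw [hskew y, ← lie_skew, map_neg, LinearMap.neg_apply, neg_neg]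
  rw [e1, hskew y (casimirBasis g i), hskew x ⁅y, casimirBasis g i⁆, lie_neg] at h
  rw [← sub_eq_zero, ← h]
  abel

end Simple

/-! ### Equivariant bilinear maps on a simple Lie algebra -/

section Equivariant

variable {g : Type*} [LieRing g] [LieAlgebra ℂ g]

/-- A bilinear map `g × g → g` is equivariant for the adjoint action. -/
def IsEquivariant (G : g →ₗ[ℂ] g →ₗ[ℂ] g) : Prop :=
  ∀ x y z : g, ⁅x, G y z⁆ = G ⁅x, y⁆ z + G y ⁅x, z⁆

variable (g) in
/-- The bracket as a bilinear map. -/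
def bracketBilin : g →ₗ[ℂ] g →ₗ[ℂ] g := LieModule.toEnd ℂ g g

@[simp]
theorem bracketBilin_apply (x y : g) : bracketBilin g x y = ⁅x, y⁆ := rfl

theorem isEquivariant_bracketBilin : IsEquivariant (bracketBilin g) := fun x y z => by
  simp only [bracketBilin_apply]
  rw [leibniz_lie]

theorem IsEquivariant.add {G G' : g →ₗ[ℂ] g →ₗ[ℂ] g} (h : IsEquivariant G)
    (h' : IsEquivariant G') : IsEquivariant (G + G') := fun x y z => by
  simp only [LinearMap.add_apply, lie_add, h x y z, h' x y z]
  abel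

theorem IsEquivariant.smul {G : g →ₗ[ℂ] g →ₗ[ℂ] g} (h : IsEquivariant G) (c : ℂ) :
    IsEquivariant (c • G) := fun x y z => by
  simp only [LinearMap.smul_apply, lie_smul, h x y z, smul_add]

theorem IsEquivariant.sub {G G' : g →ₗ[ℂ] g →ₗ[ℂ] g} (h : IsEquivariant G)
    (h' : IsEquivariant G') : IsEquivariant (G - G') := fun x y z => by
  simp only [LinearMap.sub_apply, lie_sub, h x y z, h' x y z]
  abel

theorem IsEquivariant.flip {G : g →ₗ[ℂ] g →ₗ[ℂ] g} (h : IsEquivariant G) :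
    IsEquivariant G.flip := fun x y z => by
  simp only [LinearMap.flip_apply, h x z y]
  abel

/-- The vectors that an equivariant map kills in its first argument form an ideal. -/
theorem IsEquivariant.eq_zero_of_apply_eq_zero [LieAlgebra.IsSimple ℂ g]
    {G : g →ₗ[ℂ] g →ₗ[ℂ] g} (h : IsEquivariant G) {x : g} (hx0 : x ≠ 0) (hx : G x = 0) : G = 0 := by
  ext1 y
  refine LinearMap.mem_ker.1 (mem_of_lie_mem (LinearMap.ker G) (fun x y hy => ?_)
    (LinearMap.mem_ker.2 hx) hx0 y)
  rw [LinearMap.mem_ker] at hy ⊢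
  ext z
  have := h x y z
  rw [hy, LinearMap.zero_apply, LinearMap.zero_apply, lie_zero, add_zero] at this
  rw [← this, LinearMap.zero_apply]

theorem mem_rootSpace_of_lie_eq {H : LieSubalgebra ℂ g} [H.IsCartanSubalgebra] {χ : H → ℂ} {x : g}
    (h : ∀ u : H, ⁅(u : g), x⁆ = χ u • x) :
    x ∈ LieAlgebra.rootSpace H χ := by
  rw [LieModule.mem_genWeightSpace]
  intro u
  refine ⟨1, ?_⟩
  rw [pow_one]
  change ⁅u, x⁆ - χ u • x = 0
  exact sub_eq_zero.2 (h u)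

variable [FiniteDimensional ℂ g] [LieAlgebra.IsSimple ℂ g]

/-- A symmetric equivariant `F` with `F(x, [y, z]) + F(y, [z, x]) + F(z, [x, y]) = 0` vanishes.
The hypothesis makes each `F(x, ·)` a derivation up to the factor `1/3`, and contraction with the
Casimir element turns this into `F = F / 3`. -/
theorem IsEquivariant.eq_zero_of_symm_of_cyclic {F : g →ₗ[ℂ] g →ₗ[ℂ] g} (hF : IsEquivariant F)
    (hs : ∀ x y, F x y = F y x)
    (hc : ∀ x y z : g, F x ⁅y, z⁆ + F y ⁅z, x⁆ + F z ⁅x, y⁆ = 0) : F = 0 := by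
  have third : ∀ x y z : g, (3 : ℂ) • F x ⁅y, z⁆ = ⁅y, F x z⁆ - ⁅z, F x y⁆ := by
    intro x y z
    have h1 := hF y x z
    have h2 := hF z x y
    have h3 := hc x y z
    have e1 : F ⁅y, x⁆ z = -F z ⁅x, y⁆ := by rw [hs, ← lie_skew, map_neg]
    have e2 : F ⁅z, x⁆ y = F y ⁅z, x⁆ := hs _ _
    have e3 : F x ⁅z, y⁆ = -F x ⁅y, z⁆ := by rw [← lie_skew, map_neg]
    rw [h1, h2, e1, e2, e3, eq_neg_of_add_eq_zero_right h3]
    module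
  set b := casimirBasis g
  set b' := casimirDual g
  have inv : ∀ (x : g) (B : g →ₗ[ℂ] g →ₗ[ℂ] g), ∑ i, B ⁅x, b' i⁆ (b i) = -∑ i, B (b' i) ⁅x, b i⁆ :=
    fun x B => sum_lie_casimirDual B x
  have hsum : ∀ z : g, ∑ i, ⁅b' i, ⁅b i, z⁆⁆ = z := fun z => by
    rw [← casimirOp_apply, casimirOp_adjoint]
  have hF' : ∀ x y z : g, ⁅x, F y z⁆ = F ⁅x, y⁆ z + F y ⁅x, z⁆ := hF
  have flip : ∀ B : g →ₗ[ℂ] g →ₗ[ℂ] g, ∑ i, B (b i) (b' i) = ∑ i, B (b' i) (b i) := fun B =>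
    contract_flip B
  -- the contraction of `F` itself is an invariant of `g`, hence zero
  have hF0 : ∑ i, F (b i) (b' i) = 0 := eq_zero_of_forall_lie_eq_zero fun y => by
    rw [flip, lie_sum]
    simp_rw [hF', Finset.sum_add_distrib]
    rw [inv y F, neg_add_cancel]
  have hbb : ∑ i, ⁅b' i, b i⁆ = 0 := by
    have h := flip (bracketBilin g)
    simp only [bracketBilin_apply] at h
    have h' : ∑ i, ⁅b i, b' i⁆ = -∑ i, ⁅b' i, b i⁆ := by
      rw [← Finset.sum_neg_distrib]
      exact Finset.sum_congr rfl fun i _ => (lie_skew _ _).symm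
    rw [h'] at h
    have h2 : (2 : ℂ) • ∑ i, ⁅b' i, b i⁆ = 0 := by
      rw [two_smul]
      nth_rewrite 1 [← h]
      exact neg_add_cancel _
    exact (smul_eq_zero.1 h2).resolve_left two_ne_zero
  have hw : ∀ z : g, ∑ i, ⁅b' i, F (b i) z⁆ = 0 := by
    intro z
    have h1 : ∑ i, ⁅b' i, F (b i) z⁆ = ∑ i, F (b i) ⁅b' i, z⁆ := by
      simp_rw [hF', Finset.sum_add_distrib]
      rw [← LinearMap.sum_apply, ← map_sum, hbb, map_zero, LinearMap.zero_apply, zero_add]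
    have h2 : (3 : ℂ) • ∑ i, F (b i) ⁅b' i, z⁆ = ∑ i, ⁅b' i, F (b i) z⁆ := by
      rw [Finset.smul_sum]
      simp_rw [third, Finset.sum_sub_distrib]
      rw [← lie_sum, hF0, lie_zero, sub_zero]
    rw [← h1] at h2
    have h3 : (2 : ℂ) • ∑ i, ⁅b' i, F (b i) z⁆ = 0 := by
      linear_combination (norm := module) h2
    exact (smul_eq_zero.1 h3).resolve_left two_ne_zero
  have hw' : ∀ z : g, ∑ i, ⁅b' i, F z (b i)⁆ = 0 := fun z => by simp_rw [hs z, hw]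
  have hS : ∀ x z : g, (2 : ℂ) • ∑ i, ⁅b' i, ⁅z, F x (b i)⁆⁆ = -F x z := by
    intro x z
    have h1 : ∑ i, ⁅b' i, ⁅z, F x (b i)⁆⁆ = ∑ i, ⁅b' i, F x ⁅z, b i⁆⁆ := by
      simp_rw [hF' z x, lie_add, Finset.sum_add_distrib]
      rw [hw', zero_add]
    have h2 : (3 : ℂ) • ∑ i, ⁅b' i, F x ⁅z, b i⁆⁆ = ∑ i, ⁅b' i, ⁅z, F x (b i)⁆⁆ - F x z := by
      rw [Finset.smul_sum]
      simp_rw [← lie_smul, third, lie_sub, Finset.sum_sub_distrib, hsum]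
    rw [← h1] at h2
    linear_combination (norm := module) h2
  ext x z
  have h1 : (3 : ℂ) • F x z =
      ∑ i, ⁅b' i, F x ⁅b i, z⁆⁆ - ∑ i, ⁅⁅b i, z⁆, F x (b' i)⁆ := by
    conv_lhs => rw [← hsum z, map_sum, Finset.smul_sum]
    simp_rw [third, Finset.sum_sub_distrib]
  have h2 : (3 : ℂ) • ∑ i, ⁅b' i, F x ⁅b i, z⁆⁆ = F x z - ∑ i, ⁅b' i, ⁅z, F x (b i)⁆⁆ := by
    rw [Finset.smul_sum]
    simp_rw [← lie_smul, third, lie_sub, Finset.sum_sub_distrib, hsum]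
  have h3 : ∑ i, ⁅⁅b i, z⁆, F x (b' i)⁆ = ∑ i, ⁅b' i, ⁅z, F x (b i)⁆⁆ := by
    have h := flip (LinearMap.mk₂ ℂ (fun u v : g => ⁅⁅u, z⁆, F x v⁆)
      (by simp) (by simp) (by simp) (by simp))
    simp only [LinearMap.mk₂_apply] at h
    rw [h]
    simp_rw [lie_lie, Finset.sum_sub_distrib]
    rw [← lie_sum, hw', lie_zero, sub_zero]
  rw [h3] at h1
  have h4 : (2 : ℂ) • F x z = 0 := by
    linear_combination (norm := module) h1 + (1 / 3 : ℂ) • h2 - (2 / 3 : ℂ) • hS x z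
  simpa using h4

variable (g) in
theorem exists_isNonZero_weight (H : LieSubalgebra ℂ g) [H.IsCartanSubalgebra] :
    ∃ α : LieModule.Weight ℂ H g, α.IsNonZero := by
  by_contra! hne
  have h0 : ∀ x : g, x ∈ H := by
    intro x
    have hx : x ∈ (⊤ : LieSubmodule ℂ H g) := LieSubmodule.mem_top x
    rw [← LieModule.iSup_genWeightSpace_eq_top' ℂ H g] at hx
    have hle : (⨆ χ : LieModule.Weight ℂ H g, LieModule.genWeightSpace g χ) ≤
        LieAlgebra.rootSpace H (0 : H → ℂ) := by
      refine iSup_le fun χ => ?_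
      have : (χ : H → ℂ) = 0 := hne χ
      rw [this]
    have := hle hx
    rwa [LieAlgebra.rootSpace_zero_eq, LieSubalgebra.mem_toLieSubmodule] at this
  refine LieAlgebra.IsSimple.non_abelian (R := ℂ) (L := g) ⟨fun x y => ?_⟩
  have h := LieModule.IsTrivial.trivial (L := H) (M := H) ⟨x, h0 x⟩ ⟨y, h0 y⟩
  exact congrArg Subtype.val h

variable (g) in
theorem exists_isSl2Triple : ∃ h e f : g, IsSl2Triple h e f := by
  obtain ⟨x, hx⟩ := LieAlgebra.exists_isCartanSubalgebra_engel ℂ g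
  obtain ⟨α, hα⟩ := exists_isNonZero_weight g (LieSubalgebra.engel ℂ x)
  obtain ⟨h, e, f, ht, -, -⟩ := LieAlgebra.IsKilling.exists_isSl2Triple_of_weight_isNonZero hα
  exact ⟨h, e, f, ht⟩

/-- If a symmetric equivariant `D` and a scalar `c` satisfy `D(x, [x, z]) + c [x, [x, z]] = 0`,
both vanish: an `sl₂`-triple yields `c = 0`, and then `[z, D(x, x)] = 2 D([z, x], x) = 0`. -/
theorem eq_zero_and_eq_zero_of_apply_lie_self {D : g →ₗ[ℂ] g →ₗ[ℂ] g} (hD : IsEquivariant D)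
    (hs : ∀ x y, D x y = D y x) {c : ℂ} (hc : ∀ x z : g, D x ⁅x, z⁆ + c • ⁅x, ⁅x, z⁆⁆ = 0) :
    D = 0 ∧ c = 0 := by
  have hc0 : c = 0 := by
    obtain ⟨h, e, f, ht⟩ := exists_isSl2Triple g
    have he : ⁅h, e⁆ = (2 : ℂ) • e := by rw [ht.lie_h_e_nsmul, two_smul, two_smul]
    have h1 := hc h e
    have h2 := hc e f
    rw [he, map_smul, lie_smul, he] at h1
    rw [ht.lie_e_f, hs, ← lie_skew, he] at h2
    have h3 : (8 * c) • e = 0 := by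
      linear_combination (norm := module) h1 - (2 : ℂ) • h2
    have := (smul_eq_zero.1 h3).resolve_right ht.e_ne_zero
    simpa using this
  refine ⟨?_, hc0⟩
  have h0 : ∀ x, D x x = 0 := fun x => eq_zero_of_forall_lie_eq_zero fun z => by
    have h := hc x z
    rw [hc0, zero_smul, add_zero] at h
    rw [hD, hs ⁅z, x⁆ x, ← lie_skew, map_neg, h]
    simp
  ext x y
  have h := h0 (x + y)
  simp only [map_add, LinearMap.add_apply, h0, zero_add, add_zero, hs y x] at h
  have h2 : (2 : ℂ) • D x y = 0 := by rw [two_smul]; exact h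
  simpa using h2

/-- The symmetric and antisymmetric parts of a cyclic identity between equivariant maps separate:
if `∑ (Dᵢ(x, [y, z]) + eᵢ [x, [y, z]]) = 0` over the cyclic permutations of `x, y, z`, with
symmetric equivariant `Dᵢ` and scalars `eᵢ`, then the `Dᵢ` vanish and the `eᵢ` are equal. -/
theorem eq_zero_and_eq_of_cyclic {D₁ D₂ D₃ : g →ₗ[ℂ] g →ₗ[ℂ] g} (h₁ : IsEquivariant D₁)
    (h₂ : IsEquivariant D₂) (h₃ : IsEquivariant D₃) (s₁ : ∀ x y, D₁ x y = D₁ y x)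
    (s₂ : ∀ x y, D₂ x y = D₂ y x) (s₃ : ∀ x y, D₃ x y = D₃ y x) {e₁ e₂ e₃ : ℂ}
    (hc : ∀ x y z : g, (D₁ x ⁅y, z⁆ + e₁ • ⁅x, ⁅y, z⁆⁆) + (D₂ y ⁅z, x⁆ + e₂ • ⁅y, ⁅z, x⁆⁆) +
      (D₃ z ⁅x, y⁆ + e₃ • ⁅z, ⁅x, y⁆⁆) = 0) :
    D₁ = 0 ∧ D₂ = 0 ∧ D₃ = 0 ∧ e₁ = e₂ ∧ e₂ = e₃ := by
  obtain ⟨h12, e12⟩ := eq_zero_and_eq_zero_of_apply_lie_self (h₁.sub h₂)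
    (fun x y => by simp only [LinearMap.sub_apply, s₁ x y, s₂ x y]) (c := e₁ - e₂) (fun x z => by
      have h := hc x x z
      rw [lie_self, map_zero, lie_zero, ← lie_skew z x, map_neg, lie_neg] at h
      rw [LinearMap.sub_apply, LinearMap.sub_apply]
      linear_combination (norm := module) h)
  obtain ⟨h23, e23⟩ := eq_zero_and_eq_zero_of_apply_lie_self (h₂.sub h₃)
    (fun x y => by simp only [LinearMap.sub_apply, s₂ x y, s₃ x y]) (c := e₂ - e₃) (fun x z => by
      have h := hc z x x
      rw [lie_self, map_zero, lie_zero, ← lie_skew z x, map_neg, lie_neg] at h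
      rw [LinearMap.sub_apply, LinearMap.sub_apply]
      linear_combination (norm := module) h)
  obtain rfl := sub_eq_zero.1 h12
  obtain rfl := sub_eq_zero.1 h23
  obtain rfl := sub_eq_zero.1 e12
  obtain rfl := sub_eq_zero.1 e23
  have h0 := h₁.eq_zero_of_symm_of_cyclic s₁ (fun x y z => by
    have h := hc x y z
    have hj := lie_jacobi x y z
    linear_combination (norm := module) h - e₁ • hj)
  exact ⟨h0, h0, h0, rfl, rfl⟩

section Roots

variable {H : LieSubalgebra ℂ g} [H.IsCartanSubalgebra]

theorem IsEquivariant.apply_mem_rootSpace {G : g →ₗ[ℂ] g →ₗ[ℂ] g} (hG : IsEquivariant G)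
    {χ χ' : H → ℂ} {x y : g} (hx : x ∈ LieAlgebra.rootSpace H χ)
    (hy : y ∈ LieAlgebra.rootSpace H χ') : G x y ∈ LieAlgebra.rootSpace H (χ + χ') := by
  refine mem_rootSpace_of_lie_eq fun u => ?_
  have h1 : ⁅(u : g), x⁆ = χ u • x := LieAlgebra.IsKilling.lie_eq_smul_of_mem_rootSpace hx u
  have h2 : ⁅(u : g), y⁆ = χ' u • y := LieAlgebra.IsKilling.lie_eq_smul_of_mem_rootSpace hy u
  rw [hG, h1, h2, map_smul, map_smul, LinearMap.smul_apply, Pi.add_apply, add_smul]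

theorem exists_eq_smul_of_mem_rootSpace {α : LieModule.Weight ℂ H g} (hα : α.IsNonZero) {e y : g}
    (he : e ∈ LieAlgebra.rootSpace H α) (he0 : e ≠ 0) (hy : y ∈ LieAlgebra.rootSpace H α) :
    ∃ c : ℂ, y = c • e := by
  have h1 := LieAlgebra.IsKilling.finrank_rootSpace_eq_one α hα
  obtain ⟨c, hc⟩ := (finrank_eq_one_iff_of_nonzero' (⟨e, he⟩ : LieAlgebra.rootSpace H α)
    (fun h => he0 (congrArg Subtype.val h))).1 h1 ⟨y, hy⟩
  exact ⟨c, (congrArg Subtype.val hc).symm⟩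

variable {G : g →ₗ[ℂ] g →ₗ[ℂ] g}

/-- The values of an alternating equivariant map on an `sl₂`-triple of root vectors and the Cartan
subalgebra. -/
theorem IsEquivariant.apply_isSl2Triple (hG : IsEquivariant G) (ha : ∀ x, G x x = 0)
    {α : LieModule.Weight ℂ H g} (hα : α.IsNonZero) {h e f : g} (ht : IsSl2Triple h e f)
    (he : e ∈ LieAlgebra.rootSpace H α) (hf : f ∈ LieAlgebra.rootSpace H (-α)) :
    ∃ k : ℂ, G e f = k • h ∧
      ∀ u : H, ∃ m : ℂ, G u e = (α u * k + m) • e ∧ G u h = m • h := by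
  have hcor : h = LieAlgebra.IsKilling.coroot α := ht.h_eq_coroot hα he hf
  have hH : ∀ u : H, (u : g) ∈ LieAlgebra.rootSpace H (0 : H → ℂ) := fun u => by
    rw [LieAlgebra.rootSpace_zero_eq, LieSubalgebra.mem_toLieSubmodule]; exact u.2
  have hl : ∀ u : H, ∃ l : ℂ, G u e = l • e := fun u => by
    have := hG.apply_mem_rootSpace (hH u) he
    rw [zero_add] at this
    exact exists_eq_smul_of_mem_rootSpace hα he ht.e_ne_zero this
  choose l hl using hl
  have hfu : ∀ u : H, ⁅f, (u : g)⁆ = α u • f := fun u => by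
    have : ⁅(u : g), f⁆ = (-α) u • f := LieAlgebra.IsKilling.lie_eq_smul_of_mem_rootSpace hf u
    rw [← lie_skew, this]
    change -(-(α u) • f) = α u • f
    rw [neg_smul, neg_neg]
  have hfe : ⁅f, e⁆ = -h := by rw [← lie_skew, ht.lie_e_f]
  have key : ∀ u : H, l u • h = α u • G e f + G u h := fun u => by
    have h1 := hG f u e
    rw [hl, lie_smul, hfe, hfu, map_smul, LinearMap.smul_apply, map_neg,
      skew_of_alternating ha f e] at h1
    linear_combination (norm := module) -h1
  set u₀ : H := LieAlgebra.IsKilling.coroot α with hu₀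
  have h2 : G e f = (l u₀ / 2) • h := by
    have h1 := key u₀
    rw [← hcor, ha, add_zero, LieAlgebra.IsKilling.root_apply_coroot hα] at h1
    linear_combination (norm := module) (-1 / 2 : ℂ) • h1
  refine ⟨l u₀ / 2, h2, fun u => ⟨l u - α u * (l u₀ / 2), ?_, ?_⟩⟩
  · rw [hl]; module
  · have h1 := key u
    rw [h2] at h1
    linear_combination (norm := module) -h1

/-- An alternating equivariant map vanishes on a Cartan subalgebra: its value on two coroots is a
multiple of each of them. -/
theorem IsEquivariant.apply_cartan (hG : IsEquivariant G) (ha : ∀ x, G x x = 0) (u v : H) :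
    G u v = 0 := by
  have h1 : ∀ (u : H) (β : LieModule.Weight ℂ H g), β.IsNonZero →
      ∃ m : ℂ, G u (LieAlgebra.IsKilling.coroot β) = m • (LieAlgebra.IsKilling.coroot β : g) := by
    intro u β hβ
    obtain ⟨h, e, f, ht, he, hf⟩ := LieAlgebra.IsKilling.exists_isSl2Triple_of_weight_isNonZero hβ
    obtain ⟨k, -, hk⟩ := hG.apply_isSl2Triple ha hβ ht he hf
    obtain ⟨m, -, hm⟩ := hk u
    rw [ht.h_eq_coroot hβ he hf] at hm
    exact ⟨m, hm⟩
  have h2 : ∀ α β : LieModule.Weight ℂ H g, α.IsNonZero → β.IsNonZero →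
      G (LieAlgebra.IsKilling.coroot α) (LieAlgebra.IsKilling.coroot β) = 0 := by
    intro α β hα hβ
    obtain ⟨m, hm⟩ := h1 (LieAlgebra.IsKilling.coroot α) β hβ
    obtain ⟨m', hm'⟩ := h1 (LieAlgebra.IsKilling.coroot β) α hα
    by_cases hm0 : m = 0
    · rw [hm, hm0, zero_smul]
    · have h3 : (LieAlgebra.IsKilling.coroot β : g) =
          (-m⁻¹ * m') • (LieAlgebra.IsKilling.coroot α : g) := by
        rw [skew_of_alternating ha, hm'] at hm
        rw [mul_smul, neg_smul, ← smul_neg, hm, smul_smul, inv_mul_cancel₀ hm0, one_smul]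
      rw [h3, map_smul, ha, smul_zero]
  have hspan := RootPairing.IsRootSystem.span_coroot_eq_top
    (P := LieAlgebra.IsKilling.rootSystem H)
  have ext : ∀ f : H →ₗ[ℂ] g, (∀ β : LieModule.Weight ℂ H g, β.IsNonZero →
      f (LieAlgebra.IsKilling.coroot β) = 0) → f = 0 := by
    intro f hf
    refine LinearMap.ext_on_range hspan fun β => ?_
    rw [LieAlgebra.IsKilling.rootSystem_coroot_apply, hf _ (LieSubalgebra.isNonZero_coe_root β),
      LinearMap.zero_apply]
  have h3 : ∀ α : LieModule.Weight ℂ H g, α.IsNonZero → ∀ v : H,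
      G (LieAlgebra.IsKilling.coroot α) v = 0 := fun α hα v =>
    LinearMap.congr_fun (ext (G (LieAlgebra.IsKilling.coroot α) ∘ₗ H.toSubmodule.subtype)
      fun β hβ => h2 α β hα hβ) v
  exact LinearMap.congr_fun (ext (G.flip v ∘ₗ H.toSubmodule.subtype) fun β hβ => h3 β hβ v) u

/-- On the product of the Cartan subalgebra and a root space, an alternating equivariant map is a
multiple of the bracket. -/
theorem IsEquivariant.exists_apply_cartan_rootSpace (hG : IsEquivariant G) (ha : ∀ x, G x x = 0)
    {α : LieModule.Weight ℂ H g} (hα : α.IsNonZero) :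
    ∃ k : ℂ, ∀ u : H, ∀ y ∈ LieAlgebra.rootSpace H α, G u y = (α u * k) • y := by
  obtain ⟨h, e, f, ht, he, hf⟩ := LieAlgebra.IsKilling.exists_isSl2Triple_of_weight_isNonZero hα
  obtain ⟨k, -, hk⟩ := hG.apply_isSl2Triple ha hα ht he hf
  refine ⟨k, fun u y hy => ?_⟩
  obtain ⟨m, hm, hm'⟩ := hk u
  rw [ht.h_eq_coroot hα he hf, hG.apply_cartan ha] at hm'
  have hm0 : m = 0 := by
    refine (smul_eq_zero.1 hm'.symm).resolve_right ?_
    rw [← ht.h_eq_coroot hα he hf]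
    exact ht.h_ne_zero
  obtain ⟨c, rfl⟩ := exists_eq_smul_of_mem_rootSpace hα he ht.e_ne_zero hy
  rw [map_smul, hm, hm0, add_zero, smul_comm]

/-- Roots that are not proportional are separated by elements of the Cartan subalgebra. -/
theorem exists_root_eq_zero_and_ne_zero {α β : LieModule.Weight ℂ H g} (hα : α.IsNonZero)
    (hβ : β.IsNonZero) (h1 : α ≠ β) (h2 : α ≠ -β) : ∃ u : H, β u = 0 ∧ α u ≠ 0 := by
  by_contra! hne
  obtain ⟨u₀, hu₀⟩ : ∃ u, β u ≠ 0 := by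
    by_contra! h
    exact hβ (funext h)
  rcases LieAlgebra.IsKilling.eq_neg_or_eq_of_eq_smul β α hα (α u₀ / β u₀) (funext fun u => by
    have h : α.toLinear ℂ H g (u - (β u / β u₀) • u₀) = 0 := hne (u - (β u / β u₀) • u₀) (by
      change β.toLinear ℂ H g (u - (β u / β u₀) • u₀) = 0
      rw [map_sub, map_smul]
      change β u - (β u / β u₀) • β u₀ = 0
      rw [smul_eq_mul, div_mul_cancel₀ _ hu₀, sub_self])
    rw [map_sub, map_smul] at h
    change α u - (β u / β u₀) • α u₀ = 0 at h
    rw [sub_eq_zero.1 h, Pi.smul_apply, smul_eq_mul, smul_eq_mul]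
    ring) with h | h
  · exact h2 h
  · exact h1 h

end Roots

/-- Every alternating equivariant map `g × g → g` is a multiple of the bracket: after subtraction
of the multiple that agrees with it on an `sl₂`-triple of root vectors, it kills a root vector. -/
theorem IsEquivariant.exists_eq_smul_of_alternating {G : g →ₗ[ℂ] g →ₗ[ℂ] g}
    (hG : IsEquivariant G) (ha : ∀ x, G x x = 0) : ∃ k : ℂ, ∀ x y : g, G x y = k • ⁅x, y⁆ := by
  obtain ⟨x₀, hx₀⟩ := LieAlgebra.exists_isCartanSubalgebra_engel ℂ g
  set H := LieSubalgebra.engel ℂ x₀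
  obtain ⟨α, hα⟩ := exists_isNonZero_weight g H
  obtain ⟨h, e, f, ht, he, hf⟩ := LieAlgebra.IsKilling.exists_isSl2Triple_of_weight_isNonZero hα
  obtain ⟨k, hk, hu⟩ := hG.apply_isSl2Triple ha hα ht he hf
  refine ⟨k, ?_⟩
  set G' := G - k • bracketBilin g with hG'
  have hE : IsEquivariant G' := hG.sub (isEquivariant_bracketBilin.smul k)
  have ha' : ∀ x, G' x x = 0 := fun x => by simp [hG', ha]
  have hef : G' e f = 0 := by simp [hG', hk, ht.lie_e_f]
  have hue : ∀ u : H, G' u e = 0 := fun u => by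
    obtain ⟨m, hm, hm'⟩ := hu u
    rw [ht.h_eq_coroot hα he hf, hG.apply_cartan ha] at hm'
    have hm0 : m = 0 := by
      refine (smul_eq_zero.1 hm'.symm).resolve_right ?_
      rw [← ht.h_eq_coroot hα he hf]
      exact ht.h_ne_zero
    have hb : ⁅(u : g), e⁆ = α u • e := LieAlgebra.IsKilling.lie_eq_smul_of_mem_rootSpace he u
    simp [hG', hm, hm0, hb, smul_smul, mul_comm]
  have hroot : ∀ (β : LieModule.Weight ℂ H g) (y : g), y ∈ LieAlgebra.rootSpace H β →
      G' e y = 0 := by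
    intro β y hy
    by_cases hβ : β.IsZero
    · have : (β : H → ℂ) = 0 := hβ
      rw [this, LieAlgebra.rootSpace_zero_eq, LieSubalgebra.mem_toLieSubmodule] at hy
      rw [skew_of_alternating ha', hue ⟨y, hy⟩, neg_zero]
    by_cases h1 : β = α
    · subst h1
      obtain ⟨c, rfl⟩ := exists_eq_smul_of_mem_rootSpace hα he ht.e_ne_zero hy
      rw [map_smul, ha', smul_zero]
    by_cases h2 : β = -α
    · subst h2
      obtain ⟨c, rfl⟩ := exists_eq_smul_of_mem_rootSpace hβ hf ht.f_ne_zero hy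
      rw [map_smul, hef, smul_zero]
    -- `G' u ⁅y, e⁆` is on the one hand `β u • G' y e`, on the other hand `(β + α) u • k' • ⁅y, e⁆`
    have key : ∀ u : H, G' u ⁅y, e⁆ = β u • G' y e := fun u => by
      have h3 := hE y u e
      have h4 : ⁅y, (u : g)⁆ = -(β u • y) := by
        have : ⁅(u : g), y⁆ = β u • y := LieAlgebra.IsKilling.lie_eq_smul_of_mem_rootSpace hy u
        rw [← lie_skew, this]
      rw [hue, lie_zero, h4, map_neg, map_smul, LinearMap.neg_apply, LinearMap.smul_apply] at h3
      linear_combination (norm := module) -h3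
    have hzero : ∀ u : H, G' u ⁅y, e⁆ = 0 := by
      by_cases hye : ⁅y, e⁆ = 0
      · intro u; rw [hye, map_zero]
      have hmem : ⁅y, e⁆ ∈ LieAlgebra.rootSpace H ((β : H → ℂ) + α) :=
        LieAlgebra.lie_mem_genWeightSpace_of_mem_genWeightSpace hy he
      let γ : LieModule.Weight ℂ H g := ⟨(β : H → ℂ) + α, fun hbot => hye (by
        have := hmem
        rw [LieAlgebra.rootSpace, hbot] at this
        exact this)⟩
      have hγ : γ.IsNonZero := fun h0 => h2 (by
        have h0' : (β : H → ℂ) + α = 0 := h0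
        ext u
        have := congrFun h0' u
        exact eq_neg_of_add_eq_zero_left this)
      obtain ⟨k', hk'⟩ := hE.exists_apply_cartan_rootSpace ha' hγ
      obtain ⟨u, hu0, hu1⟩ := exists_root_eq_zero_and_ne_zero hα hβ (Ne.symm h1)
        (fun h => h2 (by rw [h, neg_neg]))
      have h3 := hk' u _ hmem
      rw [key, hu0, zero_smul] at h3
      have h4 : (γ u : ℂ) = α u := by
        change β u + α u = α u
        rw [hu0, zero_add]
      have h5 : k' = 0 := by
        have := (smul_eq_zero.1 h3.symm).resolve_right hye
        rw [h4] at this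
        exact (mul_eq_zero.1 this).resolve_left hu1
      intro u
      rw [hk' u _ hmem, h5, mul_zero, zero_smul]
    obtain ⟨u, hu0⟩ : ∃ u, β u ≠ 0 := by
      by_contra! h
      exact hβ (funext h)
    have h3 := key u
    rw [hzero] at h3
    rw [skew_of_alternating ha', (smul_eq_zero.1 h3.symm).resolve_left hu0, neg_zero]
  have hGe : G' e = 0 := by
    ext y
    have hy : y ∈ (⊤ : LieSubmodule ℂ H g) := LieSubmodule.mem_top y
    rw [← LieModule.iSup_genWeightSpace_eq_top' ℂ H g] at hy
    induction hy using LieSubmodule.iSup_induction' with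
    | mem β z hz => rw [hroot β z hz, LinearMap.zero_apply]
    | zero => simp
    | add z w _ _ hz hw => rw [map_add, hz, hw, map_add]
  have h0 := hE.eq_zero_of_apply_eq_zero ht.e_ne_zero hGe
  intro x y
  have := LinearMap.congr_fun₂ (sub_eq_zero.1 (hG'.symm.trans h0)) x y
  simpa using this

end Equivariant

/-! ### Coordinates on the current algebra -/

section Coordinates

variable (g : Type*) [LieRing g] [LieAlgebra ℂ g]

/-- The coefficient of `zᵐ` of an element of the current algebra. -/
def coeff (m : ℤ) : CurrentAlgebra g →ₗ[ℂ] g :=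
  Finsupp.lapply m ∘ₗ
    (TensorProduct.equivFinsuppOfBasisLeft (N := g) (AddMonoidAlgebra.basis ℤ ℂ)).toLinearMap

/-- The bracket of the current algebra, found through its structure of a Lie ring, so that the
general lemmas on Lie modules apply to it. -/
instance (priority := 2000) instBracketCurrentAlgebra :
    Bracket (CurrentAlgebra g) (CurrentAlgebra g) :=
  LieRingModule.toBracket

variable {g}

theorem coeff_tmul (m : ℤ) (a : ℂ[T;T⁻¹]) (x : g) :
    coeff g m (a ⊗ₜ[ℂ] x) = a.coeff m • x := by
  rw [coeff, LinearMap.comp_apply, LinearEquiv.coe_coe, Finsupp.lapply_apply,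
    TensorProduct.equivFinsuppOfBasisLeft_apply_tmul_apply]
  rfl

theorem current_ext {X Y : CurrentAlgebra g} (h : ∀ m, coeff g m X = coeff g m Y) : X = Y := by
  apply (TensorProduct.equivFinsuppOfBasisLeft (N := g) (AddMonoidAlgebra.basis ℤ ℂ)).injective
  ext m
  exact h m

/-- The map `id ⊗ ξ` from the current algebra to Laurent polynomials, for a functional `ξ`. -/
def contractRight (ξ : g →ₗ[ℂ] ℂ) : CurrentAlgebra g →ₗ[ℂ] ℂ[T;T⁻¹] :=
  (TensorProduct.rid ℂ ℂ[T;T⁻¹]).toLinearMap ∘ₗ TensorProduct.map LinearMap.id ξ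

theorem coeff_contractRight (ξ : g →ₗ[ℂ] ℂ) (X : CurrentAlgebra g) (m : ℤ) :
    (contractRight ξ X).coeff m = ξ (coeff g m X) := by
  induction X using TensorProduct.induction_on with
  | zero => simp
  | tmul a x => simp [contractRight, coeff_tmul, mul_comm]
  | add X Y hX hY => simp [hX, hY]

/-- A linear map from a finite-dimensional space to the current algebra has finitely many nonzero
coefficients. -/
theorem exists_finset_coeff_eq_zero {V : Type*} [AddCommGroup V] [Module ℂ V]
    [FiniteDimensional ℂ V] (f : V →ₗ[ℂ] CurrentAlgebra g) :
    ∃ S : Finset ℤ, ∀ m ∉ S, coeff g m ∘ₗ f = 0 := by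
  classical
  let b := Module.finBasis ℂ V
  let s := fun i => (TensorProduct.equivFinsuppOfBasisLeft (N := g)
    (AddMonoidAlgebra.basis ℤ ℂ) (f (b i))).support
  refine ⟨Finset.univ.biUnion s, fun m hm => b.ext fun i => ?_⟩
  simp only [Finset.mem_biUnion, Finset.mem_univ, true_and, not_exists] at hm
  exact Finsupp.notMem_support_iff.1 (hm i)

/-- A family of linear maps with finitely many nonzero members is the family of coefficients of a
linear map to the current algebra. -/
theorem exists_coeff_eq {V : Type*} [AddCommGroup V] [Module ℂ V] (ψ : ℤ → V →ₗ[ℂ] g)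
    (S : Finset ℤ) (hS : ∀ m ∉ S, ψ m = 0) :
    ∃ Ψ : V →ₗ[ℂ] CurrentAlgebra g, ∀ m v, coeff g m (Ψ v) = ψ m v := by
  refine ⟨∑ n ∈ S, TensorProduct.mk ℂ ℂ[T;T⁻¹] g (LaurentPolynomial.T n) ∘ₗ ψ n, fun m v => ?_⟩
  simp only [LinearMap.sum_apply, LinearMap.comp_apply, TensorProduct.mk_apply, map_sum,
    coeff_tmul, LaurentPolynomial.T_apply, ite_smul, one_smul, zero_smul, Finset.sum_ite_eq']
  split_ifs with h
  · rfl
  · rw [hS m h, LinearMap.zero_apply]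

theorem linearMap_ext_T {V : Type*} [AddCommGroup V] [Module ℂ V]
    {f f' : ℂ[T;T⁻¹] →ₗ[ℂ] V} (h : ∀ n, f (LaurentPolynomial.T n) = f' (LaurentPolynomial.T n)) :
    f = f' :=
  (AddMonoidAlgebra.basis ℤ ℂ).ext fun n => by
    rw [AddMonoidAlgebra.basis_apply]; exact h n

theorem exists_linearMap_T {V : Type*} [AddCommGroup V] [Module ℂ V] (v : ℤ → V) :
    ∃ f : ℂ[T;T⁻¹] →ₗ[ℂ] V, ∀ n, f (LaurentPolynomial.T n) = v n :=
  ⟨(AddMonoidAlgebra.basis ℤ ℂ).constr ℂ v, fun n => by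
    have : (LaurentPolynomial.T n : ℂ[T;T⁻¹]) = AddMonoidAlgebra.basis ℤ ℂ n :=
      (AddMonoidAlgebra.basis_apply ℂ n).symm
    rw [this, Module.Basis.constr_basis]⟩

theorem lie_tmul_tmul (a b : ℂ[T;T⁻¹]) (x y : g) :
    ⁅a ⊗ₜ[ℂ] x, b ⊗ₜ[ℂ] y⁆ = (a * b) ⊗ₜ[ℂ] ⁅x, y⁆ :=
  LieAlgebra.ExtendScalars.bracket_tmul _ _ _ _ _ _ _ _

theorem lie_tmul_eq_smul (a : ℂ[T;T⁻¹]) (x : g) (X : CurrentAlgebra g) :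
    ⁅a ⊗ₜ[ℂ] x, X⁆ = a • ⁅(1 : ℂ[T;T⁻¹]) ⊗ₜ[ℂ] x, X⁆ := by
  rw [← smul_lie, TensorProduct.smul_tmul', smul_eq_mul, mul_one]

theorem coeff_lie (m : ℤ) (x : g) (X : CurrentAlgebra g) :
    coeff g m ⁅(1 : ℂ[T;T⁻¹]) ⊗ₜ[ℂ] x, X⁆ = ⁅x, coeff g m X⁆ := by
  induction X using TensorProduct.induction_on with
  | zero => simp
  | tmul a y => rw [lie_tmul_tmul, one_mul, coeff_tmul, coeff_tmul, lie_smul]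
  | add X Y hX hY => rw [lie_add, map_add, hX, hY, map_add, lie_add]

end Coordinates

/-! ### Cocycles with adjoint coefficients -/

section Cocycle

variable {K L : Type*} [CommRing K] [LieRing L] [LieAlgebra K L]

/-- `σ` is an alternating `2`-cocycle of `L` with coefficients in the adjoint representation. -/
structure IsCocycle (σ : L →ₗ[K] L →ₗ[K] L) : Prop where
  alternating : ∀ X, σ X X = 0
  cocycle : ∀ X Y Z, ⁅X, σ Y Z⁆ + ⁅Y, σ Z X⁆ + ⁅Z, σ X Y⁆ +
    (σ X ⁅Y, Z⁆ + σ Y ⁅Z, X⁆ + σ Z ⁅X, Y⁆) = 0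

/-- The coboundary of a linear map `ψ : L → L`. -/
def coboundary (ψ : L →ₗ[K] L) : L →ₗ[K] L →ₗ[K] L :=
  LinearMap.mk₂ K (fun X Y => ⁅X, ψ Y⁆ - ⁅Y, ψ X⁆ - ψ ⁅X, Y⁆)
    (fun X X' Y => by simp only [add_lie, map_add, lie_add]; abel)
    (fun c X Y => by simp only [smul_lie, map_smul, lie_smul, smul_sub])
    (fun X Y Y' => by simp only [add_lie, map_add, lie_add]; abel)
    (fun c X Y => by simp only [smul_lie, map_smul, lie_smul, smul_sub])

theorem coboundary_apply (ψ : L →ₗ[K] L) (X Y : L) :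
    coboundary ψ X Y = ⁅X, ψ Y⁆ - ⁅Y, ψ X⁆ - ψ ⁅X, Y⁆ := rfl

theorem coboundary_add (ψ ψ' : L →ₗ[K] L) :
    coboundary (ψ + ψ') = coboundary ψ + coboundary ψ' := by
  ext X Y
  simp only [coboundary_apply, LinearMap.add_apply, lie_add]
  abel

theorem IsCocycle.skew {σ : L →ₗ[K] L →ₗ[K] L} (h : IsCocycle σ) (X Y : L) :
    σ X Y = -σ Y X :=
  skew_of_alternating h.alternating X Y

/-- The cocycle identity with the arguments in the order of the Chevalley-Eilenberg differential. -/
theorem IsCocycle.differential_eq_zero {σ : L →ₗ[K] L →ₗ[K] L} (h : IsCocycle σ) (X Y Z : L) :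
    ⁅X, σ Y Z⁆ - ⁅Y, σ X Z⁆ + ⁅Z, σ X Y⁆ +
      (σ X ⁅Y, Z⁆ - σ Y ⁅X, Z⁆ - σ ⁅X, Y⁆ Z) = 0 := by
  have e := h.cocycle X Y Z
  rw [h.skew Z X, h.skew Z, ← lie_skew Z X, map_neg, lie_neg] at e
  rw [← e]
  abel

theorem IsCocycle.sub {σ σ' : L →ₗ[K] L →ₗ[K] L} (h : IsCocycle σ) (h' : IsCocycle σ') :
    IsCocycle (σ - σ') where
  alternating X := by simp [h.alternating, h'.alternating]
  cocycle X Y Z := by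
    simp only [LinearMap.sub_apply, lie_sub]
    rw [← sub_zero (0 : L)]
    nth_rewrite 1 [← h.cocycle X Y Z]
    rw [← h'.cocycle X Y Z]
    abel

theorem isCocycle_coboundary (ψ : L →ₗ[K] L) : IsCocycle (coboundary ψ) where
  alternating X := by simp [coboundary_apply]
  cocycle X Y Z := by
    simp only [coboundary_apply, lie_sub]
    have h1 : ψ (⁅X, ⁅Y, Z⁆⁆ + ⁅Y, ⁅Z, X⁆⁆ + ⁅Z, ⁅X, Y⁆⁆) = 0 := by
      rw [lie_jacobi, map_zero]
    simp only [map_add] at h1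
    have e : ∀ A B C : L, ⁅⁅A, B⁆, C⁆ = ⁅A, ⁅B, C⁆⁆ - ⁅B, ⁅A, C⁆⁆ := lie_lie
    simp only [e]
    rw [← neg_eq_zero, ← h1]
    abel

end Cocycle

/-! ### Hochschild cocycles and derivations of Laurent polynomials -/

section LaurentCocycle

/-- A normalised Hochschild `2`-cocycle of the algebra of Laurent polynomials is a coboundary: in
terms of `f m n = z⁻ᵐ⁻ⁿ h(zᵐ, zⁿ)` this is the vanishing of the second cohomology of the group of
integers. -/
theorem exists_hochschild_primitive (h : ℂ[T;T⁻¹] →ₗ[ℂ] ℂ[T;T⁻¹] →ₗ[ℂ] ℂ[T;T⁻¹])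
    (h1 : ∀ a, h a 1 = 0)
    (hc : ∀ a b c, a * h b c + h a (b * c) = c * h a b + h (a * b) c) :
    ∃ k : ℂ[T;T⁻¹] →ₗ[ℂ] ℂ[T;T⁻¹], ∀ a b, h a b = a * k b + b * k a - k (a * b) := by
  set T : ℤ → ℂ[T;T⁻¹] := LaurentPolynomial.T with hT
  have hadd : ∀ m n, T (m + n) = T m * T n := LaurentPolynomial.T_add
  have hinv : ∀ m, T m * T (-m) = 1 := fun m => by
    rw [← hadd, add_neg_cancel, hT, LaurentPolynomial.T_zero]
  let f : ℤ → ℤ → ℂ[T;T⁻¹] := fun m n => T (-m) * T (-n) * h (T m) (T n)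
  have hf : ∀ m n, h (T m) (T n) = T m * T n * f m n := fun m n => by
    have e1 := hinv m
    have e2 := hinv n
    simp only [f]
    linear_combination (-1 - (T n * T (-n) - 1)) * h (T m) (T n) * e1 - h (T m) (T n) * e2
  have hf1 : ∀ m n, f m n + f (m + n) 1 = f n 1 + f m (n + 1) := by
    intro m n
    have e := hc (T m) (T n) (T 1)
    rw [← hadd, ← hadd, hf, hf, hf, hf, hadd, hadd] at e
    have e1 := hinv m
    have e2 := hinv n
    have e3 := hinv 1
    have e4 : T m * T n * T 1 * (f m n + f (m + n) 1 - f n 1 - f m (n + 1)) = 0 := by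
      linear_combination -e
    have e5 : T (-m) * T (-n) * T (-1) * (T m * T n * T 1) = 1 := by
      linear_combination e1 + T m * T (-m) * e2 + T m * T (-m) * T n * T (-n) * e3
    have e6 : f m n + f (m + n) 1 - f n 1 - f m (n + 1) = 0 := by
      have := congrArg (fun w => T (-m) * T (-n) * T (-1) * w) e4
      simp only [mul_zero] at this
      rw [← mul_assoc, e5, one_mul] at this
      exact this
    linear_combination e6
  -- the solution of `κ 0 = 0`, `κ (n + 1) = κ n - f n 1`; one of the two intervals is empty
  let κ : ℤ → ℂ[T;T⁻¹] := fun n => ∑ i ∈ Finset.Ico n 0, f i 1 - ∑ i ∈ Finset.Ico 0 n, f i 1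
  have hκ0 : κ 0 = 0 := by simp [κ]
  have hκ : ∀ n, κ (n + 1) = κ n - f n 1 := by
    intro n
    simp only [κ]
    rcases le_or_gt 0 n with hn | hn
    · rw [Finset.Ico_eq_empty (by omega), Finset.Ico_eq_empty (a := n) (by omega),
        ← Finset.insert_Ico_right_eq_Ico_add_one hn, Finset.sum_insert (by simp)]
      ring
    · rw [Finset.Ico_eq_empty (a := 0) (b := n + 1) (by omega),
        Finset.Ico_eq_empty (a := 0) (b := n) (by omega),
        ← Finset.insert_Ico_add_one_left_eq_Ico hn, Finset.sum_insert (by simp)]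
      ring
  have hfκ : ∀ m n, f m n = κ m + κ n - κ (m + n) := by
    intro m n
    have step : ∀ n, f m n - (κ m + κ n - κ (m + n)) =
        f m (n + 1) - (κ m + κ (n + 1) - κ (m + (n + 1))) := by
      intro n
      rw [← add_assoc, hκ, hκ]
      linear_combination hf1 m n
    rw [← sub_eq_zero]
    induction n using Int.induction_on with
    | zero =>
      have : T 0 = 1 := LaurentPolynomial.T_zero
      simp [f, this, h1, hκ0]
    | succ n ih => rw [← step, ih]
    | pred n ih => rw [step, sub_add_cancel, ih]
  obtain ⟨k, hk⟩ := exists_linearMap_T (fun n => T n * κ n)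
  refine ⟨k, fun a b => ?_⟩
  have key : h = (LinearMap.mul ℂ ℂ[T;T⁻¹]).compl₂ k +
      ((LinearMap.mul ℂ ℂ[T;T⁻¹]).compl₂ k).flip - (LinearMap.mul ℂ ℂ[T;T⁻¹]).compr₂ k := by
    refine linearMap_ext_T fun m => linearMap_ext_T fun n => ?_
    simp only [LinearMap.sub_apply, LinearMap.add_apply, LinearMap.compl₂_apply,
      LinearMap.flip_apply, LinearMap.compr₂_apply, LinearMap.mul_apply']
    rw [← LaurentPolynomial.T_add, hk, hk, hk]
    change h (T m) (T n) = T m * (T n * κ n) + T n * (T m * κ m) - T (m + n) * κ (m + n)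
    rw [hf, hfκ, hadd]
    ring
  have := LinearMap.congr_fun₂ key a b
  simpa using this

/-- A derivation of the algebra of Laurent polynomials is determined by its value at `z`. -/
theorem derivation_eq_zero_of_T {V : Type*} [AddCommGroup V] [Module ℂ V] [Module ℂ[T;T⁻¹] V]
    (d : ℂ[T;T⁻¹] →ₗ[ℂ] V) (hd : ∀ a b, d (a * b) = a • d b + b • d a)
    (h1 : d (LaurentPolynomial.T 1) = 0) : d = 0 := by
  have step : ∀ n : ℤ, d (LaurentPolynomial.T (n + 1)) =
      (LaurentPolynomial.T 1 : ℂ[T;T⁻¹]) • d (LaurentPolynomial.T n) := fun n => by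
    rw [LaurentPolynomial.T_add, hd, h1, smul_zero, zero_add]
  refine linearMap_ext_T fun n => ?_
  rw [LinearMap.zero_apply]
  induction n using Int.induction_on with
  | zero =>
    have := hd 1 1
    rw [one_mul, one_smul] at this
    rw [LaurentPolynomial.T_zero]
    simpa using this
  | succ n ih => rw [step, ih, smul_zero]
  | pred n ih =>
    have h2 := step (-n - 1)
    rw [sub_add_cancel, ih] at h2
    have h3 := congrArg (fun w => (LaurentPolynomial.T (-1) : ℂ[T;T⁻¹]) • w) h2
    simp only [smul_zero, smul_smul] at h3
    rw [← LaurentPolynomial.T_add, neg_add_cancel, LaurentPolynomial.T_zero, one_smul] at h3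
    exact h3.symm

end LaurentCocycle

/-! ### Vanishing of the second cohomology of the current algebra -/

section CurrentCohomologyVanishing

variable {g : Type*} [LieRing g] [LieAlgebra ℂ g]

/-- A cocycle that vanishes when one argument is in `g` is `g`-equivariant. -/
theorem IsCocycle.lie_apply_of_constant
    {σ : CurrentAlgebra g →ₗ[ℂ] CurrentAlgebra g →ₗ[ℂ] CurrentAlgebra g} (h : IsCocycle σ)
    (h0 : ∀ (x : g) (Y : CurrentAlgebra g), σ ((1 : ℂ[T;T⁻¹]) ⊗ₜ[ℂ] x) Y = 0)
    (x : g) (Y Z : CurrentAlgebra g) :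
    ⁅(1 : ℂ[T;T⁻¹]) ⊗ₜ[ℂ] x, σ Y Z⁆ =
      σ ⁅(1 : ℂ[T;T⁻¹]) ⊗ₜ[ℂ] x, Y⁆ Z + σ Y ⁅(1 : ℂ[T;T⁻¹]) ⊗ₜ[ℂ] x, Z⁆ := by
  have e := h.differential_eq_zero ((1 : ℂ[T;T⁻¹]) ⊗ₜ[ℂ] x) Y Z
  rw [h0, h0, h0, lie_zero, lie_zero] at e
  linear_combination (norm := module) e

variable [FiniteDimensional ℂ g] [LieAlgebra.IsSimple ℂ g]

/-- Modulo coboundaries a cocycle vanishes on `g × g`, by Whitehead's second lemma. -/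
theorem IsCocycle.exists_eq_coboundary_on_constants
    {σ : CurrentAlgebra g →ₗ[ℂ] CurrentAlgebra g →ₗ[ℂ] CurrentAlgebra g} (h : IsCocycle σ) :
    ∃ ψ : CurrentAlgebra g →ₗ[ℂ] CurrentAlgebra g, ∀ x y : g,
      σ ((1 : ℂ[T;T⁻¹]) ⊗ₜ[ℂ] x) ((1 : ℂ[T;T⁻¹]) ⊗ₜ[ℂ] y) =
        coboundary ψ ((1 : ℂ[T;T⁻¹]) ⊗ₜ[ℂ] x) ((1 : ℂ[T;T⁻¹]) ⊗ₜ[ℂ] y) := by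
  let ι : g →ₗ[ℂ] CurrentAlgebra g := TensorProduct.mk ℂ ℂ[T;T⁻¹] g 1
  let f : ℤ → g →ₗ[ℂ] g →ₗ[ℂ] g := fun m => (σ.compl₁₂ ι ι).compr₂ (coeff g m)
  obtain ⟨S, hS⟩ := exists_finset_coeff_eq_zero (TensorProduct.lift (σ.compl₁₂ ι ι))
  have hψ : ∀ m, ∃ ψ : g →ₗ[ℂ] g,
      (∀ x y, f m x y = ⁅x, ψ y⁆ - ⁅y, ψ x⁆ - ψ ⁅x, y⁆) ∧ (m ∉ S → ψ = 0) := by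
    intro m
    by_cases hm : m ∈ S
    · obtain ⟨ψ, hψ⟩ := exists_coboundary_of_cocycle (f m)
        (fun x => by simp [f, h.alternating]) (fun x y z => by
          have e := congrArg (coeff g m) (h.cocycle (ι x) (ι y) (ι z))
          simp only [map_add, map_zero] at e
          simp only [ι, TensorProduct.mk_apply, coeff_lie, lie_tmul_tmul, one_mul] at e
          exact e)
      exact ⟨ψ, hψ, fun hm' => absurd hm hm'⟩
    · refine ⟨0, fun x y => ?_, fun _ => rfl⟩
      have := LinearMap.congr_fun (hS m hm) (x ⊗ₜ y)
      simpa [f] using this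
  choose ψ hψ hψ0 using hψ
  obtain ⟨Ψ, hΨ⟩ := exists_coeff_eq ψ S hψ0
  have h0 : ∀ x : g, coeff g 0 ((1 : ℂ[T;T⁻¹]) ⊗ₜ[ℂ] x) = x := fun x => by
    rw [coeff_tmul, ← LaurentPolynomial.T_zero, LaurentPolynomial.T_apply, if_pos rfl, one_smul]
  refine ⟨Ψ ∘ₗ coeff g 0, fun x y => current_ext fun m => ?_⟩
  rw [coboundary_apply, map_sub, map_sub, coeff_lie, coeff_lie, lie_tmul_tmul, one_mul]
  simp only [LinearMap.comp_apply, h0, hΨ]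
  exact hψ m x y

/-- Modulo coboundaries a cocycle that vanishes on `g × g` vanishes when one argument is in `g`,
by Whitehead's first lemma. -/
theorem IsCocycle.exists_eq_coboundary_of_constant
    {σ : CurrentAlgebra g →ₗ[ℂ] CurrentAlgebra g →ₗ[ℂ] CurrentAlgebra g} (h : IsCocycle σ)
    (h0 : ∀ x y : g, σ ((1 : ℂ[T;T⁻¹]) ⊗ₜ[ℂ] x) ((1 : ℂ[T;T⁻¹]) ⊗ₜ[ℂ] y) = 0) :
    ∃ ψ : CurrentAlgebra g →ₗ[ℂ] CurrentAlgebra g, ∀ (x : g) (Y : CurrentAlgebra g),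
      σ ((1 : ℂ[T;T⁻¹]) ⊗ₜ[ℂ] x) Y = coboundary ψ ((1 : ℂ[T;T⁻¹]) ⊗ₜ[ℂ] x) Y := by
  let ι : ℂ[T;T⁻¹] → g →ₗ[ℂ] CurrentAlgebra g := fun a => TensorProduct.mk ℂ ℂ[T;T⁻¹] g a
  have hΨ : ∀ n : ℤ, ∃ Ψ : g →ₗ[ℂ] CurrentAlgebra g,
      (∀ x u, σ (ι 1 x) (ι (LaurentPolynomial.T n) u) = ⁅ι 1 x, Ψ u⁆ - Ψ ⁅x, u⁆) ∧
        (n = 0 → Ψ = 0) := by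
    intro n
    rcases eq_or_ne n 0 with rfl | hn
    · refine ⟨0, fun x u => ?_, fun _ => rfl⟩
      rw [LaurentPolynomial.T_zero]
      simpa [ι] using h0 x u
    -- the coefficients of `σ(x, zⁿ ⊗ u)` are derivations of `g` with values in `End g`
    let c : ℤ → g →ₗ[ℂ] g →ₗ[ℂ] g := fun m =>
      (σ.compl₁₂ (ι 1) (ι (LaurentPolynomial.T n))).compr₂ (coeff g m)
    obtain ⟨S, hS⟩ := exists_finset_coeff_eq_zero
      (TensorProduct.lift (σ.compl₁₂ (ι 1) (ι (LaurentPolynomial.T n))))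
    have hψ : ∀ m, ∃ ψ : g →ₗ[ℂ] g,
        (∀ x u, c m x u = ⁅x, ψ u⁆ - ψ ⁅x, u⁆) ∧ (m ∉ S → ψ = 0) := by
      intro m
      by_cases hm : m ∈ S
      · obtain ⟨ψ, hψ⟩ := exists_eq_lie_of_derivation (c m) (fun x y => by
          ext u
          have e := congrArg (coeff g m)
            (h.differential_eq_zero (ι 1 x) (ι 1 y) (ι (LaurentPolynomial.T n) u))
          simp only [map_add, map_sub, map_zero] at e
          simp only [ι, TensorProduct.mk_apply, coeff_lie, lie_tmul_tmul, one_mul, h0, lie_zero,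
            map_zero] at e
          simp only [LinearMap.sub_apply, LieHom.lie_apply]
          simp only [c, ι, LinearMap.compr₂_apply, LinearMap.compl₁₂_apply,
            TensorProduct.mk_apply]
          linear_combination (norm := module) -e)
        exact ⟨ψ, fun x u => by rw [hψ, LieHom.lie_apply], fun hm' => absurd hm hm'⟩
      · refine ⟨0, fun x u => ?_, fun _ => rfl⟩
        have := LinearMap.congr_fun (hS m hm) (x ⊗ₜ u)
        simpa [c] using this
    choose ψ hψ hψ0 using hψ
    obtain ⟨Ψ, hΨ⟩ := exists_coeff_eq ψ S hψ0
    refine ⟨Ψ, fun x u => current_ext fun m => ?_, fun hn' => absurd hn' hn⟩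
    rw [map_sub, hΨ]
    simp only [ι, TensorProduct.mk_apply, coeff_lie, hΨ]
    exact hψ m x u
  choose Ψ hΨ hΨ0 using hΨ
  obtain ⟨F, hF⟩ := exists_linearMap_T Ψ
  have hψ : ∀ n u, TensorProduct.lift F (LaurentPolynomial.T n ⊗ₜ u) = Ψ n u := fun n u => by
    rw [TensorProduct.lift.tmul, hF]
  refine ⟨TensorProduct.lift F, fun x => LinearMap.congr_fun (f := σ (1 ⊗ₜ x)) ?_⟩
  refine TensorProduct.ext (linearMap_ext_T (V := g →ₗ[ℂ] CurrentAlgebra g) fun n =>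
    LinearMap.ext fun u => ?_)
  have h1 : TensorProduct.lift F ((1 : ℂ[T;T⁻¹]) ⊗ₜ[ℂ] x) = 0 := by
    rw [← LaurentPolynomial.T_zero, hψ, hΨ0 0 rfl, LinearMap.zero_apply]
  change σ _ (LaurentPolynomial.T n ⊗ₜ u) =
    coboundary (TensorProduct.lift F) _ (LaurentPolynomial.T n ⊗ₜ u)
  rw [coboundary_apply, h1, lie_zero, sub_zero, lie_tmul_tmul, one_mul, hψ, hψ]
  exact hΨ n x u

/-- A cocycle that vanishes when one argument is in `g` is a coboundary. For Laurent polynomials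
`a`, `b` the slice `G a b (x, y) = σ(a ⊗ x, b ⊗ y)` is equivariant, so twice its alternating part
is `μ(a, b) ⊗ [x, y]`. The cocycle identity separates into a statement on the symmetric part `S`,
which is a biderivation in `a`, `b` that changes sign under their exchange and hence vanishes, and
a statement on `μ`, which is a Hochschild cocycle and hence a coboundary. -/
theorem IsCocycle.eq_coboundary_of_constant
    {σ : CurrentAlgebra g →ₗ[ℂ] CurrentAlgebra g →ₗ[ℂ] CurrentAlgebra g} (h : IsCocycle σ)
    (h0 : ∀ (x : g) (Y : CurrentAlgebra g), σ ((1 : ℂ[T;T⁻¹]) ⊗ₜ[ℂ] x) Y = 0) :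
    ∃ ψ, σ = coboundary ψ := by
  let ι : ℂ[T;T⁻¹] → g →ₗ[ℂ] CurrentAlgebra g := fun a => TensorProduct.mk ℂ ℂ[T;T⁻¹] g a
  have hι : ∀ a b x y, ⁅ι a x, ι b y⁆ = ι (a * b) ⁅x, y⁆ := lie_tmul_tmul
  let G : ℂ[T;T⁻¹] → ℂ[T;T⁻¹] → g →ₗ[ℂ] g →ₗ[ℂ] CurrentAlgebra g := fun a b =>
    σ.compl₁₂ (ι a) (ι b)
  have hG : ∀ a b x y, G a b x y = σ (ι a x) (ι b y) := fun _ _ _ _ => rfl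
  have hskew : ∀ a b x y, G a b x y = -G b a y x := fun a b x y => h.skew _ _
  have hGeq : ∀ a b x y z, ⁅ι 1 x, G a b y z⁆ = G a b ⁅x, y⁆ z + G a b y ⁅x, z⁆ := by
    intro a b x y z
    have e := h.lie_apply_of_constant h0 x (ι a y) (ι b z)
    simp only [ι, TensorProduct.mk_apply, lie_tmul_tmul, one_mul] at e
    exact e
  have hcoeff : ∀ (H : g →ₗ[ℂ] g →ₗ[ℂ] CurrentAlgebra g),
      (∀ x y z, ⁅ι 1 x, H y z⁆ = H ⁅x, y⁆ z + H y ⁅x, z⁆) →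
      ∀ m, IsEquivariant (H.compr₂ (coeff g m)) := by
    intro H hH m x y z
    have e := congrArg (coeff g m) (hH x y z)
    rw [map_add] at e
    simp only [ι, TensorProduct.mk_apply, coeff_lie] at e
    exact e
  -- the symmetric part of the slices, multiplied by two
  let S : ℂ[T;T⁻¹] → ℂ[T;T⁻¹] → g →ₗ[ℂ] g →ₗ[ℂ] CurrentAlgebra g := fun a b =>
    G a b + (G a b).flip
  have hS : ∀ a b x y, S a b x y = G a b x y + G a b y x := fun _ _ _ _ => rfl
  have hSsymm : ∀ a b x y, S a b x y = S a b y x := fun a b x y => by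
    rw [hS, hS, add_comm]
  have hSskew : ∀ a b x y, S a b x y = -S b a x y := fun a b x y => by
    rw [hS, hS, hskew a b x y, hskew a b y x]; abel
  have hSeq : ∀ a b x y z, ⁅ι 1 x, S a b y z⁆ = S a b ⁅x, y⁆ z + S a b y ⁅x, z⁆ := by
    intro a b x y z
    rw [hS, hS, hS, lie_add, hGeq, hGeq]
    abel
  -- the alternating part is a multiple of the bracket, by a Laurent polynomial
  obtain ⟨h', e', f', t⟩ := exists_isSl2Triple g
  obtain ⟨ξ, hξ⟩ := Module.Projective.exists_dual_eq_one ℂ t.e_ne_zero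
  let ρ : CurrentAlgebra g →ₗ[ℂ] ℂ[T;T⁻¹] := contractRight ξ
  have hρ : ∀ (X : CurrentAlgebra g) m, (ρ X).coeff m = ξ (coeff g m X) := coeff_contractRight ξ
  let μ : ℂ[T;T⁻¹] →ₗ[ℂ] ℂ[T;T⁻¹] →ₗ[ℂ] ℂ[T;T⁻¹] := (2⁻¹ : ℂ) •
    ((σ.compl₁₂ ((TensorProduct.mk ℂ ℂ[T;T⁻¹] g).flip h')
        ((TensorProduct.mk ℂ ℂ[T;T⁻¹] g).flip e')).compr₂ ρ -
      (σ.compl₁₂ ((TensorProduct.mk ℂ ℂ[T;T⁻¹] g).flip e')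
        ((TensorProduct.mk ℂ ℂ[T;T⁻¹] g).flip h')).compr₂ ρ)
  have hμ : ∀ a b, μ a b = (2⁻¹ : ℂ) • (ρ (G a b h' e') - ρ (G a b e' h')) := fun _ _ => rfl
  have hA : ∀ a b x y, G a b x y - G a b y x = ι (μ a b) ⁅x, y⁆ := by
    intro a b x y
    refine current_ext fun m => ?_
    have hE := hcoeff (G a b) (hGeq a b) m
    obtain ⟨k, hk⟩ := (hE.sub hE.flip).exists_eq_smul_of_alternating (fun x => by simp)
    simp only [LinearMap.sub_apply, LinearMap.flip_apply, LinearMap.compr₂_apply] at hk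
    rw [map_sub, hk]
    have : (μ a b).coeff m = k := by
      rw [hμ]
      have e1 := hk h' e'
      rw [t.lie_h_e_nsmul] at e1
      have e2 := congrArg ξ e1
      simp only [map_sub, map_smul, map_nsmul, hξ] at e2
      simp [hρ]
      simp at e2
      linear_combination (1/2 : ℂ) * e2
    rw [TensorProduct.mk_apply, coeff_tmul, this]
  have hμsymm : ∀ a b, μ b a = μ a b := fun a b => by
    rw [hμ, hμ, hskew b a, hskew b a, map_neg, map_neg]
    module
  have hμ1 : ∀ a, μ a 1 = 0 := fun a => by
    have e : ∀ x y, G 1 a x y = 0 := fun x y => h0 x _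
    rw [hμsymm, hμ, e, e, sub_self, smul_zero]
  have h2 : ∀ a b x y, (2 : ℂ) • G a b x y = S a b x y + ι (μ a b) ⁅x, y⁆ := by
    intro a b x y
    rw [hS, ← hA]
    module
  have hsmul : ∀ a x X, ⁅ι a x, X⁆ = a • ⁅ι 1 x, X⁆ := lie_tmul_eq_smul
  have hlie : ∀ (a : ℂ[T;T⁻¹]) (X Y : CurrentAlgebra g), ⁅X, a • Y⁆ = a • ⁅X, Y⁆ :=
    fun a X Y => lie_smul a X Y
  -- the cocycle identity in terms of the symmetric and alternating parts
  let M : ℂ[T;T⁻¹] → CurrentAlgebra g →ₗ[ℂ] CurrentAlgebra g := fun a =>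
    Algebra.lsmul ℂ ℂ (CurrentAlgebra g) a
  let D : ℂ[T;T⁻¹] → ℂ[T;T⁻¹] → ℂ[T;T⁻¹] → g →ₗ[ℂ] g →ₗ[ℂ] CurrentAlgebra g := fun a b c =>
    S a (b * c) + (S c a).compr₂ (M b) + (S a b).compr₂ (M (-c))
  have hD : ∀ a b c x y, D a b c x y = S a (b * c) x y + b • S c a x y - c • S a b x y := by
    intro a b c x y
    have e : D a b c x y = S a (b * c) x y + b • S c a x y + (-c) • S a b x y := rfl
    rw [e]
    module
  have hDeq : ∀ a b c m, IsEquivariant ((D a b c).compr₂ (coeff g m)) := fun a b c =>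
    hcoeff _ fun x y z => by
      rw [hD, hD, hD, lie_sub, lie_add, hlie, hlie, hSeq, hSeq, hSeq]
      module
  have hDsymm : ∀ a b c x y, D a b c x y = D a b c y x := fun a b c x y => by
    rw [hD, hD, hSsymm a _ x, hSsymm c _ x, hSsymm a _ x]
  have hterm : ∀ a b c x y z, (2 : ℂ) • (⁅ι a x, G b c y z⁆ + G a (b * c) x ⁅y, z⁆) =
      a • S b c ⁅x, y⁆ z - a • S b c y ⁅z, x⁆ + S a (b * c) x ⁅y, z⁆ +
        ι (a * μ b c + μ a (b * c)) ⁅x, ⁅y, z⁆⁆ := by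
    intro a b c x y z
    rw [smul_add, h2, ← lie_smul, h2, lie_add, hι, hsmul, hSeq, ← lie_skew z x, map_neg]
    simp only [ι, TensorProduct.mk_apply, TensorProduct.add_tmul]
    module
  have hmain : ∀ a b c x y z,
      (D a b c x ⁅y, z⁆ + ι (a * μ b c + μ a (b * c)) ⁅x, ⁅y, z⁆⁆) +
      (D b c a y ⁅z, x⁆ + ι (b * μ c a + μ b (c * a)) ⁅y, ⁅z, x⁆⁆) +
      (D c a b z ⁅x, y⁆ + ι (c * μ a b + μ c (a * b)) ⁅z, ⁅x, y⁆⁆) = 0 := by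
    intro a b c x y z
    have e := h.cocycle (ι a x) (ι b y) (ι c z)
    rw [hι, hι, hι] at e
    have e3 : (2 : ℂ) • (⁅ι a x, G b c y z⁆ + G a (b * c) x ⁅y, z⁆) +
        (2 : ℂ) • (⁅ι b y, G c a z x⁆ + G b (c * a) y ⁅z, x⁆) +
        (2 : ℂ) • (⁅ι c z, G a b x y⁆ + G c (a * b) z ⁅x, y⁆) = 0 := by
      simp only [hG]
      linear_combination (norm := module) (2 : ℂ) • e
    rw [hterm, hterm, hterm] at e3
    rw [hD, hD, hD, hSsymm c a x, hSsymm a b x, hSsymm a b y, hSsymm b c y, hSsymm b c z,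
      hSsymm c a z]
    rw [← e3, hSsymm a b x, hSsymm b c y, hSsymm c a z]
    abel
  have hzero : ∀ a b c, D a b c = 0 ∧
      a * μ b c + μ a (b * c) = c * μ a b + μ c (a * b) := by
    intro a b c
    have key := fun m => eq_zero_and_eq_of_cyclic (hDeq a b c m) (hDeq b c a m) (hDeq c a b m)
      (fun x y => congrArg (coeff g m) (hDsymm a b c x y))
      (fun x y => congrArg (coeff g m) (hDsymm b c a x y))
      (fun x y => congrArg (coeff g m) (hDsymm c a b x y))
      (e₁ := (a * μ b c + μ a (b * c)).coeff m) (e₂ := (b * μ c a + μ b (c * a)).coeff m)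
      (e₃ := (c * μ a b + μ c (a * b)).coeff m) (fun x y z => by
        have e := congrArg (coeff g m) (hmain a b c x y z)
        rw [map_zero, map_add, map_add, map_add, map_add, map_add] at e
        simp only [ι, TensorProduct.mk_apply, coeff_tmul] at e
        exact e)
    constructor
    · refine LinearMap.ext₂ fun x y => current_ext fun m => ?_
      exact LinearMap.congr_fun₂ (key m).1 x y
    · ext m
      exact (key m).2.2.2.1.trans (key m).2.2.2.2
  -- the symmetric part is a biderivation, determined by its value at `(z, z)`
  have hSder : ∀ a b c x y, S a (b * c) x y = b • S a c x y + c • S a b x y := by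
    intro a b c x y
    have e := LinearMap.congr_fun₂ (hzero a b c).1 x y
    rw [hD, hSskew c a] at e
    linear_combination (norm := (simp only [LinearMap.zero_apply]; module)) e
  have hSzero : ∀ a x y, S a (LaurentPolynomial.T 1) x y = 0 → ∀ b, S a b x y = 0 := by
    intro a x y h1 b
    let d : ℂ[T;T⁻¹] →ₗ[ℂ] CurrentAlgebra g :=
      σ (ι a x) ∘ₗ (TensorProduct.mk ℂ ℂ[T;T⁻¹] g).flip y +
        σ (ι a y) ∘ₗ (TensorProduct.mk ℂ ℂ[T;T⁻¹] g).flip x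
    exact LinearMap.congr_fun (derivation_eq_zero_of_T d (fun b c => hSder a b c x y) h1) b
  have hSzero' : ∀ a b x y, S a b x y = 0 := by
    intro a b x y
    have hself : S (LaurentPolynomial.T 1) (LaurentPolynomial.T 1) x y = 0 := by
      linear_combination (norm := module) (1 / 2 : ℂ) • hSskew (LaurentPolynomial.T 1)
        (LaurentPolynomial.T 1) x y
    exact hSzero a x y (by rw [hSskew, hSzero _ x y hself, neg_zero]) b
  obtain ⟨k, hk⟩ := exists_hochschild_primitive μ hμ1 fun a b c => by
    rw [(hzero a b c).2, hμsymm c]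
  refine ⟨(2⁻¹ : ℂ) • TensorProduct.map k LinearMap.id, ?_⟩
  have hfin : ∀ a x b y, σ (a ⊗ₜ x) (b ⊗ₜ y) =
      coboundary ((2⁻¹ : ℂ) • TensorProduct.map k LinearMap.id) (a ⊗ₜ x) (b ⊗ₜ y) := by
    intro a x b y
    have e := h2 a b x y
    rw [hSzero', zero_add, hk] at e
    simp only [ι, hG, TensorProduct.mk_apply] at e
    rw [coboundary_apply, LinearMap.smul_apply, LinearMap.smul_apply, LinearMap.smul_apply,
      lie_tmul_tmul, TensorProduct.map_tmul, TensorProduct.map_tmul, TensorProduct.map_tmul,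
      lie_smul, lie_smul, lie_tmul_tmul, lie_tmul_tmul, LinearMap.id_apply, LinearMap.id_apply,
      LinearMap.id_apply, ← lie_skew y x, TensorProduct.tmul_neg]
    rw [TensorProduct.sub_tmul, TensorProduct.add_tmul] at e
    rw [← smul_sub, ← smul_sub, sub_neg_eq_add, ← e, smul_smul, inv_mul_cancel₀ two_ne_zero,
      one_smul]
  exact TensorProduct.ext' fun a x => TensorProduct.ext' fun b y => hfin a x b y

/-- The second cohomology of the current algebra with adjoint coefficients vanishes. -/
theorem IsCocycle.exists_eq_coboundary
    {σ : CurrentAlgebra g →ₗ[ℂ] CurrentAlgebra g →ₗ[ℂ] CurrentAlgebra g} (h : IsCocycle σ) :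
    ∃ ψ, σ = coboundary ψ := by
  obtain ⟨ψ₁, h₁⟩ := h.exists_eq_coboundary_on_constants
  have hs₁ := h.sub (isCocycle_coboundary ψ₁)
  obtain ⟨ψ₂, h₂⟩ := hs₁.exists_eq_coboundary_of_constant fun x y => sub_eq_zero.2 (h₁ x y)
  obtain ⟨ψ₃, h₃⟩ := (hs₁.sub (isCocycle_coboundary ψ₂)).eq_coboundary_of_constant
    fun x Y => sub_eq_zero.2 (h₂ x Y)
  refine ⟨ψ₃ + (ψ₂ + ψ₁), ?_⟩
  rw [coboundary_add, coboundary_add, ← h₃, add_comm (coboundary ψ₂), sub_sub, sub_add_cancel]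

end CurrentCohomologyVanishing

/-! ### Complete local algebras -/

section CompleteAlgebra

theorem mem_smul_top_pi {A ι : Type*} [CommRing A] [Fintype ι] {J : Ideal A} {v : ι → A} :
    v ∈ (J • ⊤ : Submodule A (ι → A)) ↔ ∀ i, v i ∈ J := by
  classical
  constructor
  · intro hv i
    have := Submodule.smul_top_le_comap_smul_top J (LinearMap.proj i : (ι → A) →ₗ[A] A) hv
    simpa using this
  · intro hv
    rw [← Finset.univ_sum_single v]
    refine Submodule.sum_mem _ fun i _ => ?_
    have : Pi.single i (v i) = v i • (Pi.single i 1 : ι → A) := by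
      rw [← Pi.single_smul, smul_eq_mul, mul_one]
    rw [this]
    exact Submodule.smul_mem_smul (hv i) trivial

instance isPrecomplete_pi {A ι : Type*} [CommRing A] [Fintype ι] (I : Ideal A)
    [IsPrecomplete I A] : IsPrecomplete I (ι → A) where
  prec' f hf := by
    have h : ∀ i, ∃ L : A, ∀ n, f n i ≡ L [SMOD (I ^ n • ⊤ : Submodule A A)] := fun i =>
      IsPrecomplete.prec' (fun n => f n i) fun {m n} hmn => by
        have := hf hmn
        rw [SModEq.sub_mem, mem_smul_top_pi] at this
        rw [SModEq.sub_mem]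
        simpa using this i
    choose L hL using h
    refine ⟨L, fun n => ?_⟩
    rw [SModEq.sub_mem, mem_smul_top_pi]
    intro i
    have := hL i n
    rw [SModEq.sub_mem] at this
    simpa using this

theorem coe_mem_of_mem_smul_top {A : Type*} [CommRing A] {I J : Ideal A} {x : I}
    (hx : x ∈ (J • ⊤ : Submodule A I)) : (x : A) ∈ J * I := by
  have := Submodule.mem_map_of_mem (f := I.subtype) hx
  rwa [Submodule.map_smul'', Submodule.map_top, Submodule.range_subtype, smul_eq_mul] at this

theorem isHausdorff_ideal {A : Type*} [CommRing A] (I J : Ideal A) [IsHausdorff I A] :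
    IsHausdorff I J where
  haus' x hx := by
    refine Subtype.ext (IsHausdorff.haus (I := I) inferInstance (x : A) fun n => ?_)
    have := hx n
    rw [SModEq.zero] at this ⊢
    rw [smul_eq_mul, Ideal.mul_top]
    exact (Ideal.mul_le_inf (coe_mem_of_mem_smul_top this)).1

/-- In a complete algebra an ideal that is finitely generated modulo its square is finitely
generated. -/
theorem fg_of_fg_modulo_sq {A ι : Type*} [CommRing A] [Finite ι] (I : Ideal A) [IsAdicComplete I A]
    (t : ι → A) (ht : ∀ i, t i ∈ I)
    (hI : ∀ a ∈ I, ∃ c : ι → A, ∀ s : Finset ι, (∀ i, i ∈ s) → a - ∑ i ∈ s, c i * t i ∈ I * I) :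
    I.FG := by
  classical
  have := Fintype.ofFinite ι
  have := isHausdorff_ideal I I
  let f : (ι → A) →ₗ[A] I := Fintype.linearCombination A fun i => ⟨t i, ht i⟩
  have hf : ∀ c, (f c : A) = ∑ i, c i * t i := fun c => by
    simp [f, Fintype.linearCombination_apply]
  have hsurj : Function.Surjective f := by
    refine surjective_of_mkQ_comp_surjective (I := I) fun y => ?_
    obtain ⟨y, rfl⟩ := Submodule.mkQ_surjective _ y
    obtain ⟨c, hc⟩ := hI y y.2
    refine ⟨c, ?_⟩
    rw [LinearMap.comp_apply, Submodule.mkQ_apply, Submodule.mkQ_apply, eq_comm,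
      Submodule.Quotient.eq]
    have h := hc Finset.univ (fun i => Finset.mem_univ i)
    rw [← hf] at h
    have h' : I.subtype (y - f c) ∈ Submodule.map I.subtype (I • ⊤ : Submodule A I) := by
      rw [Submodule.map_smul'', Submodule.map_top, Submodule.range_subtype]
      exact h
    obtain ⟨z, hz, hz'⟩ := h'
    have hz'' : z = y - f c := Subtype.ext hz'
    rwa [← hz'']
  have h1 := (Module.Finite.of_surjective f hsurj).fg_top
  exact (Submodule.fg_top I).1 h1

end CompleteAlgebra

section Residue

variable {K : Type*} [Field K] {A : Type*} [CommRing A] [Algebra K A]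

/-- If `Iⁿ / Iⁿ⁺¹` is finite-dimensional, it has a basis of classes of elements `tᵢ` of `Iⁿ`, and
the coordinates extend to functionals on the whole algebra. -/
theorem exists_basis_functionals (I : Ideal A) (n : ℕ)
    (h : Module.Finite K (↥(I ^ n) ⧸ (I ^ (n + 1)).submoduleOf (I ^ n))) :
    ∃ (k : ℕ) (t : Fin k → A) (l : Fin k → A →ₗ[K] K), (∀ i, t i ∈ I ^ n) ∧
      (∀ i, ∀ a ∈ I ^ (n + 1), l i a = 0) ∧ (∀ i j, l i (t j) = if i = j then 1 else 0) ∧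
      ∀ a ∈ I ^ n, a - ∑ i, l i a • t i ∈ I ^ (n + 1) := by
  classical
  let Q := ↥(I ^ n) ⧸ (I ^ (n + 1)).submoduleOf (I ^ n)
  let b := Module.finBasis K Q
  let π : ↥(I ^ n) →ₗ[K] Q := ((I ^ (n + 1)).submoduleOf (I ^ n)).mkQ.restrictScalars K
  have hπ : ∀ a : ↥(I ^ n), π a = 0 ↔ (a : A) ∈ I ^ (n + 1) := fun a => by
    change Submodule.Quotient.mk a = 0 ↔ _
    rw [Submodule.Quotient.mk_eq_zero]
    rfl
  have hsurj : Function.Surjective π := fun q => by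
    obtain ⟨a, ha⟩ := Submodule.Quotient.mk_surjective _ q
    exact ⟨a, ha⟩
  choose t ht using fun i => hsurj (b i)
  have hl : ∀ i, ∃ l : A →ₗ[K] K, ∀ a : ↥(I ^ n), l a = b.coord i (π a) := fun i => by
    obtain ⟨l, hl⟩ := LinearMap.exists_extend (p := (I ^ n).restrictScalars K)
      (b.coord i ∘ₗ (π : (I ^ n).restrictScalars K →ₗ[K] Q))
    exact ⟨l, fun a => LinearMap.congr_fun hl (⟨a.1, a.2⟩ : (I ^ n).restrictScalars K)⟩
  choose l hl using hl
  refine ⟨_, fun i => t i, l, fun i => (t i).2, fun i a ha => ?_, fun i j => ?_, fun a ha => ?_⟩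
  · have := hl i ⟨a, Ideal.pow_le_pow_right n.le_succ ha⟩
    rw [(hπ _).2 ha, map_zero] at this
    exact this
  · rw [hl, ht, Module.Basis.coord_apply, Module.Basis.repr_self, Finsupp.single_apply]
    simp only [eq_comm]
  · have h1 : π (⟨a, ha⟩ - ∑ i, l i a • t i) = 0 := by
      rw [map_sub, map_sum]
      simp only [map_smul, ht]
      conv_lhs => rw [← b.sum_repr (π ⟨a, ha⟩)]
      rw [sub_eq_zero]
      exact Finset.sum_congr rfl fun i _ => by rw [hl i ⟨a, ha⟩]; rfl
    simpa using (hπ _).1 h1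

theorem fg_of_finite_cotangent (I : Ideal A) [IsAdicComplete I A]
    (h : Module.Finite K (↥(I ^ 1) ⧸ (I ^ (1 + 1)).submoduleOf (I ^ 1))) : I.FG := by
  obtain ⟨k, t, l, ht, -, -, hl⟩ := exists_basis_functionals I 1 h
  simp only [pow_one] at ht hl
  refine fg_of_fg_modulo_sq I t ht fun a ha => ⟨fun i => algebraMap K A (l i a), fun s hs => ?_⟩
  rw [Finset.eq_univ_of_forall hs, ← pow_two]
  simpa only [Algebra.smul_def] using hl a ha

theorem ker_eq_maximalIdeal [IsLocalRing A] (ε : A →ₐ[K] K) :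
    RingHom.ker ε = IsLocalRing.maximalIdeal A :=
  IsLocalRing.eq_maximalIdeal
    (RingHom.ker_isMaximal_of_surjective ε fun c => ⟨algebraMap K A c, by simp⟩)

end Residue

/-! ### Formal rigidity from the vanishing of the second cohomology -/

section Filtration

variable {A M : Type*} [CommRing A] [AddCommGroup M] [Module A M] {I : Ideal A}

theorem smul_mem_pow_smul {n m : ℕ} {a : A} {X : M} (ha : a ∈ I ^ n)
    (hX : X ∈ (I ^ m • ⊤ : Submodule A M)) : a • X ∈ (I ^ (n + m) • ⊤ : Submodule A M) := by
  rw [pow_add, Submodule.mul_smul]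
  exact Submodule.smul_mem_smul ha hX

theorem map_mem_smul_top {N : Type*} [AddCommGroup N] [Module A N] {J : Ideal A} (f : M →ₗ[A] N)
    {X : M} (hX : X ∈ (J • ⊤ : Submodule A M)) : f X ∈ (J • ⊤ : Submodule A N) :=
  Submodule.smul_top_le_comap_smul_top J f hX

theorem bilin_mem_pow_smul {n m : ℕ} (μ : M →ₗ[A] M →ₗ[A] M) {X Y : M}
    (hX : X ∈ (I ^ n • ⊤ : Submodule A M)) (hY : Y ∈ (I ^ m • ⊤ : Submodule A M)) :
    μ X Y ∈ (I ^ (n + m) • ⊤ : Submodule A M) := by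
  refine Submodule.smul_induction_on hX (fun a ha X' _ => ?_) fun X X' h h' => ?_
  · rw [map_smul, LinearMap.smul_apply]
    exact smul_mem_pow_smul ha (map_mem_smul_top (μ X') hY)
  · rw [map_add, LinearMap.add_apply]
    exact Submodule.add_mem _ h h'

theorem pow_succ_smul_top_le (n : ℕ) :
    (I ^ (n + 1) • ⊤ : Submodule A M) ≤ (I ^ n • ⊤ : Submodule A M) :=
  Submodule.smul_mono_left (Ideal.pow_le_pow_right n.le_succ)

end Filtration

section Formal

universe u v

variable {K : Type u} [Field K] {A : Type u} [CommRing A] [Algebra K A]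
variable {L : Type v} [LieRing L] [LieAlgebra K L] {I : Ideal A}

variable (I) in
theorem mem_pow_smul_iff_val_eq_zero (hI : I.FG) {n : ℕ} {X : AdicCompletion I (A ⊗[K] L)} :
    X ∈ (I ^ n • ⊤ : Submodule A (AdicCompletion I (A ⊗[K] L))) ↔ X.val n = 0 := by
  rw [AdicCompletion.pow_smul_top_eq_ker_eval hI]
  rfl

theorem exists_sub_of_mem (hI : I.FG) (n : ℕ) (X : AdicCompletion I (A ⊗[K] L)) :
    ∃ Y : A ⊗[K] L, X - AdicCompletion.of I (A ⊗[K] L) Y ∈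
      (I ^ n • ⊤ : Submodule A (AdicCompletion I (A ⊗[K] L))) := by
  obtain ⟨Y, hY⟩ := Submodule.mkQ_surjective _ (X.val n)
  refine ⟨Y, ?_⟩
  rw [mem_pow_smul_iff_val_eq_zero I hI, AdicCompletion.val_sub_apply, AdicCompletion.of_apply,
    hY, sub_self]

theorem eq_of_forall_sub_mem (hI : I.FG) {X Y : AdicCompletion I (A ⊗[K] L)}
    (h : ∀ n, X - Y ∈ (I ^ n • ⊤ : Submodule A (AdicCompletion I (A ⊗[K] L)))) : X = Y :=
  AdicCompletion.ext fun n => by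
    have := (mem_pow_smul_iff_val_eq_zero I hI).1 (h n)
    rwa [AdicCompletion.val_sub_apply, sub_eq_zero] at this

/-- The map `l ⊗ id : A ⊗ L → L` of a functional `l` on `A`. -/
def tensorFunctional (L : Type v) [LieRing L] [LieAlgebra K L] (l : A →ₗ[K] K) :
    A ⊗[K] L →ₗ[K] L :=
  (TensorProduct.lid K L).toLinearMap ∘ₗ TensorProduct.map l LinearMap.id

theorem tensorFunctional_tmul (l : A →ₗ[K] K) (a : A) (x : L) :
    tensorFunctional L l (a ⊗ₜ[K] x) = l a • x := by
  simp [tensorFunctional]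

theorem tensorFunctional_eq_zero {l : A →ₗ[K] K} {J : Ideal A} (hl : ∀ a ∈ J, l a = 0) :
    ((J • ⊤ : Submodule A (A ⊗[K] L)).restrictScalars K) ≤
      LinearMap.ker (tensorFunctional L l) := by
  intro X hX
  rw [Submodule.restrictScalars_mem] at hX
  rw [LinearMap.mem_ker]
  refine Submodule.smul_induction_on hX ?_ ?_
  · intro a ha Y _
    induction Y using TensorProduct.induction_on with
    | zero => simp
    | tmul b x =>
      rw [TensorProduct.smul_tmul', tensorFunctional_tmul, smul_eq_mul,
        hl _ (J.mul_mem_right b ha), zero_smul]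
    | add X Y hX hY => rw [smul_add, map_add, hX trivial, hY trivial, add_zero]
  · intro X Y hX hY
    rw [map_add, hX, hY, add_zero]

/-- The extension of `l ⊗ id` to the completion, for a functional `l` that vanishes on `Iⁿ`. -/
def completedFunctional (L : Type v) [LieRing L] [LieAlgebra K L] (l : A →ₗ[K] K) (n : ℕ)
    (hl : ∀ a ∈ I ^ n, l a = 0) : AdicCompletion I (A ⊗[K] L) →ₗ[K] L :=
  (Submodule.liftQ _ (tensorFunctional L l) (tensorFunctional_eq_zero hl)) ∘ₗ
    (Submodule.Quotient.restrictScalarsEquiv K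
      (I ^ n • ⊤ : Submodule A (A ⊗[K] L))).symm.toLinearMap ∘ₗ
    (AdicCompletion.eval I (A ⊗[K] L) n).restrictScalars K

theorem completedFunctional_of (l : A →ₗ[K] K) (n : ℕ) (hl : ∀ a ∈ I ^ n, l a = 0)
    (X : A ⊗[K] L) :
    completedFunctional L l n hl (AdicCompletion.of I (A ⊗[K] L) X) = tensorFunctional L l X :=
  rfl

theorem completedFunctional_eq_zero (hI : I.FG) (l : A →ₗ[K] K) (n : ℕ)
    (hl : ∀ a ∈ I ^ n, l a = 0) {X : AdicCompletion I (A ⊗[K] L)}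
    (hX : X ∈ (I ^ n • ⊤ : Submodule A (AdicCompletion I (A ⊗[K] L)))) :
    completedFunctional L l n hl X = 0 := by
  have h := (mem_pow_smul_iff_val_eq_zero I hI).1 hX
  rw [completedFunctional, LinearMap.comp_apply, LinearMap.comp_apply,
    LinearMap.restrictScalars_apply, AdicCompletion.eval_apply, h, map_zero, map_zero]

variable (I L) in
/-- The map `x ↦ 1 ⊗ x` from `L` to the completed tensor product. -/
def constant : L →ₗ[K] AdicCompletion I (A ⊗[K] L) :=
  (AdicCompletion.of I (A ⊗[K] L)).restrictScalars K ∘ₗ TensorProduct.mk K A L 1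

theorem constant_apply (x : L) :
    constant L I x = AdicCompletion.of I (A ⊗[K] L) ((1 : A) ⊗ₜ[K] x) := rfl

/-- The graded pieces of the completed tensor product are `Iⁿ / Iⁿ⁺¹ ⊗ L`: modulo `Iⁿ⁺¹`, an element
of the `n`-th step of the filtration has coordinates in `L` with respect to a basis `t` of
`Iⁿ / Iⁿ⁺¹`. -/
theorem exists_leading_coefficients (hI : I.FG) (n : ℕ)
    (h : Module.Finite K (↥(I ^ n) ⧸ (I ^ (n + 1)).submoduleOf (I ^ n))) :
    ∃ (k : ℕ) (t : Fin k → A) (C : Fin k → AdicCompletion I (A ⊗[K] L) →ₗ[K] L),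
      (∀ i, t i ∈ I ^ n) ∧
      (∀ i, ∀ X ∈ (I ^ (n + 1) • ⊤ : Submodule A (AdicCompletion I (A ⊗[K] L))), C i X = 0) ∧
      (∀ i j x, C i (t j • constant L I x) = if i = j then x else 0) ∧
      ∀ X ∈ (I ^ n • ⊤ : Submodule A (AdicCompletion I (A ⊗[K] L))),
        X - ∑ i, t i • constant L I (C i X) ∈
          (I ^ (n + 1) • ⊤ : Submodule A (AdicCompletion I (A ⊗[K] L))) := by
  obtain ⟨k, t, l, ht, hl0, hlt, hl⟩ := exists_basis_functionals I n h
  refine ⟨k, t, fun i => completedFunctional L (l i) (n + 1) (hl0 i), ht,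
    fun i X hX => completedFunctional_eq_zero hI _ _ _ hX, fun i j x => ?_, ?_⟩
  · rw [constant_apply, ← map_smul, completedFunctional_of, TensorProduct.smul_tmul',
      tensorFunctional_tmul, smul_eq_mul, mul_one, hlt, ite_smul, one_smul, zero_smul]
  have hadd : ∀ X Y : AdicCompletion I (A ⊗[K] L),
      X - ∑ i, t i • constant L I (completedFunctional L (l i) (n + 1) (hl0 i) X) ∈
        (I ^ (n + 1) • ⊤ : Submodule A (AdicCompletion I (A ⊗[K] L))) →
      Y - ∑ i, t i • constant L I (completedFunctional L (l i) (n + 1) (hl0 i) Y) ∈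
        (I ^ (n + 1) • ⊤ : Submodule A (AdicCompletion I (A ⊗[K] L))) →
      X + Y - ∑ i, t i • constant L I (completedFunctional L (l i) (n + 1) (hl0 i) (X + Y)) ∈
        (I ^ (n + 1) • ⊤ : Submodule A (AdicCompletion I (A ⊗[K] L))) := by
    intro X Y hX hY
    have := Submodule.add_mem _ hX hY
    simp only [map_add, smul_add, Finset.sum_add_distrib]
    convert this using 1
    abel
  intro X hX
  refine Submodule.smul_induction_on (p := fun X =>
    X - ∑ i, t i • constant L I (completedFunctional L (l i) (n + 1) (hl0 i) X) ∈
        (I ^ (n + 1) • ⊤ : Submodule A (AdicCompletion I (A ⊗[K] L)))) hX ?_ hadd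
  intro a ha Y _
  obtain ⟨Z, hZ⟩ := exists_sub_of_mem hI 1 Y
  have hsmall := smul_mem_pow_smul ha hZ
  have e : a • Y = a • (Y - AdicCompletion.of I (A ⊗[K] L) Z) +
      AdicCompletion.of I (A ⊗[K] L) (a • Z) := by
    rw [smul_sub, map_smul]; abel
  rw [e]
  refine hadd _ _ ?_ ?_
  · refine Submodule.sub_mem _ hsmall (Submodule.sum_mem _ fun i _ => ?_)
    rw [completedFunctional_eq_zero hI _ _ _ hsmall, map_zero, smul_zero]
    exact Submodule.zero_mem _
  clear hsmall e hZ
  induction Z using TensorProduct.induction_on with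
  | zero => simp
  | tmul b x =>
    have hab := hl (a * b) (Ideal.mul_mem_right b _ ha)
    have e2 : AdicCompletion.of I (A ⊗[K] L) (a • b ⊗ₜ[K] x) -
        ∑ i, t i • constant L I (completedFunctional L (l i) (n + 1) (hl0 i)
          (AdicCompletion.of I (A ⊗[K] L) (a • b ⊗ₜ[K] x))) =
        (a * b - ∑ i, l i (a * b) • t i) • constant L I x := by
      simp only [completedFunctional_of, TensorProduct.smul_tmul', tensorFunctional_tmul,
        smul_eq_mul, constant_apply, ← map_smul]
      rw [← map_sum, ← map_sub]
      congr 1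
      rw [mul_one, TensorProduct.sub_tmul, TensorProduct.sum_tmul]
      simp only [TensorProduct.tmul_smul, TensorProduct.smul_tmul', mul_one]
    rw [e2]
    exact Submodule.smul_mem_smul hab trivial
  | add Z Z' hZ hZ' =>
    rw [smul_add, map_add]
    exact hadd _ _ hZ hZ'

end Formal

section FormalRigidity

universe u v

variable {K : Type u} [Field K] {A : Type u} [CommRing A] [Algebra K A]
variable {L : Type v} [LieRing L] [LieAlgebra K L]

theorem completedAugmentation_constant (ε : A →ₐ[K] K) (x : L) :
    completedAugmentation L ε (constant L (RingHom.ker ε) x) = x := by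
  rw [constant_apply, completedAugmentation_of, augmentation_tmul, map_one, one_smul]

theorem completedAugmentation_eq_zero_iff {ε : A →ₐ[K] K} (hI : (RingHom.ker ε).FG)
    {X : CompletedTensor L ε} :
    completedAugmentation L ε X = 0 ↔
      X ∈ (RingHom.ker ε ^ 1 • ⊤ : Submodule A (CompletedTensor L ε)) := by
  have h0 : ∀ X ∈ (RingHom.ker ε ^ 1 • ⊤ : Submodule A (CompletedTensor L ε)),
      completedAugmentation L ε X = 0 := by
    intro X hX
    have h := (mem_pow_smul_iff_val_eq_zero _ hI).1 hX
    rw [completedAugmentation, LinearMap.comp_apply, LinearMap.comp_apply,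
      LinearMap.restrictScalars_apply, AdicCompletion.eval_apply, h, map_zero, map_zero]
  refine ⟨fun hX => ?_, h0 X⟩
  obtain ⟨Y, hY⟩ := exists_sub_of_mem hI 1 X
  have h1 := h0 _ hY
  rw [map_sub, hX, zero_sub, neg_eq_zero, completedAugmentation_of] at h1
  have h2 : ∀ Y : A ⊗[K] L, AdicCompletion.of (RingHom.ker ε) (A ⊗[K] L) Y -
      constant L (RingHom.ker ε) (augmentation L ε Y) ∈
        (RingHom.ker ε ^ 1 • ⊤ : Submodule A (CompletedTensor L ε)) := by
    intro Y
    induction Y using TensorProduct.induction_on with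
    | zero => simp
    | tmul a x =>
      have : AdicCompletion.of (RingHom.ker ε) (A ⊗[K] L) (a ⊗ₜ[K] x) -
          constant L (RingHom.ker ε) (augmentation L ε (a ⊗ₜ[K] x)) =
          (a - algebraMap K A (ε a)) • constant L (RingHom.ker ε) x := by
        rw [augmentation_tmul, map_smul, sub_smul, algebraMap_smul]
        congr 1
        rw [constant_apply, ← map_smul, TensorProduct.smul_tmul', smul_eq_mul, mul_one]
      rw [this, pow_one]
      exact Submodule.smul_mem_smul (by simp [RingHom.mem_ker]) trivial
    | add Y Z hY hZ =>
      have := Submodule.add_mem _ hY hZ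
      rw [map_add, map_add, map_add]
      convert this using 1
      abel
  have h3 := Submodule.add_mem _ hY (h2 Y)
  rw [h1, map_zero, sub_zero, sub_add_cancel] at h3
  exact h3

/-- A bracket-preserving map `L → A ⊗ L` modulo `Iⁿ` is corrected to one modulo `Iⁿ⁺¹`: the
coordinates of the error in `Iⁿ / Iⁿ⁺¹ ⊗ L` are cocycles, hence coboundaries. -/
theorem exists_lift_modulo_pow_succ
    (h2 : ∀ σ : L →ₗ[K] L →ₗ[K] L, IsCocycle σ → ∃ ψ, σ = coboundary ψ)
    {ε : A →ₐ[K] K} (hI : (RingHom.ker ε).FG) {n : ℕ} (hn : 1 ≤ n)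
    (hfin : Module.Finite K (↥(RingHom.ker ε ^ n) ⧸
      (RingHom.ker ε ^ (n + 1)).submoduleOf (RingHom.ker ε ^ n)))
    {μ : CompletedTensor L ε →ₗ[A] CompletedTensor L ε →ₗ[A] CompletedTensor L ε}
    (hμ : IsDeformation (completedAugmentation L ε) μ) (φ : L →ₗ[K] CompletedTensor L ε)
    (hp : ∀ x, completedAugmentation L ε (φ x) = x)
    (hφ : ∀ x y, μ (φ x) (φ y) - φ ⁅x, y⁆ ∈
      (RingHom.ker ε ^ n • ⊤ : Submodule A (CompletedTensor L ε))) :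
    ∃ φ' : L →ₗ[K] CompletedTensor L ε,
      (∀ x, φ' x - φ x ∈ (RingHom.ker ε ^ n • ⊤ : Submodule A (CompletedTensor L ε))) ∧
      ∀ x y, μ (φ' x) (φ' y) - φ' ⁅x, y⁆ ∈
        (RingHom.ker ε ^ (n + 1) • ⊤ : Submodule A (CompletedTensor L ε)) := by
  obtain ⟨k, t, C, ht, hC0, hCt, hC⟩ := exists_leading_coefficients (L := L) hI n hfin
  set F : ℕ → Submodule A (CompletedTensor L ε) := fun n => RingHom.ker ε ^ n • ⊤ with hF
  have hskew : ∀ X Y, μ X Y = -μ Y X := skew_of_alternating hμ.alternating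
  -- the bracket with `φ x` acts on coordinates as the bracket with `x`
  have hCμ : ∀ i x, ∀ Z ∈ F n, C i (μ (φ x) Z) = ⁅x, C i Z⁆ := by
    intro i x Z hZ
    have h1 : μ (φ x) (Z - ∑ j, t j • constant L (RingHom.ker ε) (C j Z)) ∈ F (n + 1) :=
      map_mem_smul_top _ (hC Z hZ)
    have h1' := hC0 i _ h1
    rw [map_sub, map_sub, sub_eq_zero] at h1'
    have h3 : ∀ j, C i (t j • μ (φ x) (constant L (RingHom.ker ε) (C j Z))) =
        if i = j then ⁅x, C j Z⁆ else 0 := by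
      intro j
      rw [← hCt i j, ← sub_eq_zero, ← map_sub, ← smul_sub]
      refine hC0 i _ (smul_mem_pow_smul (ht j) ((completedAugmentation_eq_zero_iff hI).1 ?_))
      rw [map_sub, hμ.map_bracket, hp, completedAugmentation_constant,
        completedAugmentation_constant, sub_self]
    rw [h1', map_sum, map_sum]
    simp only [map_smul, h3]
    simp
  -- the error of `φ`
  let E : L →ₗ[K] L →ₗ[K] CompletedTensor L ε := LinearMap.mk₂ K
    (fun x y => μ (φ x) (φ y) - φ ⁅x, y⁆)
    (fun x x' y => by simp only [map_add, LinearMap.add_apply, add_lie]; abel)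
    (fun c x y => by
      rw [map_smul φ, smul_lie, map_smul φ, ← algebraMap_smul A c (φ x), map_smul,
        LinearMap.smul_apply, algebraMap_smul, smul_sub])
    (fun x y y' => by simp only [map_add, lie_add]; abel)
    (fun c x y => by
      rw [map_smul φ, lie_smul, map_smul φ, ← algebraMap_smul A c (φ y), map_smul,
        algebraMap_smul, smul_sub])
  have hE : ∀ x y, E x y = μ (φ x) (φ y) - φ ⁅x, y⁆ := fun _ _ => rfl
  have hEn : ∀ x y, E x y ∈ F n := hφ
  have hcocycle : ∀ i, IsCocycle (E.compr₂ (C i)) := fun i => by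
    refine ⟨fun x => ?_, fun x y z => ?_⟩
    · rw [LinearMap.compr₂_apply, hE, hμ.alternating, lie_self, map_zero, sub_zero, map_zero]
    · simp only [LinearMap.compr₂_apply]
      rw [← hCμ i x _ (hEn y z), ← hCμ i y _ (hEn z x), ← hCμ i z _ (hEn x y), ← map_add,
        ← map_add, ← map_add, ← map_add, ← map_add]
      have hj := congrArg φ (lie_jacobi x y z)
      rw [map_add, map_add, map_zero] at hj
      have e : μ (φ x) (E y z) + μ (φ y) (E z x) + μ (φ z) (E x y) +
          (E x ⁅y, z⁆ + E y ⁅z, x⁆ + E z ⁅x, y⁆) =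
          μ (φ x) (μ (φ y) (φ z)) + μ (φ y) (μ (φ z) (φ x)) + μ (φ z) (μ (φ x) (φ y)) -
            (φ ⁅x, ⁅y, z⁆⁆ + φ ⁅y, ⁅z, x⁆⁆ + φ ⁅z, ⁅x, y⁆⁆) := by
        simp only [hE, map_sub]
        abel
      rw [e, hμ.jacobi, hj, sub_zero, map_zero]
  choose ψ hψ using fun i => h2 _ (hcocycle i)
  let δ : L →ₗ[K] CompletedTensor L ε := ∑ j,
    (LinearMap.lsmul A (CompletedTensor L ε) (t j)).restrictScalars K ∘ₗ
      constant L (RingHom.ker ε) ∘ₗ ψ j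
  have hδ : ∀ x, δ x = ∑ j, t j • constant L (RingHom.ker ε) (ψ j x) := fun x => by
    simp only [δ, LinearMap.sum_apply]
    rfl
  have hδn : ∀ x, δ x ∈ F n := fun x => by
    rw [hδ]
    exact Submodule.sum_mem _ fun j _ => Submodule.smul_mem_smul (ht j) trivial
  have hCδ : ∀ i x, C i (δ x) = ψ i x := fun i x => by
    rw [hδ, map_sum]
    simp only [hCt]
    simp
  refine ⟨φ - δ, fun x => ?_, fun x y => ?_⟩
  · rw [LinearMap.sub_apply, sub_sub_cancel_left]
    exact Submodule.neg_mem _ (hδn x)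
  have e : μ ((φ - δ) x) ((φ - δ) y) - (φ - δ) ⁅x, y⁆ =
      E x y - μ (φ x) (δ y) + μ (φ y) (δ x) + μ (δ x) (δ y) + δ ⁅x, y⁆ := by
    simp only [LinearMap.sub_apply, map_sub, hE]
    rw [hskew (φ y) (δ x)]
    abel
  have hδδ : μ (δ x) (δ y) ∈ F (n + 1) :=
    Submodule.smul_mono_left (Ideal.pow_le_pow_right (Nat.add_le_add_left hn n))
      (bilin_mem_pow_smul μ (hδn x) (hδn y))
  have hmem : E x y - μ (φ x) (δ y) + μ (φ y) (δ x) + μ (δ x) (δ y) + δ ⁅x, y⁆ ∈ F n :=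
    Submodule.add_mem _ (Submodule.add_mem _ (Submodule.add_mem _ (Submodule.sub_mem _ (hEn x y)
      (map_mem_smul_top _ (hδn y))) (map_mem_smul_top _ (hδn x)))
        (pow_succ_smul_top_le n hδδ)) (hδn _)
  have hfinal := hC _ hmem
  have hzero : ∀ i, C i (E x y - μ (φ x) (δ y) + μ (φ y) (δ x) + μ (δ x) (δ y) + δ ⁅x, y⁆) =
      0 := by
    intro i
    have e1 := LinearMap.congr_fun₂ (hψ i) x y
    rw [LinearMap.compr₂_apply, coboundary_apply] at e1
    rw [map_add, map_add, map_add, map_sub, hCμ i x _ (hδn y), hCμ i y _ (hδn x), hCδ, hCδ, hCδ,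
      hC0 i _ hδδ, e1]
    abel
  simp only [hzero, map_zero, smul_zero, Finset.sum_const_zero, sub_zero] at hfinal
  rw [e]
  exact hfinal

/-- If the second cohomology of `L` with adjoint coefficients vanishes, then every formal
deformation of `L` contains a copy of `L` that lifts the special fibre. -/
theorem exists_lift_of_isDeformation
    (h2 : ∀ σ : L →ₗ[K] L →ₗ[K] L, IsCocycle σ → ∃ ψ, σ = coboundary ψ)
    {ε : A →ₐ[K] K} (hI : (RingHom.ker ε).FG)
    (hfin : ∀ n, Module.Finite K (↥(RingHom.ker ε ^ n) ⧸
      (RingHom.ker ε ^ (n + 1)).submoduleOf (RingHom.ker ε ^ n)))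
    {μ : CompletedTensor L ε →ₗ[A] CompletedTensor L ε →ₗ[A] CompletedTensor L ε}
    (hμ : IsDeformation (completedAugmentation L ε) μ) :
    ∃ φ : L →ₗ[K] CompletedTensor L ε, (∀ x, completedAugmentation L ε (φ x) = x) ∧
      ∀ x y, μ (φ x) (φ y) = φ ⁅x, y⁆ := by
  set F : ℕ → Submodule A (CompletedTensor L ε) := fun n => RingHom.ker ε ^ n • ⊤ with hF
  have hF1 : ∀ n, F (n + 1) ≤ F 1 := fun n =>
    Submodule.smul_mono_left (Ideal.pow_le_pow_right (by omega))
  let good : ℕ → (L →ₗ[K] CompletedTensor L ε) → Prop := fun n φ =>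
    (∀ x, completedAugmentation L ε (φ x) = x) ∧ ∀ x y, μ (φ x) (φ y) - φ ⁅x, y⁆ ∈ F (n + 1)
  have hstep : ∀ n φ, good n φ → ∃ φ', (∀ x, φ' x - φ x ∈ F (n + 1)) ∧ good (n + 1) φ' := by
    intro n φ h
    obtain ⟨φ', h1, h2⟩ := exists_lift_modulo_pow_succ h2 hI (Nat.le_add_left 1 n)
      (hfin (n + 1)) hμ φ h.1 h.2
    refine ⟨φ', h1, fun x => ?_, h2⟩
    have := (completedAugmentation_eq_zero_iff hI).2 (hF1 n (h1 x))
    rw [map_sub, h.1, sub_eq_zero] at this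
    exact this
  choose next hnext hgood using hstep
  have h0 : good 0 (constant L (RingHom.ker ε)) := by
    refine ⟨completedAugmentation_constant ε, fun x y => ?_⟩
    refine (completedAugmentation_eq_zero_iff hI).1 ?_
    rw [map_sub, hμ.map_bracket, completedAugmentation_constant, completedAugmentation_constant,
      completedAugmentation_constant, sub_self]
  let s : (n : ℕ) → {φ // good n φ} := fun n =>
    Nat.rec ⟨_, h0⟩ (fun n φ => ⟨next n φ.1 φ.2, hgood n φ.1 φ.2⟩) n
  have hs : ∀ n x, (s (n + 1)).1 x - (s n).1 x ∈ F (n + 1) := fun n x =>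
    hnext n (s n).1 (s n).2 x
  have hval : ∀ n k x, ((s (n + k)).1 x).val n = ((s n).1 x).val n := by
    intro n k x
    induction k with
    | zero => rfl
    | succ k ih =>
      have h : (s (n + k + 1)).1 x - (s (n + k)).1 x ∈ F n :=
        Submodule.smul_mono_left (Ideal.pow_le_pow_right (by omega)) (hs (n + k) x)
      have h' := (mem_pow_smul_iff_val_eq_zero _ hI).1 h
      rw [AdicCompletion.val_sub_apply, sub_eq_zero] at h'
      rw [← ih, ← h']
      rfl
  -- the limit of the corrections
  let φ : L →ₗ[K] CompletedTensor L ε :=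
    { toFun := fun x => ⟨fun n => ((s n).1 x).val n, fun {m n} hmn => by
        obtain ⟨k, rfl⟩ := Nat.exists_eq_add_of_le hmn
        rw [((s (m + k)).1 x).property hmn]
        exact hval m k x⟩
      map_add' := fun x y => AdicCompletion.ext fun n => by
        simp only [map_add]
        rfl
      map_smul' := fun c x => AdicCompletion.ext fun n => by
        simp only [map_smul]
        rfl }
  have hφ : ∀ n x, φ x - (s n).1 x ∈ F n := fun n x => by
    refine (mem_pow_smul_iff_val_eq_zero _ hI).2 ?_
    rw [AdicCompletion.val_sub_apply, sub_eq_zero]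
    rfl
  refine ⟨φ, fun x => ?_, fun x y => eq_of_forall_sub_mem hI fun n => ?_⟩
  · have := (completedAugmentation_eq_zero_iff hI).2 (hφ 1 x)
    rwa [map_sub, (s 1).2.1, sub_eq_zero] at this
  · have e : μ (φ x) (φ y) - φ ⁅x, y⁆ = μ (φ x - (s n).1 x) (φ y) +
        μ ((s n).1 x) (φ y - (s n).1 y) + (μ ((s n).1 x) ((s n).1 y) - (s n).1 ⁅x, y⁆) -
          (φ ⁅x, y⁆ - (s n).1 ⁅x, y⁆) := by
      simp only [map_sub, LinearMap.sub_apply]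
      abel
    rw [e]
    refine Submodule.sub_mem _ (Submodule.add_mem _ (Submodule.add_mem _ ?_ ?_) ?_) (hφ n _)
    · exact map_mem_smul_top (μ.flip (φ y)) (hφ n x)
    · exact map_mem_smul_top _ (hφ n y)
    · exact pow_succ_smul_top_le n ((s n).2.2 x y)

variable {I : Ideal A}

/-- A linear endomorphism of a completed tensor product that is the identity modulo `I` is
bijective. -/
theorem bijective_of_sub_mem (hI : I.FG)
    (Φ : AdicCompletion I (A ⊗[K] L) →ₗ[A] AdicCompletion I (A ⊗[K] L))
    (hΦ : ∀ X, Φ X - X ∈ (I ^ 1 • ⊤ : Submodule A (AdicCompletion I (A ⊗[K] L)))) :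
    Function.Bijective Φ := by
  have := AdicCompletion.isAdicComplete (M := A ⊗[K] L) hI
  constructor
  · rw [← LinearMap.ker_eq_bot, LinearMap.ker_eq_bot']
    intro X hX
    have hn : ∀ n, X ∈ (I ^ n • ⊤ : Submodule A (AdicCompletion I (A ⊗[K] L))) := by
      intro n
      induction n with
      | zero => simp
      | succ n ih =>
        have h : Φ X - X ∈ (I ^ (n + 1) • ⊤ : Submodule A (AdicCompletion I (A ⊗[K] L))) := by
          refine Submodule.smul_induction_on ih (fun a ha Y _ => ?_) fun Y Z hY hZ => ?_
          · rw [map_smul, ← smul_sub]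
            exact smul_mem_pow_smul ha (hΦ Y)
          · rw [map_add, add_sub_add_comm]
            exact Submodule.add_mem _ hY hZ
        rw [hX, zero_sub] at h
        exact (Submodule.neg_mem_iff _).1 h
    exact eq_of_forall_sub_mem hI fun n => by rw [sub_zero]; exact hn n
  · refine surjective_of_mkQ_comp_surjective (I := I) fun Y => ?_
    obtain ⟨X, rfl⟩ := Submodule.mkQ_surjective _ Y
    refine ⟨X, ?_⟩
    rw [LinearMap.comp_apply, Submodule.mkQ_apply, Submodule.mkQ_apply, Submodule.Quotient.eq]
    simpa using hΦ X

/-- The `A`-linear extension to the completed tensor product of a linear map defined on `L`. -/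
theorem exists_extension (hI : I.FG) (φ : L →ₗ[K] AdicCompletion I (A ⊗[K] L)) :
    ∃ Φ : AdicCompletion I (A ⊗[K] L) →ₗ[A] AdicCompletion I (A ⊗[K] L),
      ∀ a x, Φ (AdicCompletion.of I (A ⊗[K] L) (a ⊗ₜ[K] x)) = a • φ x := by
  have := AdicCompletion.isAdicComplete (M := A ⊗[K] L) hI
  refine ⟨(AdicCompletion.ofLinearEquiv I (AdicCompletion I (A ⊗[K] L))).symm.toLinearMap ∘ₗ
    (AdicCompletion.map I (LinearMap.liftBaseChange A φ)).restrictScalars A, fun a x => ?_⟩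
  rw [LinearMap.comp_apply, LinearMap.restrictScalars_apply, AdicCompletion.map_of]
  exact (AdicCompletion.ofLinearEquiv_symm_of _ _).trans (by simp)

/-- A Lie algebra whose second cohomology with adjoint coefficients vanishes is formally rigid: the
`A`-linear extension of a lift of the special fibre is an equivalence. -/
theorem isFormallyRigid_of_cocycle
    (h2 : ∀ σ : L →ₗ[K] L →ₗ[K] L, IsCocycle σ → ∃ ψ, σ = coboundary ψ) :
    IsFormallyRigid K L := by
  intro A _ _ _ ε hA hfin μ hμ
  rw [← ker_eq_maximalIdeal ε] at hA
  have hfin' : ∀ n, Module.Finite K (↥(RingHom.ker ε ^ n) ⧸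
      (RingHom.ker ε ^ (n + 1)).submoduleOf (RingHom.ker ε ^ n)) := by
    rw [ker_eq_maximalIdeal ε]
    exact hfin
  have hI : (RingHom.ker ε).FG := fg_of_finite_cotangent _ (hfin' 1)
  obtain ⟨φ, hp, hφ⟩ := exists_lift_of_isDeformation h2 hI hfin' hμ
  obtain ⟨Φ, hΦ⟩ := exists_extension hI φ
  have hsub : ∀ X, Φ X - X ∈ (RingHom.ker ε ^ 1 • ⊤ : Submodule A (CompletedTensor L ε)) := by
    intro X
    obtain ⟨Y, hY⟩ := exists_sub_of_mem hI 1 X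
    have h : ∀ Y : A ⊗[K] L, Φ (AdicCompletion.of (RingHom.ker ε) (A ⊗[K] L) Y) -
        AdicCompletion.of (RingHom.ker ε) (A ⊗[K] L) Y ∈
          (RingHom.ker ε ^ 1 • ⊤ : Submodule A (CompletedTensor L ε)) := by
      intro Y
      induction Y using TensorProduct.induction_on with
      | zero => simp
      | tmul a x =>
        have e : AdicCompletion.of (RingHom.ker ε) (A ⊗[K] L) (a ⊗ₜ[K] x) =
            a • constant L (RingHom.ker ε) x := by
          rw [constant_apply, ← map_smul, TensorProduct.smul_tmul', smul_eq_mul, mul_one]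
        rw [hΦ, e, ← smul_sub]
        refine Submodule.smul_mem _ _ ((completedAugmentation_eq_zero_iff hI).1 ?_)
        rw [map_sub, hp, completedAugmentation_constant, sub_self]
      | add Y Z hY hZ =>
        have := Submodule.add_mem _ hY hZ
        rw [map_add, map_add]
        convert this using 1
        abel
    have e : Φ X - X = Φ (X - AdicCompletion.of (RingHom.ker ε) (A ⊗[K] L) Y) +
        (Φ (AdicCompletion.of (RingHom.ker ε) (A ⊗[K] L) Y) -
          AdicCompletion.of (RingHom.ker ε) (A ⊗[K] L) Y) -
        (X - AdicCompletion.of (RingHom.ker ε) (A ⊗[K] L) Y) := by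
      rw [map_sub]
      abel
    rw [e]
    exact Submodule.sub_mem _ (Submodule.add_mem _ (map_mem_smul_top _ hY) (h Y)) hY
  set β := completedBilin (RingHom.ker ε) (trivialBracket K A L)
  -- the difference of the two brackets vanishes on a dense submodule
  have hbr : ∀ X Y, Φ (β X Y) = μ (Φ X) (Φ Y) := by
    let D : CompletedTensor L ε →ₗ[A] CompletedTensor L ε →ₗ[A] CompletedTensor L ε :=
      β.compr₂ Φ - μ.compl₁₂ Φ Φ
    have hD : ∀ X Y : A ⊗[K] L, D (AdicCompletion.of (RingHom.ker ε) (A ⊗[K] L) X)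
        (AdicCompletion.of (RingHom.ker ε) (A ⊗[K] L) Y) = 0 := by
      intro X Y
      induction X using TensorProduct.induction_on with
      | zero => simp
      | tmul a x =>
        induction Y using TensorProduct.induction_on with
        | zero => simp
        | tmul b y =>
          simp only [D, LinearMap.sub_apply, LinearMap.compr₂_apply, LinearMap.compl₁₂_apply, β]
          rw [completedBilin_of, trivialBracket_tmul, hΦ, hΦ, hΦ, map_smul, map_smul,
            LinearMap.smul_apply, smul_smul, mul_comm b a, hφ, sub_self]
        | add Y Z hY hZ => rw [map_add, map_add, hY, hZ, add_zero]
      | add X Z hX hZ => rw [map_add, map_add, LinearMap.add_apply, hX, hZ, add_zero]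
    intro X Y
    refine eq_of_forall_sub_mem hI fun n => ?_
    obtain ⟨X', hX'⟩ := exists_sub_of_mem hI n X
    obtain ⟨Y', hY'⟩ := exists_sub_of_mem hI n Y
    have e : Φ (β X Y) - μ (Φ X) (Φ Y) =
        D (X - AdicCompletion.of (RingHom.ker ε) (A ⊗[K] L) X') Y +
        D (AdicCompletion.of (RingHom.ker ε) (A ⊗[K] L) X')
          (Y - AdicCompletion.of (RingHom.ker ε) (A ⊗[K] L) Y') := by
      rw [map_sub, map_sub, LinearMap.sub_apply, hD]
      change D X Y = _
      abel
    rw [e]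
    exact Submodule.add_mem _ (map_mem_smul_top (D.flip Y) hX') (map_mem_smul_top _ hY')
  let e := LinearEquiv.ofBijective Φ (bijective_of_sub_mem hI Φ hsub)
  have he : ∀ X, e X = Φ X := fun _ => rfl
  refine ⟨e.symm, fun X Y => ?_, fun X => ?_⟩
  · rw [LinearEquiv.symm_apply_eq, he, hbr, ← he, ← he, e.apply_symm_apply, e.apply_symm_apply]
  · have h := (completedAugmentation_eq_zero_iff hI).2 (hsub (e.symm X))
    rw [← he, e.apply_symm_apply, map_sub, sub_eq_zero] at h
    exact h.symm

end FormalRigidity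

/-! ### Units and the Euler derivation of Laurent polynomials -/

section Laurent

/-- The derivation `z d/dz` of the algebra of Laurent polynomials. -/
theorem exists_euler_derivation : ∃ δ : ℂ[T;T⁻¹] →ₗ[ℂ] ℂ[T;T⁻¹],
    (∀ n : ℤ, δ (LaurentPolynomial.T n) = (n : ℂ) • LaurentPolynomial.T n) ∧
      ∀ a b, δ (a * b) = a * δ b + b * δ a := by
  obtain ⟨δ, hδ⟩ := exists_linearMap_T
    (fun n : ℤ => (n : ℂ) • (LaurentPolynomial.T n : ℂ[T;T⁻¹]))
  refine ⟨δ, hδ, fun a b => ?_⟩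
  have key : (LinearMap.mul ℂ ℂ[T;T⁻¹]).compr₂ δ =
      (LinearMap.mul ℂ ℂ[T;T⁻¹]).compl₂ δ + ((LinearMap.mul ℂ ℂ[T;T⁻¹]).compl₂ δ).flip := by
    refine linearMap_ext_T fun m => linearMap_ext_T fun n => ?_
    simp only [LinearMap.add_apply, LinearMap.compl₂_apply, LinearMap.flip_apply,
      LinearMap.compr₂_apply, LinearMap.mul_apply']
    rw [← LaurentPolynomial.T_add, hδ, hδ, hδ, mul_smul_comm, mul_smul_comm,
      ← LaurentPolynomial.T_add, ← LaurentPolynomial.T_add, add_comm n m]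
    push_cast
    module
  simpa using LinearMap.congr_fun₂ key a b

/-- The units of the algebra of Laurent polynomials are the monomials. -/
theorem exists_eq_smul_T_of_mul_eq_one {u v : ℂ[T;T⁻¹]} (h : u * v = 1) :
    ∃ (c : ℂ) (n : ℤ), c ≠ 0 ∧ u = c • LaurentPolynomial.T n ∧
      v = c⁻¹ • LaurentPolynomial.T (-n) := by
  obtain ⟨k, f, hf⟩ := u.exists_T_pow
  obtain ⟨l, f', hf'⟩ := v.exists_T_pow
  have hff : f * f' = Polynomial.X ^ (k + l) := by
    apply Polynomial.toLaurent_injective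
    rw [map_mul, hf, hf', Polynomial.toLaurent_X_pow]
    push_cast
    rw [LaurentPolynomial.T_add]
    linear_combination (LaurentPolynomial.T k * LaurentPolynomial.T l) * h
  obtain ⟨i, -, hi⟩ := (dvd_prime_pow Polynomial.prime_X _).1 (Dvd.intro _ hff)
  obtain ⟨w, hw⟩ := hi.symm
  obtain ⟨c, hc, hcw⟩ := Polynomial.isUnit_iff.1 w.isUnit
  have hc0 : c ≠ 0 := hc.ne_zero
  have hu : u = c • LaurentPolynomial.T ((i : ℤ) - k) := by
    have h1 : u = Polynomial.toLaurent f * LaurentPolynomial.T (-k) := by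
      rw [hf, mul_assoc, ← LaurentPolynomial.T_add, add_neg_cancel, LaurentPolynomial.T_zero,
        mul_one]
    rw [h1, ← hw, ← hcw, map_mul, Polynomial.toLaurent_X_pow, Polynomial.toLaurent_C,
      LaurentPolynomial.smul_eq_C_mul, sub_eq_add_neg, LaurentPolynomial.T_add]
    ring
  refine ⟨c, i - k, hc0, hu, ?_⟩
  have h2 : u * (c⁻¹ • LaurentPolynomial.T (-((i : ℤ) - k))) = 1 := by
    rw [hu, smul_mul_smul_comm, mul_inv_cancel₀ hc0, ← LaurentPolynomial.T_add, add_neg_cancel,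
      LaurentPolynomial.T_zero, one_smul]
  calc v = v * (u * (c⁻¹ • LaurentPolynomial.T (-((i : ℤ) - k)))) := by rw [h2, mul_one]
    _ = _ := by rw [← mul_assoc, mul_comm v u, h, one_mul]

/-- For `r = ∑ sⱼ Xʲ` the recursion is the identity `r (1 + p X⁻¹ + q X⁻²) = m (X - q X⁻¹)` of
Laurent polynomials, and comparison of the terms of highest and of lowest exponent leaves only
`p = q = 0`. -/
theorem eq_zero_of_recursion {p q m : ℂ} (hm : m ≠ 0) (s : ℤ → ℂ) (S : Finset ℤ)
    (hS : ∀ j ∉ S, s j = 0)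
    (hrec : ∀ j, s j + p * s (j + 1) + q * s (j + 2) =
      (if j = 1 then m else 0) - if j = -1 then q * m else 0) : p = 0 ∧ q = 0 := by
  classical
  have hne : (S.filter fun j => s j ≠ 0).Nonempty := by
    by_contra h
    have h0 : ∀ j, s j = 0 := fun j => by
      by_contra hj
      exact h ⟨j, Finset.mem_filter.2 ⟨by_contra fun h' => hj (hS j h'), hj⟩⟩
    have := hrec 1
    simp [h0] at this
    exact hm this.symm
  have hmem : ∀ j, s j ≠ 0 → j ∈ S.filter fun j => s j ≠ 0 := fun j hj =>
    Finset.mem_filter.2 ⟨by_contra fun h' => hj (hS j h'), hj⟩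
  obtain ⟨a, ha, hamax⟩ : ∃ a, s a ≠ 0 ∧ ∀ j, a < j → s j = 0 := by
    refine ⟨(S.filter fun j => s j ≠ 0).max' hne,
      (Finset.mem_filter.1 (Finset.max'_mem _ hne)).2, fun j hj => ?_⟩
    by_contra h
    exact absurd (Finset.le_max' _ j (hmem j h)) (not_le.2 hj)
  obtain ⟨b, hb, hbmin⟩ : ∃ b, s b ≠ 0 ∧ ∀ j, j < b → s j = 0 := by
    refine ⟨(S.filter fun j => s j ≠ 0).min' hne,
      (Finset.mem_filter.1 (Finset.min'_mem _ hne)).2, fun j hj => ?_⟩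
    by_contra h
    exact absurd (Finset.min'_le _ j (hmem j h)) (not_le.2 hj)
  have hba : b ≤ a := by
    by_contra h
    exact ha (hbmin a (not_le.1 h))
  have ha1 : a ≤ 1 := by
    by_contra h
    have h1 := hrec a
    rw [hamax (a + 1) (by omega), hamax (a + 2) (by omega), if_neg (by omega),
      if_neg (by omega)] at h1
    exact ha (by linear_combination h1)
  have hq : q = 0 := by
    by_contra hq
    have h1 := hrec (b - 2)
    rw [hbmin (b - 2) (by omega), hbmin (b - 2 + 1) (by omega), sub_add_cancel,
      if_neg (by omega)] at h1
    split_ifs at h1 with hb1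
    · have hb' : b = 1 := by omega
      have ha' : a = 1 := by omega
      have h2 := hrec 1
      rw [hamax (1 + 1) (by omega), hamax (1 + 2) (by omega), if_pos rfl,
        if_neg (by omega)] at h2
      rw [hb'] at h1
      have h3 : q * m * 2 = 0 := by linear_combination h1 - q * h2
      simp [hq, hm] at h3
    · exact (mul_ne_zero hq hb) (by linear_combination h1)
  subst hq
  refine ⟨?_, rfl⟩
  by_contra hp
  have h1 := hrec (b - 1)
  rw [hbmin (b - 1) (by omega), sub_add_cancel, if_neg (by omega)] at h1
  exact (mul_ne_zero hp hb) (by simpa using h1)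

end Laurent

/-! ### The deformed algebra and its centroid -/

section DeformedAlgebra

/-- The deformed product over the complex numbers. -/
def deformedMul (p q : ℂ) : ℂ[T;T⁻¹] →ₗ[ℂ] ℂ[T;T⁻¹] →ₗ[ℂ] ℂ[T;T⁻¹] :=
  (deformedProduct p q).compr₂ (TensorProduct.lid ℂ ℂ[T;T⁻¹]).toLinearMap

theorem deformedProduct_T {A : Type} [CommRing A] [Algebra ℂ A] (p q : A) (n m : ℤ) :
    deformedProduct p q (LaurentPolynomial.T n) (LaurentPolynomial.T m) =
      structureConstants p q n m := by
  have hT : ∀ k : ℤ, (LaurentPolynomial.T k : ℂ[T;T⁻¹]) = AddMonoidAlgebra.basis ℤ ℂ k :=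
    fun k => (AddMonoidAlgebra.basis_apply ℂ k).symm
  rw [hT, hT, deformedProduct, Module.Basis.constr_basis, Module.Basis.constr_basis]

theorem deformedMul_T_of_even (p q : ℂ) {n m : ℤ} (h : Even n ∨ Even m) :
    deformedMul p q (LaurentPolynomial.T n) (LaurentPolynomial.T m) =
      LaurentPolynomial.T (n + m) := by
  rw [deformedMul, LinearMap.compr₂_apply, deformedProduct_T, structureConstants, if_pos h]
  simp

theorem deformedMul_T_of_odd (p q : ℂ) {n m : ℤ} (hn : Odd n) (hm : Odd m) :
    deformedMul p q (LaurentPolynomial.T n) (LaurentPolynomial.T m) =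
      LaurentPolynomial.T (n + m) + p • LaurentPolynomial.T (n + m - 2) +
        q • LaurentPolynomial.T (n + m - 4) := by
  rw [deformedMul, LinearMap.compr₂_apply, deformedProduct_T, structureConstants, if_neg]
  · simp
  · rw [Int.not_even_iff_odd.symm] at hn hm
    tauto

theorem deformedMul_comm (p q : ℂ) (a b : ℂ[T;T⁻¹]) :
    deformedMul p q a b = deformedMul p q b a := by
  have key : deformedMul p q = (deformedMul p q).flip := by
    refine linearMap_ext_T fun n => linearMap_ext_T fun m => ?_
    rw [LinearMap.flip_apply]
    by_cases h : Even n ∨ Even m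
    · rw [deformedMul_T_of_even p q h, deformedMul_T_of_even p q h.symm, add_comm]
    · push Not at h
      rw [Int.not_even_iff_odd, Int.not_even_iff_odd] at h
      rw [deformedMul_T_of_odd p q h.1 h.2, deformedMul_T_of_odd p q h.2 h.1, add_comm m]
  exact LinearMap.congr_fun₂ key a b

theorem deformedMul_zero_zero (a b : ℂ[T;T⁻¹]) : deformedMul 0 0 a b = a * b := by
  have key : deformedMul 0 0 = LinearMap.mul ℂ ℂ[T;T⁻¹] := by
    refine linearMap_ext_T fun n => linearMap_ext_T fun m => ?_
    rw [LinearMap.mul_apply', ← LaurentPolynomial.T_add]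
    by_cases h : Even n ∨ Even m
    · rw [deformedMul_T_of_even _ _ h]
    · push Not at h
      rw [Int.not_even_iff_odd, Int.not_even_iff_odd] at h
      rw [deformedMul_T_of_odd _ _ h.1 h.2, zero_smul, zero_smul, add_zero, add_zero]
  exact LinearMap.congr_fun₂ key a b

theorem deformedMul_one_left (p q : ℂ) (a : ℂ[T;T⁻¹]) : deformedMul p q 1 a = a := by
  have key : deformedMul p q 1 = LinearMap.id := linearMap_ext_T fun n => by
    rw [← LaurentPolynomial.T_zero, deformedMul_T_of_even p q (Or.inl Even.zero), zero_add]
    rfl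
  exact LinearMap.congr_fun key a

/-- A product of three basis elements is deformed if at least two exponents are odd. -/
theorem deformedMul_T_T_T (p q : ℂ) (n m k : ℤ) :
    deformedMul p q (LaurentPolynomial.T n)
      (deformedMul p q (LaurentPolynomial.T m) (LaurentPolynomial.T k)) =
      if (Odd n ∧ Odd m) ∨ (Odd m ∧ Odd k) ∨ (Odd k ∧ Odd n) then
        LaurentPolynomial.T (n + m + k) + p • LaurentPolynomial.T (n + m + k - 2) +
          q • LaurentPolynomial.T (n + m + k - 4)
      else LaurentPolynomial.T (n + m + k) := by
  by_cases h : Odd m ∧ Odd k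
  · have he : Even (m + k) := h.1.add_odd h.2
    rw [if_pos (by tauto), deformedMul_T_of_odd p q h.1 h.2, map_add, map_add, map_smul, map_smul,
      deformedMul_T_of_even p q (Or.inr he),
      deformedMul_T_of_even p q (Or.inr (he.sub even_two)),
      deformedMul_T_of_even p q (Or.inr (he.sub (by decide : Even (4 : ℤ)))),
      show n + (m + k) = n + m + k by ring, show n + (m + k - 2) = n + m + k - 2 by ring,
      show n + (m + k - 4) = n + m + k - 4 by ring]
  · have h' : Even m ∨ Even k := by
      rw [← Int.not_odd_iff_even, ← Int.not_odd_iff_even]; tauto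
    rw [deformedMul_T_of_even p q h']
    by_cases hn : Odd n ∧ Odd (m + k)
    · rw [if_pos, deformedMul_T_of_odd p q hn.1 hn.2, add_assoc n m k]
      have := hn.2
      rw [Int.odd_add, ← Int.not_odd_iff_even] at this
      tauto
    · have hn' : Even n ∨ Even (m + k) := by
        rw [← Int.not_odd_iff_even, ← Int.not_odd_iff_even]; tauto
      rw [if_neg, deformedMul_T_of_even p q hn', add_assoc n m k]
      rw [Int.odd_add, ← Int.not_odd_iff_even] at hn
      tauto

theorem deformedMul_assoc (p q : ℂ) (a b c : ℂ[T;T⁻¹]) :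
    deformedMul p q (deformedMul p q a b) c = deformedMul p q a (deformedMul p q b c) := by
  have key : (deformedMul p q).compr₂ (deformedMul p q) =
      (LinearMap.llcomp ℂ ℂ[T;T⁻¹] ℂ[T;T⁻¹] ℂ[T;T⁻¹] ∘ₗ deformedMul p q).compl₂
        (deformedMul p q) := by
    refine linearMap_ext_T fun n => linearMap_ext_T fun m => linearMap_ext_T fun k => ?_
    change deformedMul p q (deformedMul p q _ _) _ = deformedMul p q _ (deformedMul p q _ _)
    rw [deformedMul_comm p q (deformedMul p q _ _), deformedMul_T_T_T, deformedMul_T_T_T,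
      add_comm k n, add_right_comm n k m]
    congr 1
    rw [eq_iff_iff]
    tauto
  exact LinearMap.congr_fun (LinearMap.congr_fun₂ key a b) c

/-- The coefficients with even exponent of the product of `z` and `r`. -/
theorem coeff_deformedMul_T_one (p q : ℂ) (r : ℂ[T;T⁻¹]) (j : ℤ) :
    (deformedMul p q (LaurentPolynomial.T 1) r).coeff (2 * j) =
      r.coeff (2 * j - 1) + p * r.coeff (2 * j + 1) + q * r.coeff (2 * j + 3) := by
  let c : ℤ → ℂ[T;T⁻¹] →ₗ[ℂ] ℂ := fun m =>
    (AddMonoidAlgebra.basis ℤ ℂ).coord m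
  have hc : ∀ m a, c m a = a.coeff m := fun m a => rfl
  have key : c (2 * j) ∘ₗ deformedMul p q (LaurentPolynomial.T 1) =
      c (2 * j - 1) + p • c (2 * j + 1) + q • c (2 * j + 3) := by
    refine linearMap_ext_T fun n => ?_
    simp only [LinearMap.comp_apply, LinearMap.add_apply, LinearMap.smul_apply, hc, smul_eq_mul]
    rcases Int.even_or_odd n with hn | hn
    · rw [deformedMul_T_of_even p q (Or.inr hn)]
      simp only [LaurentPolynomial.T_apply]
      obtain ⟨i, rfl⟩ := hn
      rw [if_neg (by omega), if_neg (by omega), if_neg (by omega), if_neg (by omega)]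
      simp
    · rw [deformedMul_T_of_odd p q odd_one hn]
      simp only [AddMonoidAlgebra.coeff_add, AddMonoidAlgebra.coeff_smul, Finsupp.add_apply,
        Finsupp.smul_apply, LaurentPolynomial.T_apply, smul_eq_mul]
      have e1 : (1 + n = 2 * j) = (n = 2 * j - 1) := by rw [eq_iff_iff]; omega
      have e2 : (1 + n - 2 = 2 * j) = (n = 2 * j + 1) := by rw [eq_iff_iff]; omega
      have e3 : (1 + n - 4 = 2 * j) = (n = 2 * j + 3) := by rw [eq_iff_iff]; omega
      simp only [e1, e2, e3]
  exact LinearMap.congr_fun key r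

end DeformedAlgebra

section Centroid

variable {g : Type*} [LieRing g] [LieAlgebra ℂ g]

variable (g) in
/-- The bracket on the current algebra with the deformed product of Laurent polynomials. -/
def deformedLie (p q : ℂ) : CurrentAlgebra g →ₗ[ℂ] CurrentAlgebra g →ₗ[ℂ] CurrentAlgebra g :=
  TensorProduct.map₂ (deformedMul p q) (LieModule.toEnd ℂ g g : g →ₗ[ℂ] g →ₗ[ℂ] g)

theorem deformedLie_tmul (p q : ℂ) (a b : ℂ[T;T⁻¹]) (x y : g) :
    deformedLie g p q (a ⊗ₜ[ℂ] x) (b ⊗ₜ[ℂ] y) = deformedMul p q a b ⊗ₜ[ℂ] ⁅x, y⁆ := rfl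

variable (g) in
/-- Multiplication by `r` in the deformed algebra, on the current algebra. -/
def mulCurrent (p q : ℂ) : ℂ[T;T⁻¹] →ₗ[ℂ] CurrentAlgebra g →ₗ[ℂ] CurrentAlgebra g :=
  LinearMap.rTensorHom g ∘ₗ deformedMul p q

theorem mulCurrent_tmul (p q : ℂ) (r a : ℂ[T;T⁻¹]) (x : g) :
    mulCurrent g p q r (a ⊗ₜ[ℂ] x) = deformedMul p q r a ⊗ₜ[ℂ] x := rfl

theorem mulCurrent_mulCurrent (p q : ℂ) (r s : ℂ[T;T⁻¹]) (X : CurrentAlgebra g) :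
    mulCurrent g p q r (mulCurrent g p q s X) = mulCurrent g p q (deformedMul p q r s) X := by
  induction X using TensorProduct.induction_on with
  | zero => simp
  | tmul a x => rw [mulCurrent_tmul, mulCurrent_tmul, mulCurrent_tmul, deformedMul_assoc]
  | add X Y hX hY => rw [map_add, map_add, map_add, hX, hY]

/-- Multiplications lie in the centroid. -/
theorem mulCurrent_deformedLie (p q : ℂ) (r : ℂ[T;T⁻¹]) (X Y : CurrentAlgebra g) :
    mulCurrent g p q r (deformedLie g p q X Y) = deformedLie g p q X (mulCurrent g p q r Y) := by
  induction X using TensorProduct.induction_on with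
  | zero => simp
  | add X Z hX hZ => simp only [map_add, LinearMap.add_apply, hX, hZ]
  | tmul a x =>
    induction Y using TensorProduct.induction_on with
    | zero => simp
    | add Y Z hY hZ => simp only [map_add, hY, hZ]
    | tmul b y =>
      rw [deformedLie_tmul, mulCurrent_tmul, mulCurrent_tmul, deformedLie_tmul,
        ← deformedMul_assoc, ← deformedMul_assoc, deformedMul_comm p q r a]

theorem mulCurrent_injective [Nontrivial g] {p q : ℂ} {r s : ℂ[T;T⁻¹]}
    (h : mulCurrent g p q r = mulCurrent g p q s) : r = s := by
  obtain ⟨x, hx⟩ := exists_ne (0 : g)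
  ext m
  have e := congrArg (coeff g m) (LinearMap.congr_fun h ((1 : ℂ[T;T⁻¹]) ⊗ₜ[ℂ] x))
  rw [mulCurrent_tmul, mulCurrent_tmul, deformedMul_comm, deformedMul_one_left, deformedMul_comm,
    deformedMul_one_left, coeff_tmul, coeff_tmul] at e
  exact smul_left_injective ℂ hx e

variable [FiniteDimensional ℂ g] [LieAlgebra.IsSimple ℂ g]

/-- A map in the centroid of the deformed current algebra is a multiplication, by Schur's lemma. -/
theorem exists_eq_mulCurrent (p q : ℂ) (f : CurrentAlgebra g →ₗ[ℂ] CurrentAlgebra g)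
    (hf : ∀ X Y, f (deformedLie g p q X Y) = deformedLie g p q X (f Y)) :
    ∃ r, f = mulCurrent g p q r := by
  have h1 : ∀ (x : g) (Z : CurrentAlgebra g),
      deformedLie g p q ((1 : ℂ[T;T⁻¹]) ⊗ₜ[ℂ] x) Z = ⁅(1 : ℂ[T;T⁻¹]) ⊗ₜ[ℂ] x, Z⁆ := by
    intro x Z
    induction Z using TensorProduct.induction_on with
    | zero => rw [map_zero, lie_zero]
    | tmul b y => rw [deformedLie_tmul, deformedMul_one_left, lie_tmul_tmul, one_mul]
    | add Y Z hY hZ => rw [map_add, lie_add, hY, hZ]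
  obtain ⟨y₀, hy₀⟩ := exists_ne (0 : g)
  obtain ⟨ξ, hξ⟩ := Module.Projective.exists_dual_eq_one ℂ hy₀
  let ι : g →ₗ[ℂ] CurrentAlgebra g := TensorProduct.mk ℂ ℂ[T;T⁻¹] g 1
  set r := contractRight ξ (f (ι y₀)) with hr
  have hr1 : ∀ y, f (ι y) = r ⊗ₜ[ℂ] y := by
    intro y
    refine current_ext fun m => ?_
    obtain ⟨c, hc⟩ := exists_eq_smul_of_equivariant (coeff g m ∘ₗ f ∘ₗ ι) (fun x y => by
      have e := hf (ι x) (ι y)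
      simp only [ι, TensorProduct.mk_apply] at e
      rw [deformedLie_tmul, deformedMul_one_left, h1] at e
      simp only [LinearMap.comp_apply, ι, TensorProduct.mk_apply]
      rw [e, coeff_lie])
    simp only [LinearMap.comp_apply] at hc
    rw [hc, coeff_tmul, hr, coeff_contractRight, hc, map_smul, hξ, smul_eq_mul, mul_one]
  refine ⟨r, TensorProduct.ext' fun a y => ?_⟩
  refine LinearMap.congr_fun (f := f ∘ₗ TensorProduct.mk ℂ ℂ[T;T⁻¹] g a)
    (g := mulCurrent g p q r ∘ₗ TensorProduct.mk ℂ ℂ[T;T⁻¹] g a)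
    (linearMap_ext_lie fun x y => ?_) y
  have e := hf (a ⊗ₜ x) (ι y)
  rw [hr1, deformedLie_tmul, deformedMul_comm p q a r] at e
  simp only [ι, TensorProduct.mk_apply] at e
  rw [deformedLie_tmul, deformedMul_comm, deformedMul_one_left] at e
  simpa only [LinearMap.comp_apply, TensorProduct.mk_apply, mulCurrent_tmul] using e

/-- A nontrivial deformed product yields a current algebra that is not isomorphic to the
undeformed one. An isomorphism would identify the centroids, hence the deformed algebra with the
algebra of Laurent polynomials. The element `X = A₂` is a unit and corresponds to a monomial, so
there is a derivation with `X ↦ nX`, where `n ≠ 0`; applied to `Y² = X + p + q X⁻¹`, where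
`Y = A₁`, it gives `2 Y DY = n (X - q X⁻¹)`, and the right-hand side is not a multiple of `Y`
unless `p = q = 0`. -/
theorem eq_zero_of_equiv_deformedLie {p q : ℂ} (Φ : CurrentAlgebra g ≃ₗ[ℂ] CurrentAlgebra g)
    (hΦ : ∀ X Y, Φ (deformedLie g 0 0 X Y) = deformedLie g p q (Φ X) (Φ Y)) : p = 0 ∧ q = 0 := by
  have hΦ' : ∀ X Y, Φ.symm (deformedLie g p q X Y) =
      deformedLie g 0 0 (Φ.symm X) (Φ.symm Y) := fun X Y => by
    rw [LinearEquiv.symm_apply_eq, hΦ, Φ.apply_symm_apply, Φ.apply_symm_apply]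
  -- the correspondence of multiplications, an isomorphism of algebras
  let R : ℂ[T;T⁻¹] → ℂ[T;T⁻¹] → Prop := fun s r =>
    ∀ X, Φ (mulCurrent g 0 0 s X) = mulCurrent g p q r (Φ X)
  have hθ : ∀ r, ∃ s, R s r := by
    intro r
    obtain ⟨s, hs⟩ := exists_eq_mulCurrent 0 0
      (Φ.symm.toLinearMap ∘ₗ mulCurrent g p q r ∘ₗ Φ.toLinearMap) (fun X Y => by
        simp only [LinearMap.comp_apply, LinearEquiv.coe_coe]
        rw [hΦ, mulCurrent_deformedLie, hΦ', Φ.symm_apply_apply])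
    refine ⟨s, fun X => ?_⟩
    rw [← hs]
    simp
  have hη : ∀ s, ∃ r, R s r := by
    intro s
    obtain ⟨r, hr⟩ := exists_eq_mulCurrent p q
      (Φ.toLinearMap ∘ₗ mulCurrent g 0 0 s ∘ₗ Φ.symm.toLinearMap) (fun X Y => by
        simp only [LinearMap.comp_apply, LinearEquiv.coe_coe]
        rw [hΦ', mulCurrent_deformedLie, hΦ, Φ.apply_symm_apply])
    refine ⟨r, fun X => ?_⟩
    rw [← hr]
    simp
  have hleft : ∀ {s s' r}, R s r → R s' r → s = s' := fun h h' =>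
    mulCurrent_injective (LinearMap.ext fun X => Φ.injective ((h X).trans (h' X).symm))
  have hright : ∀ {s r r'}, R s r → R s r' → r = r' := fun h h' =>
    mulCurrent_injective (LinearMap.ext fun X => by
      rw [← Φ.apply_symm_apply X, ← h, ← h'])
  have hRmul : ∀ {s r s' r'}, R s r → R s' r' → R (s * s') (deformedMul p q r r') :=
    fun h h' X => by
      rw [← deformedMul_zero_zero, ← mulCurrent_mulCurrent, h, h', mulCurrent_mulCurrent]
  have hRadd : ∀ {s r s' r'}, R s r → R s' r' → R (s + s') (r + r') := fun h h' X => by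
    rw [map_add, map_add, LinearMap.add_apply, LinearMap.add_apply, map_add, h, h']
  have hRsmul : ∀ (c : ℂ) {s r}, R s r → R (c • s) (c • r) := fun c s r h X => by
    rw [map_smul, map_smul, LinearMap.smul_apply, LinearMap.smul_apply, map_smul, h]
  have hRone : R 1 1 := by
    have : ∀ (p q : ℂ) (X : CurrentAlgebra g), mulCurrent g p q 1 X = X := fun p q X => by
      induction X using TensorProduct.induction_on with
      | zero => simp
      | tmul a x => rw [mulCurrent_tmul, deformedMul_one_left]
      | add X Y hX hY => rw [map_add, hX, hY]
    exact fun X => by rw [this, this]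
  obtain ⟨u, hu⟩ := hθ (LaurentPolynomial.T 2)
  obtain ⟨u', hu'⟩ := hθ (LaurentPolynomial.T (-2))
  obtain ⟨w, hw⟩ := hθ (LaurentPolynomial.T 1)
  have huu' : u * u' = 1 := by
    have h := hRmul hu hu'
    rw [deformedMul_T_of_even p q (Or.inl even_two), add_neg_cancel, LaurentPolynomial.T_zero] at h
    exact hleft h hRone
  have hww : w * w = u + p • 1 + q • u' := by
    have h := hRmul hw hw
    rw [deformedMul_T_of_odd p q odd_one odd_one, one_add_one_eq_two, sub_self,
      LaurentPolynomial.T_zero] at h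
    exact hleft h (hRadd (hRadd hu (hRsmul p hRone)) (hRsmul q hu'))
  obtain ⟨c, n, hc, rfl, rfl⟩ := exists_eq_smul_T_of_mul_eq_one huu'
  have hn : n ≠ 0 := by
    rintro rfl
    have h := hright hu (by rw [LaurentPolynomial.T_zero]; exact hRsmul c hRone)
    have h' := congrArg (fun a : ℂ[T;T⁻¹] => a.coeff 2) h
    rw [← LaurentPolynomial.T_zero] at h'
    simp only [AddMonoidAlgebra.coeff_smul, Finsupp.smul_apply, LaurentPolynomial.T_apply] at h'
    norm_num at h'
  obtain ⟨δ, hδT, hδ⟩ := exists_euler_derivation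
  have hδw : (2 : ℂ) • (w * δ w) =
      (n : ℂ) • (c • LaurentPolynomial.T n) +
        (-(n : ℂ) * q) • (c⁻¹ • LaurentPolynomial.T (-n)) := by
    have h := congrArg δ hww
    rw [hδ, ← LaurentPolynomial.T_zero] at h
    simp only [map_add, map_smul, hδT] at h
    rw [two_smul, h]
    push_cast
    module
  obtain ⟨r, hr⟩ := hη (δ w)
  have hYr := hright (hRsmul 2 (hRmul hw hr))
    (by rw [hδw]; exact hRadd (hRsmul _ hu) (hRsmul _ hu'))
  refine eq_zero_of_recursion (m := n / 2) (by simpa using hn) (fun j => r.coeff (2 * j - 1))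
    (r.coeff.support.image fun k => (k + 1) / 2) (fun j hj => ?_) fun j => ?_
  · by_contra h
    exact hj (Finset.mem_image.2 ⟨2 * j - 1, Finsupp.mem_support_iff.2 h, by omega⟩)
  · have h := congrArg (fun a : ℂ[T;T⁻¹] => a.coeff (2 * j)) hYr
    simp only [AddMonoidAlgebra.coeff_smul, AddMonoidAlgebra.coeff_add, Finsupp.smul_apply,
      Finsupp.add_apply, coeff_deformedMul_T_one, LaurentPolynomial.T_apply, smul_eq_mul] at h
    have e1 : 2 * (j + 1) - 1 = 2 * j + 1 := by ring
    have e2 : 2 * (j + 2) - 1 = 2 * j + 3 := by ring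
    have e3 : ((2 : ℤ) = 2 * j) = (j = 1) := by rw [eq_iff_iff]; omega
    have e4 : ((-2 : ℤ) = 2 * j) = (j = -1) := by rw [eq_iff_iff]; omega
    simp only [e3, e4] at h
    rw [e1, e2]
    split_ifs at h ⊢ <;> linear_combination h / 2

end Centroid

/-! ### Fibres of deformations -/

section Fibres

universe u v

variable {K : Type u} [Field K] {A B : Type u} [CommRing A] [Algebra K A] [CommRing B]
  [Algebra K B] {L : Type v} [LieRing L] [LieAlgebra K L]

theorem augmentation_smul (ε : A →ₐ[K] K) (a : A) (X : A ⊗[K] L) :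
    augmentation L ε (a • X) = ε a • augmentation L ε X := by
  induction X using TensorProduct.induction_on with
  | zero => simp
  | tmul b x => simp [TensorProduct.smul_tmul', mul_smul]
  | add X Y hX hY => simp [hX, hY]

theorem fiberBracket_apply (ε : A →ₐ[K] K) (μ : A ⊗[K] L →ₗ[A] A ⊗[K] L →ₗ[A] A ⊗[K] L)
    (x y : L) :
    fiberBracket ε μ x y = augmentation L ε (μ ((1 : A) ⊗ₜ[K] x) ((1 : A) ⊗ₜ[K] y)) := rfl

theorem tmul_eq_smul_one_tmul (a : A) (x : L) : a ⊗ₜ[K] x = a • ((1 : A) ⊗ₜ[K] x) := by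
  rw [TensorProduct.smul_tmul', smul_eq_mul, mul_one]

/-- The map to the fibre over a point is a homomorphism to the bracket of the fibre. -/
theorem augmentation_bracket (ε : A →ₐ[K] K) (μ : A ⊗[K] L →ₗ[A] A ⊗[K] L →ₗ[A] A ⊗[K] L)
    (X Y : A ⊗[K] L) :
    augmentation L ε (μ X Y) = fiberBracket ε μ (augmentation L ε X) (augmentation L ε Y) := by
  induction X using TensorProduct.induction_on with
  | zero => simp
  | add X Z hX hZ => simp only [map_add, LinearMap.add_apply, hX, hZ]
  | tmul a x =>
    induction Y using TensorProduct.induction_on with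
    | zero => simp
    | add Y Z hY hZ => simp only [map_add, hY, hZ]
    | tmul b y =>
      rw [augmentation_tmul, augmentation_tmul, LinearMap.map_smul₂, map_smul, fiberBracket_apply,
        tmul_eq_smul_one_tmul a, tmul_eq_smul_one_tmul b, LinearMap.map_smul₂,
        map_smul (μ ((1 : A) ⊗ₜ[K] x)), augmentation_smul, augmentation_smul]

theorem augmentation_map (f : A →ₐ[K] B) (ε : B →ₐ[K] K) (X : A ⊗[K] L) :
    augmentation L ε (TensorProduct.map f.toLinearMap LinearMap.id X) =
      augmentation L (ε.comp f) X := by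
  induction X using TensorProduct.induction_on with
  | zero => simp
  | tmul a x => simp
  | add X Y hX hY => simp [hX, hY]

theorem fiberBracket_pushout (f : A →ₐ[K] B) (ε : B →ₐ[K] K)
    (μ : A ⊗[K] L →ₗ[A] A ⊗[K] L →ₗ[A] A ⊗[K] L) :
    fiberBracket ε (pushout f μ) = fiberBracket (ε.comp f) μ := by
  ext x y
  rw [fiberBracket_apply, pushout_tmul, mul_one, one_smul, augmentation_map, fiberBracket_apply]

theorem fiberBracket_trivialBracket (ε : A →ₐ[K] K) (x y : L) :
    fiberBracket ε (trivialBracket K A L) x y = ⁅x, y⁆ := by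
  rw [fiberBracket_apply, trivialBracket_tmul, mul_one, augmentation_tmul, map_one, one_smul]

/-- A linear automorphism of `A ⊗ L` induces automorphisms of the fibres. -/
theorem exists_equiv_fiber (ε : A →ₐ[K] K) (φ : A ⊗[K] L ≃ₗ[A] A ⊗[K] L) :
    ∃ Φ : L ≃ₗ[K] L, ∀ X, augmentation L ε (φ X) = Φ (augmentation L ε X) := by
  have key : ∀ ψ : A ⊗[K] L →ₗ[A] A ⊗[K] L, ∃ Ψ : L →ₗ[K] L,
      ∀ X, augmentation L ε (ψ X) = Ψ (augmentation L ε X) := fun ψ => by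
    refine ⟨augmentation L ε ∘ₗ ψ.restrictScalars K ∘ₗ TensorProduct.mk K A L 1, fun X => ?_⟩
    induction X using TensorProduct.induction_on with
    | zero => simp
    | tmul a x =>
      rw [augmentation_tmul, map_smul, tmul_eq_smul_one_tmul, map_smul, augmentation_smul]
      rfl
    | add X Y hX hY => rw [map_add, map_add, hX, hY, map_add, map_add]
  obtain ⟨Φ, hΦ⟩ := key φ.toLinearMap
  obtain ⟨Ψ, hΨ⟩ := key φ.symm.toLinearMap
  have hone : ∀ x : L, augmentation L ε ((1 : A) ⊗ₜ[K] x) = x := fun x => by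
    rw [augmentation_tmul, map_one, one_smul]
  refine ⟨LinearEquiv.ofLinearMap Φ Ψ (LinearMap.ext fun x => ?_) (LinearMap.ext fun x => ?_), hΦ⟩
  · rw [LinearMap.comp_apply, ← hone x, ← hΨ, ← hΦ]
    simp
  · rw [LinearMap.comp_apply, ← hone x, ← hΦ, ← hΨ]
    simp

/-- An equivalence with the trivial deformation trivialises every fibre, not only the special
one. -/
theorem IsEquivalent.exists_equiv_fiber {p : A ⊗[K] L →ₗ[K] L}
    {μ : A ⊗[K] L →ₗ[A] A ⊗[K] L →ₗ[A] A ⊗[K] L} (h : IsEquivalent p μ (trivialBracket K A L))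
    (ε : A →ₐ[K] K) : ∃ Φ : L ≃ₗ[K] L, ∀ x y, Φ ⁅x, y⁆ = fiberBracket ε μ (Φ x) (Φ y) := by
  obtain ⟨φ, hφ, -⟩ := h
  obtain ⟨Φ, hΦ⟩ := CurrentRigidity.exists_equiv_fiber ε φ
  have hone : ∀ x : L, augmentation L ε ((1 : A) ⊗ₜ[K] x) = x := fun x => by
    rw [augmentation_tmul, map_one, one_smul]
  have hbr : ∀ x y, Φ (fiberBracket ε μ x y) = ⁅Φ x, Φ y⁆ := fun x y => by
    rw [fiberBracket_apply, ← hΦ, hφ, augmentation_bracket, fiberBracket_trivialBracket, hΦ, hΦ,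
      hone, hone]
  refine ⟨Φ.symm, fun x y => ?_⟩
  rw [LinearEquiv.symm_apply_eq, hbr, Φ.apply_symm_apply, Φ.apply_symm_apply]

end Fibres

/-! ### The Krichever-Novikov families -/

section Families

variable {g : Type*} [LieRing g] [LieAlgebra ℂ g]

theorem current_linearMap_ext {V : Type*} [AddCommGroup V] [Module ℂ V]
    {f f' : CurrentAlgebra g →ₗ[ℂ] V}
    (h : ∀ n x, f (LaurentPolynomial.T n ⊗ₜ x) = f' (LaurentPolynomial.T n ⊗ₜ x)) : f = f' :=
  TensorProduct.ext (linearMap_ext_T (V := g →ₗ[ℂ] V) fun n => LinearMap.ext fun x => h n x)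

theorem deformedLie_zero_zero (X Y : CurrentAlgebra g) : deformedLie g 0 0 X Y = ⁅X, Y⁆ := by
  induction X using TensorProduct.induction_on with
  | zero => rw [map_zero, LinearMap.zero_apply, zero_lie]
  | add X Z hX hZ => rw [map_add, LinearMap.add_apply, hX, hZ, add_lie]
  | tmul a x =>
    induction Y using TensorProduct.induction_on with
    | zero => rw [map_zero, lie_zero]
    | add Y Z hY hZ => rw [map_add, hY, hZ, lie_add]
    | tmul b y => rw [deformedLie_tmul, deformedMul_zero_zero, lie_tmul_tmul]

variable {A : Type} [CommRing A] [Algebra ℂ A]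

theorem fiberBracket_currentBracket (ε : A →ₐ[ℂ] ℂ) (p q : A) :
    fiberBracket ε (currentBracket g p q) = deformedLie g (ε p) (ε q) := by
  set F := fiberBracket ε (currentBracket g p q) with hF
  have hT : ∀ n m (x y : g), F (LaurentPolynomial.T n ⊗ₜ x) (LaurentPolynomial.T m ⊗ₜ y) =
      deformedLie g (ε p) (ε q) (LaurentPolynomial.T n ⊗ₜ x) (LaurentPolynomial.T m ⊗ₜ y) := by
    intro n m x y
    rw [hF, fiberBracket_apply, currentBracket_T, deformedLie_tmul]
    by_cases h : Even n ∨ Even m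
    · rw [if_pos h, deformedMul_T_of_even _ _ h, augmentation_tmul, map_one, one_smul]
    · rw [if_neg h]
      push Not at h
      rw [Int.not_even_iff_odd, Int.not_even_iff_odd] at h
      rw [deformedMul_T_of_odd _ _ h.1 h.2, map_add, map_add, augmentation_tmul,
        augmentation_tmul, augmentation_tmul, map_one, one_smul, TensorProduct.add_tmul,
        TensorProduct.add_tmul, TensorProduct.smul_tmul', TensorProduct.smul_tmul']
  have hY : ∀ m (y : g), F.flip (LaurentPolynomial.T m ⊗ₜ y) =
      (deformedLie g (ε p) (ε q)).flip (LaurentPolynomial.T m ⊗ₜ y) := fun m y =>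
    current_linearMap_ext fun n x => hT n m x y
  refine LinearMap.ext fun X => current_linearMap_ext fun m y => ?_
  exact LinearMap.congr_fun (hY m y) X

/-- `A`-linear maps on `A ⊗ (ℂ[z, z⁻¹] ⊗ g)` are determined by the values on the elements
`1 ⊗ zⁿ ⊗ x`. -/
theorem eq_zero_of_T {V : Type*} [AddCommGroup V] [Module A V]
    (f : A ⊗[ℂ] CurrentAlgebra g →ₗ[A] V)
    (h : ∀ n x, f (1 ⊗ₜ (LaurentPolynomial.T n ⊗ₜ x)) = 0) (X : A ⊗[ℂ] CurrentAlgebra g) :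
    f X = 0 := by
  let _ : Module ℂ V := Module.compHom V (algebraMap ℂ A)
  have _ : IsScalarTower ℂ A V := IsScalarTower.of_algebraMap_smul fun _ _ => rfl
  have h1 : f.restrictScalars ℂ ∘ₗ TensorProduct.mk ℂ A (CurrentAlgebra g) 1 = 0 :=
    current_linearMap_ext h
  induction X using TensorProduct.induction_on with
  | zero => simp
  | tmul a x =>
    rw [tmul_eq_smul_one_tmul, map_smul]
    exact (congrArg (a • ·) (LinearMap.congr_fun h1 x)).trans (smul_zero a)
  | add X Y hX hY => rw [map_add, hX, hY, add_zero]

theorem currentBracket_T_of_even (p q : A) {n m : ℤ} (h : Even n ∨ Even m) (x y : g) :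
    currentBracket g p q (1 ⊗ₜ (LaurentPolynomial.T n ⊗ₜ x)) (1 ⊗ₜ (LaurentPolynomial.T m ⊗ₜ y)) =
      1 ⊗ₜ (LaurentPolynomial.T (n + m) ⊗ₜ ⁅x, y⁆) := by
  rw [currentBracket_T, if_pos h]

theorem currentBracket_T_of_odd (p q : A) {n m : ℤ} (hn : Odd n) (hm : Odd m) (x y : g) :
    currentBracket g p q (1 ⊗ₜ (LaurentPolynomial.T n ⊗ₜ x)) (1 ⊗ₜ (LaurentPolynomial.T m ⊗ₜ y)) =
      1 ⊗ₜ (LaurentPolynomial.T (n + m) ⊗ₜ ⁅x, y⁆) +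
        p • 1 ⊗ₜ (LaurentPolynomial.T (n + m - 2) ⊗ₜ ⁅x, y⁆) +
        q • 1 ⊗ₜ (LaurentPolynomial.T (n + m - 4) ⊗ₜ ⁅x, y⁆) := by
  rw [currentBracket_T, if_neg, tmul_eq_smul_one_tmul p, tmul_eq_smul_one_tmul q]
  rw [Int.not_even_iff_odd.symm] at hn hm
  tauto

/-- A bracket of three generators is deformed if at least two exponents are odd. -/
theorem currentBracket_T_T_T (p q : A) (n m k : ℤ) (x y z : g) :
    currentBracket g p q (1 ⊗ₜ (LaurentPolynomial.T n ⊗ₜ x))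
      (currentBracket g p q (1 ⊗ₜ (LaurentPolynomial.T m ⊗ₜ y))
        (1 ⊗ₜ (LaurentPolynomial.T k ⊗ₜ z))) =
      if (Odd n ∧ Odd m) ∨ (Odd m ∧ Odd k) ∨ (Odd k ∧ Odd n) then
        1 ⊗ₜ (LaurentPolynomial.T (n + m + k) ⊗ₜ ⁅x, ⁅y, z⁆⁆) +
          p • 1 ⊗ₜ (LaurentPolynomial.T (n + m + k - 2) ⊗ₜ ⁅x, ⁅y, z⁆⁆) +
          q • 1 ⊗ₜ (LaurentPolynomial.T (n + m + k - 4) ⊗ₜ ⁅x, ⁅y, z⁆⁆)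
      else 1 ⊗ₜ (LaurentPolynomial.T (n + m + k) ⊗ₜ ⁅x, ⁅y, z⁆⁆) := by
  by_cases h : Odd m ∧ Odd k
  · have he : Even (m + k) := h.1.add_odd h.2
    rw [if_pos (by tauto), currentBracket_T_of_odd p q h.1 h.2, map_add, map_add, map_smul,
      map_smul, currentBracket_T_of_even p q (Or.inr he),
      currentBracket_T_of_even p q (Or.inr (he.sub even_two)),
      currentBracket_T_of_even p q (Or.inr (he.sub (by decide : Even (4 : ℤ)))),
      show n + (m + k) = n + m + k by ring, show n + (m + k - 2) = n + m + k - 2 by ring,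
      show n + (m + k - 4) = n + m + k - 4 by ring]
  · have h' : Even m ∨ Even k := by
      rw [← Int.not_odd_iff_even, ← Int.not_odd_iff_even]; tauto
    rw [currentBracket_T_of_even p q h']
    by_cases hn : Odd n ∧ Odd (m + k)
    · rw [if_pos, currentBracket_T_of_odd p q hn.1 hn.2, add_assoc n m k]
      have := hn.2
      rw [Int.odd_add, ← Int.not_odd_iff_even] at this
      tauto
    · have hn' : Even n ∨ Even (m + k) := by
        rw [← Int.not_odd_iff_even, ← Int.not_odd_iff_even]; tauto
      rw [if_neg, currentBracket_T_of_even p q hn', add_assoc n m k]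
      rw [Int.odd_add, ← Int.not_odd_iff_even] at hn
      tauto

theorem currentBracket_skew (p q : A) (X Y : A ⊗[ℂ] CurrentAlgebra g) :
    currentBracket g p q X Y = -currentBracket g p q Y X := by
  rw [← add_eq_zero_iff_eq_neg]
  refine eq_zero_of_T ((currentBracket g p q).flip Y + currentBracket g p q Y) (fun n x => ?_) X
  refine eq_zero_of_T (currentBracket g p q (1 ⊗ₜ (LaurentPolynomial.T n ⊗ₜ x)) +
    (currentBracket g p q).flip (1 ⊗ₜ (LaurentPolynomial.T n ⊗ₜ x))) (fun m y => ?_) Y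
  rw [LinearMap.add_apply, LinearMap.flip_apply]
  by_cases h : Even n ∨ Even m
  · rw [currentBracket_T_of_even p q h, currentBracket_T_of_even p q h.symm, ← lie_skew x y,
      add_comm m n]
    simp only [TensorProduct.tmul_neg]
    abel
  · push Not at h
    rw [Int.not_even_iff_odd, Int.not_even_iff_odd] at h
    rw [currentBracket_T_of_odd p q h.1 h.2, currentBracket_T_of_odd p q h.2 h.1, ← lie_skew x y,
      add_comm m n]
    simp only [TensorProduct.tmul_neg, smul_neg]
    abel

theorem currentBracket_jacobi (p q : A) (X Y Z : A ⊗[ℂ] CurrentAlgebra g) :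
    currentBracket g p q X (currentBracket g p q Y Z) +
      currentBracket g p q Y (currentBracket g p q Z X) +
      currentBracket g p q Z (currentBracket g p q X Y) = 0 := by
  set μ := currentBracket g p q with hμ
  have hT : ∀ n m k (x y z : g),
      μ (1 ⊗ₜ (LaurentPolynomial.T n ⊗ₜ x)) (μ (1 ⊗ₜ (LaurentPolynomial.T m ⊗ₜ y))
        (1 ⊗ₜ (LaurentPolynomial.T k ⊗ₜ z))) +
      μ (1 ⊗ₜ (LaurentPolynomial.T m ⊗ₜ y)) (μ (1 ⊗ₜ (LaurentPolynomial.T k ⊗ₜ z))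
        (1 ⊗ₜ (LaurentPolynomial.T n ⊗ₜ x))) +
      μ (1 ⊗ₜ (LaurentPolynomial.T k ⊗ₜ z)) (μ (1 ⊗ₜ (LaurentPolynomial.T n ⊗ₜ x))
        (1 ⊗ₜ (LaurentPolynomial.T m ⊗ₜ y))) = 0 := by
    intro n m k x y z
    have hj : ∀ j : ℤ, (1 : A) ⊗ₜ[ℂ] ((LaurentPolynomial.T j : ℂ[T;T⁻¹]) ⊗ₜ[ℂ] ⁅x, ⁅y, z⁆⁆) +
        (1 : A) ⊗ₜ[ℂ] ((LaurentPolynomial.T j : ℂ[T;T⁻¹]) ⊗ₜ[ℂ] ⁅y, ⁅z, x⁆⁆) +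
        (1 : A) ⊗ₜ[ℂ] ((LaurentPolynomial.T j : ℂ[T;T⁻¹]) ⊗ₜ[ℂ] ⁅z, ⁅x, y⁆⁆) = 0 := fun j => by
      rw [← TensorProduct.tmul_add, ← TensorProduct.tmul_add, ← TensorProduct.tmul_add,
        ← TensorProduct.tmul_add, lie_jacobi, TensorProduct.tmul_zero, TensorProduct.tmul_zero]
    rw [hμ, currentBracket_T_T_T, currentBracket_T_T_T, currentBracket_T_T_T,
      show m + k + n = n + m + k by ring, show k + n + m = n + m + k by ring]
    by_cases h : (Odd n ∧ Odd m) ∨ (Odd m ∧ Odd k) ∨ (Odd k ∧ Odd n)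
    · rw [if_pos h, if_pos (by tauto), if_pos (by tauto)]
      linear_combination (norm := module) hj (n + m + k) + p • hj (n + m + k - 2) +
        q • hj (n + m + k - 4)
    · rw [if_neg h, if_neg (by tauto), if_neg (by tauto)]
      exact hj _
  refine eq_zero_of_T (μ.flip (μ Y Z) + μ Y ∘ₗ μ Z + μ Z ∘ₗ μ.flip Y) (fun n x => ?_) X
  refine eq_zero_of_T (μ (1 ⊗ₜ (LaurentPolynomial.T n ⊗ₜ x)) ∘ₗ μ.flip Z +
    μ.flip (μ Z (1 ⊗ₜ (LaurentPolynomial.T n ⊗ₜ x))) +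
    μ Z ∘ₗ μ (1 ⊗ₜ (LaurentPolynomial.T n ⊗ₜ x))) (fun m y => ?_) Y
  exact eq_zero_of_T (μ (1 ⊗ₜ (LaurentPolynomial.T n ⊗ₜ x)) ∘ₗ
    μ (1 ⊗ₜ (LaurentPolynomial.T m ⊗ₜ y)) +
    μ (1 ⊗ₜ (LaurentPolynomial.T m ⊗ₜ y)) ∘ₗ μ.flip (1 ⊗ₜ (LaurentPolynomial.T n ⊗ₜ x)) +
    μ.flip (μ (1 ⊗ₜ (LaurentPolynomial.T n ⊗ₜ x)) (1 ⊗ₜ (LaurentPolynomial.T m ⊗ₜ y))))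
    (fun k z => hT n m k x y z) Z

theorem isDeformation_currentBracket (ε : A →ₐ[ℂ] ℂ) {p q : A} (hp : ε p = 0) (hq : ε q = 0) :
    IsDeformation (augmentation (CurrentAlgebra g) ε) (currentBracket g p q) where
  alternating X := by
    have h := currentBracket_skew p q X X
    linear_combination (norm := module) (1 / 2 : ℂ) • h
  jacobi := currentBracket_jacobi p q
  map_bracket X Y := by
    rw [augmentation_bracket, fiberBracket_currentBracket, hp, hq, deformedLie_zero_zero]

theorem point_lineCoefficients_zero (s : OnePoint ℂ) :
    point 0 (lineCoefficients s).1 = 0 ∧ point 0 (lineCoefficients s).2 = 0 := by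
  induction s using OnePoint.rec <;> simp [point, lineCoefficients]

theorem eq_zero_of_point_lineCoefficients {s : OnePoint ℂ} {c : ℂ}
    (h : point c (lineCoefficients s).1 = 0 ∧ point c (lineCoefficients s).2 = 0) : c = 0 := by
  induction s using OnePoint.rec with
  | infty => simpa [point, lineCoefficients] using h
  | coe s => simpa [point, lineCoefficients] using h.1

variable (g) in
theorem isDeformation_lineFamily (s : OnePoint ℂ) :
    IsDeformation (augmentation (CurrentAlgebra g) (point 0)) (lineFamily g s) :=
  isDeformation_currentBracket _ (point_lineCoefficients_zero s).1 (point_lineCoefficients_zero s).2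

/-- The fibres away from the base point are not isomorphic to the current algebra. -/
theorem eq_zero_of_equiv_fiber [FiniteDimensional ℂ g] [LieAlgebra.IsSimple ℂ g] {s : OnePoint ℂ}
    {c : ℂ} (Φ : CurrentAlgebra g ≃ₗ[ℂ] CurrentAlgebra g)
    (hΦ : ∀ X Y, Φ ⁅X, Y⁆ = fiberBracket (point c) (lineFamily g s) (Φ X) (Φ Y)) : c = 0 := by
  refine eq_zero_of_point_lineCoefficients (s := s) (eq_zero_of_equiv_deformedLie Φ fun X Y => ?_)
  rw [deformedLie_zero_zero, hΦ, lineFamily, fiberBracket_currentBracket]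

end Families

/-! ### The families are not trivial near the base point -/

section Neighbourhoods

variable {L : Type*} [LieRing L] [LieAlgebra ℂ L]

theorem point_apply (c : ℂ) (f : ℂ[X]) : point c f = f.eval c := by
  simp [point, Polynomial.aeval_def, Polynomial.eval₂_eq_eval_map]

theorem IsAnalyticSection.zero {U : Set ℂ} :
    IsAnalyticSection ℂ ℂ U (fun _ => (0 : L)) :=
  fun _ _ => ⟨0, Fin.elim0, Fin.elim0, fun i => i.elim0, by simp⟩

theorem IsAnalyticSection.add {U : Set ℂ} {s s' : ℂ → L} (hs : IsAnalyticSection ℂ ℂ U s)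
    (hs' : IsAnalyticSection ℂ ℂ U s') : IsAnalyticSection ℂ ℂ U (fun t => s t + s' t) := by
  intro x hx
  obtain ⟨n, f, l, hf, h⟩ := hs x hx
  obtain ⟨n', f', l', hf', h'⟩ := hs' x hx
  refine ⟨n + n', Fin.append f f', Fin.append l l', fun i => ?_, ?_⟩
  · refine Fin.addCases (fun i => ?_) (fun i => ?_) i
    · rw [Fin.append_left]; exact hf i
    · rw [Fin.append_right]; exact hf' i
  · filter_upwards [h, h'] with y hy hy'
    rw [hy, hy', Fin.sum_univ_add]
    simp only [Fin.append_left, Fin.append_right]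

theorem isAnalyticSection_augmentation (U : Set ℂ) (Z : ℂ[X] ⊗[ℂ] L) :
    IsAnalyticSection ℂ ℂ U (fun t => augmentation L (point t) Z) := by
  induction Z using TensorProduct.induction_on with
  | zero => simpa only [map_zero] using IsAnalyticSection.zero
  | tmul f l =>
    refine fun x _ => ⟨1, fun _ t => f.eval t, fun _ => l, fun _ => ?_, ?_⟩
    · rw [contMDiffAt_iff_contDiffAt]
      simpa only [Polynomial.coe_aeval_eq_eval] using
        (Polynomial.contDiff_aeval (𝕜 := ℂ) f ω).contDiffAt
    · refine Filter.Eventually.of_forall fun t => ?_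
      simp [point_apply]
  | add X Y hX hY => simpa only [map_add] using hX.add hY

/-- The fibres of an algebraic family over the affine line form an analytic family. -/
theorem IsDeformation.isAnalyticDeformation_fiberBracket
    {μ : ℂ[X] ⊗[ℂ] L →ₗ[ℂ[X]] ℂ[X] ⊗[ℂ] L →ₗ[ℂ[X]] ℂ[X] ⊗[ℂ] L}
    (h : IsDeformation (augmentation L (point 0)) μ) :
    IsAnalyticDeformation ℂ (0 : ℂ) (fun e => fiberBracket (point e) μ) := by
  have hone : ∀ t (x : L), augmentation L (point t) ((1 : ℂ[X]) ⊗ₜ[ℂ] x) = x := fun t x => by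
    rw [augmentation_tmul, map_one, one_smul]
  refine ⟨fun t x => ?_, fun t x y z => ?_, fun x y => ?_, fun x y => ?_⟩
  · rw [fiberBracket_apply, h.alternating, map_zero]
  · have hj := congrArg (augmentation L (point t))
      (h.jacobi ((1 : ℂ[X]) ⊗ₜ[ℂ] x) ((1 : ℂ[X]) ⊗ₜ[ℂ] y) ((1 : ℂ[X]) ⊗ₜ[ℂ] z))
    simpa only [map_add, map_zero, augmentation_bracket, hone] using hj
  · rw [fiberBracket_apply, h.map_bracket, hone, hone]
  · exact isAnalyticSection_augmentation _ _

/-- A Zariski neighbourhood of the origin of the affine line contains further points. -/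
theorem IsAffineNeighbourhood.exists_point_ne_zero {B : Type} [CommRing B] [Algebra ℂ B]
    {f : ℂ[X] →ₐ[ℂ] B} {ε : B →ₐ[ℂ] ℂ} (h : IsAffineNeighbourhood (point 0) f ε) :
    ∃ c : ℂ, c ≠ 0 ∧ ∃ ε' : B →ₐ[ℂ] ℂ, ε'.comp f = point c := by
  obtain ⟨hf, hε⟩ := h
  set F := AlgebraicGeometry.Spec.map (CommRingCat.ofHom (f : ℂ[X] →+* B)) with hF
  let pt : ℂ → PrimeSpectrum ℂ[X] := fun c =>
    PrimeSpectrum.comap (point c : ℂ[X] →+* ℂ) ⊥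
  have hopen : IsOpen (Set.range (PrimeSpectrum.comap (f : ℂ[X] →+* B))) :=
    F.isOpenEmbedding.isOpen_range
  have hmem : pt 0 ∈ Set.range (PrimeSpectrum.comap (f : ℂ[X] →+* B)) :=
    ⟨PrimeSpectrum.comap (ε : B →+* ℂ) ⊥, by
      rw [← PrimeSpectrum.comap_comp_apply]
      simp only [pt, ← hε]
      rfl⟩
  obtain ⟨_, ⟨p, rfl⟩, hp0, hp⟩ :=
    PrimeSpectrum.isTopologicalBasis_basic_opens.exists_subset_of_mem_open hmem hopen
  have hpt : ∀ c, pt c ∈ PrimeSpectrum.basicOpen p ↔ p.eval c ≠ 0 := fun c => by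
    rw [PrimeSpectrum.mem_basicOpen, ← point_apply]
    exact not_congr (by simp [pt])
  have hp1 : p ≠ 0 := by
    rintro rfl
    exact (hpt 0).1 hp0 (by simp)
  obtain ⟨c, hc⟩ := Polynomial.exists_eval_ne_zero_of_natDegree_lt_card (Polynomial.X * p)
    (mul_ne_zero Polynomial.X_ne_zero hp1)
    (Cardinal.natCast_lt_aleph0.trans_le (Cardinal.aleph0_le_mk ℂ))
  rw [Polynomial.eval_mul, Polynomial.eval_X] at hc
  refine ⟨c, left_ne_zero_of_mul hc, ?_⟩
  -- the point `c` lies in the image of the open immersion, so its inclusion factors through it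
  set G := AlgebraicGeometry.Spec.map (CommRingCat.ofHom (point c : ℂ[X] →+* ℂ)) with hG
  have hrange : Set.range G ⊆ Set.range F := by
    rintro _ ⟨x, rfl⟩
    refine hp ?_
    have : G x = pt c := by
      show PrimeSpectrum.comap _ x = PrimeSpectrum.comap _ ⊥
      congr 1
      exact Subsingleton.elim (α := PrimeSpectrum ℂ) _ _
    rw [this]
    exact (hpt c).2 (right_ne_zero_of_mul hc)
  obtain ⟨r, hr⟩ := AlgebraicGeometry.Spec.map_surjective
    (AlgebraicGeometry.IsOpenImmersion.lift F G hrange)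
  have hcomp : CategoryTheory.CategoryStruct.comp (CommRingCat.ofHom (f : ℂ[X] →+* B)) r =
      CommRingCat.ofHom (point c : ℂ[X] →+* ℂ) := by
    apply AlgebraicGeometry.Spec.map_injective
    rw [AlgebraicGeometry.Spec.map_comp, hr]
    exact AlgebraicGeometry.IsOpenImmersion.lift_fac F G hrange
  have hr' : ∀ a, r.hom (f a) = point c a := fun a =>
    congrArg (fun k : CommRingCat.of ℂ[X] ⟶ CommRingCat.of ℂ => k.hom a) hcomp
  refine ⟨{ r.hom with commutes' := fun a => ?_ }, AlgHom.ext hr'⟩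
  have := hr' (algebraMap ℂ ℂ[X] a)
  rwa [AlgHom.commutes, AlgHom.commutes] at this

variable {g : Type*} [LieRing g] [LieAlgebra ℂ g] [FiniteDimensional ℂ g]
  [LieAlgebra.IsSimple ℂ g]

theorem IsAffineNeighbourhood.not_isEquivalent_pushout_lineFamily {B : Type} [CommRing B]
    [Algebra ℂ B] {f : ℂ[X] →ₐ[ℂ] B} {ε : B →ₐ[ℂ] ℂ} (h : IsAffineNeighbourhood (point 0) f ε)
    (s : OnePoint ℂ) (p : B ⊗[ℂ] CurrentAlgebra g →ₗ[ℂ] CurrentAlgebra g) :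
    ¬ IsEquivalent p (pushout f (lineFamily g s)) (trivialBracket ℂ B (CurrentAlgebra g)) := by
  intro he
  obtain ⟨c, hc, ε', hε'⟩ := h.exists_point_ne_zero
  obtain ⟨Φ, hΦ⟩ := he.exists_equiv_fiber ε'
  rw [fiberBracket_pushout, hε'] at hΦ
  exact hc (eq_zero_of_equiv_fiber Φ hΦ)

theorem not_isAnalyticallyTrivialOn_lineFamily {U : Set ℂ} (hU : IsOpen U) (h0 : (0 : ℂ) ∈ U)
    (s : OnePoint ℂ) : ¬ IsAnalyticallyTrivialOn ℂ (0 : ℂ) U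
      (fun e => fiberBracket (point e) (lineFamily g s)) := by
  rintro ⟨φ, -, -, hφ, -⟩
  have hev : ∀ᶠ c in 𝓝[≠] (0 : ℂ), c ∈ U := nhdsWithin_le_nhds (hU.mem_nhds h0)
  obtain ⟨c, hcU, hc⟩ := (hev.and self_mem_nhdsWithin).exists
  exact hc (eq_zero_of_equiv_fiber (φ c) (hφ c hcU))

variable (g)

theorem not_isGeometricallyRigid_currentAlgebra :
    ¬ IsGeometricallyRigid ℂ (CurrentAlgebra g) := by
  intro h
  obtain ⟨B, _, _, f, ε, hf, he⟩ := h ℂ[X] (point 0) _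
    (isDeformation_lineFamily g ((0 : ℂ) : OnePoint ℂ))
  exact hf.not_isEquivalent_pushout_lineFamily _ _ he

theorem not_isAnalyticallyRigid_currentAlgebra :
    ¬ IsAnalyticallyRigid ℂ (CurrentAlgebra g) := by
  intro h
  obtain ⟨U, hU, h0, ht⟩ := h ℂ ℂ 0 _
    (isDeformation_lineFamily g ((0 : ℂ) : OnePoint ℂ)).isAnalyticDeformation_fiberBracket
  exact not_isAnalyticallyTrivialOn_lineFamily hU h0 _ ht

end Neighbourhoods

end CurrentRigidity

end

theorem mainTheorem1 (g : Type*) [LieRing g] [LieAlgebra ℂ g] [FiniteDimensional ℂ g]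
    [LieAlgebra.IsSimple ℂ g] :
    CurrentRigidity.IsFormallyRigid ℂ (CurrentRigidity.CurrentAlgebra g) ∧
    ¬ CurrentRigidity.IsGeometricallyRigid ℂ (CurrentRigidity.CurrentAlgebra g) ∧
    ¬ CurrentRigidity.IsAnalyticallyRigid ℂ (CurrentRigidity.CurrentAlgebra g) ∧
    ∀ s : OnePoint ℂ,
      -- the family is a deformation over `ℂ[e]` with special fibre at `e = 0`
      CurrentRigidity.IsDeformation
        (CurrentRigidity.augmentation (CurrentRigidity.CurrentAlgebra g) (CurrentRigidity.point 0))
        (CurrentRigidity.lineFamily g s) ∧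
      -- it is non-trivial on every affine Zariski open neighbourhood of `e = 0`
      (∀ (B : Type) [CommRing B] [Algebra ℂ B] (f : ℂ[X] →ₐ[ℂ] B) (ε : B →ₐ[ℂ] ℂ),
        CurrentRigidity.IsAffineNeighbourhood (CurrentRigidity.point 0) f ε →
        ¬ CurrentRigidity.IsEquivalent
          (CurrentRigidity.augmentation (CurrentRigidity.CurrentAlgebra g) ε)
          (CurrentRigidity.pushout f (CurrentRigidity.lineFamily g s))
          (CurrentRigidity.trivialBracket ℂ B (CurrentRigidity.CurrentAlgebra g))) ∧
      -- the family of its fibres over the complex line is analytic, and it is non-trivial on every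
      -- open neighbourhood of `e = 0` in the usual topology
      CurrentRigidity.IsAnalyticDeformation ℂ (0 : ℂ)
        (fun e : ℂ => CurrentRigidity.fiberBracket (CurrentRigidity.point e)
          (CurrentRigidity.lineFamily g s)) ∧
      ∀ U : Set ℂ, IsOpen U → 0 ∈ U →
        ¬ CurrentRigidity.IsAnalyticallyTrivialOn ℂ (0 : ℂ) U
          (fun e : ℂ => CurrentRigidity.fiberBracket (CurrentRigidity.point e)
            (CurrentRigidity.lineFamily g s)) := by
  refine ⟨CurrentRigidity.isFormallyRigid_of_cocycle fun σ h => h.exists_eq_coboundary,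
    CurrentRigidity.not_isGeometricallyRigid_currentAlgebra g,
    CurrentRigidity.not_isAnalyticallyRigid_currentAlgebra g, fun s => ?_⟩
  have hs := CurrentRigidity.isDeformation_lineFamily g s
  exact ⟨hs, fun B _ _ f ε hf => hf.not_isEquivalent_pushout_lineFamily s _,
    hs.isAnalyticDeformation_fiberBracket,
    fun U hU h0 => CurrentRigidity.not_isAnalyticallyTrivialOn_lineFamily hU h0 s⟩
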